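/- Conventions. Manifolds are smooth, Hausdorff and second countable. Let $\pi\colon E\to M$ be a smooth fibre bundle. A transgressive generating set on $E$ is a finite ordered family $\Psi=(\psi_1,\dots,\psi_N)$ of forms of odd degree on $E$ with $d\psi_i=\pi^*c_i$ for forms $c_i\in\Omega^\bullet(M)$, whose restrictions to each fibre are closed with classes that freely generate the (real) de Rham cohomology algebra of the fibre. Its transgressive complex is $\Omega_\Psi=\wedge^\bullet\langle\Psi\rangle\otimes\Omega^\bullet(M)\subset\Omega^\bullet(E)$, with the differential for which $d\psi_i=c_i$. Put $V^*=\langle\Psi\rangle$. The Clifford algebra $\mathrm{Clif}(V\oplus V^*)$ of the natural pairing acts on $\wedge^\bullet V^*$ by interior and exterior products, and the bundle $$C_{\langle\Psi\rangle}=TM\oplus\big(\mathrm{Clif}(V\oplus V^*)\otimes\wedge^\bullet T^*M\big)^{od}$$ acts on $\wedge^\bullet V^*\otimes\wedge^\bullet T^*M$, tangent vectors acting by interior product. For a closed odd form $H\in\Omega_\Psi$ put $d^H=d+H\wedge$. The bracket $[\![v,w]\!]_H$ of sections $v,w$ of $C_{\langle\Psi\rangle}$ is the section that acts on $\Omega_\Psi$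 as $\{\{v,d^H\},w\}$, where $\{\cdot,\cdot\}$ is the graded commutator. The Clifford–Courant algebroid is $C_{\langle\Psi\rangle}$ with this bracket. T-duality. Let $(E,H,\Psi)\to M$ and $(\hat E,\hat H,\hat\Psi)\to M$ be two such fibre bundles with transgressive generating sets and closed odd forms $H\in\Omega_\Psi$, $\hat H\in\Omega_{\hat\Psi}$. Let $p^*$ and $\hat p^*$ be the inclusions of $\Omega_\Psi$ and $\Omega_{\hat\Psi}$ in $\Omega_{\Psi\cup\hat\Psi}=\wedge^\bullet\langle\Psi\cup\hat\Psi\rangle\otimes\Omega^\bullet(M)$, the transgressive complex of $E\times_M\hat E$. Let $\hat p_*\colon\Omega_{\Psi\cup\hat\Psi}\to\Omega_{\hat\Psi}$ be integration over $\Psi$: for $\beta\in\Omega_{\hat\Psi}$ it sends $\beta\wedge\psi_1\wedge\dots\wedge\psi_N$ to $\beta$ and the product of $\beta$ with fewer of the $\psi_i$ to $0$. For an even $F\in\Omega_{\Psi\cup\hat\Psi}$ put $\tau_F=\hat p_*\circ e^F\circ p^*\colon\Omega_\Psi\to\Omega_{\hat\Psi}$; it acts fibrewise over $M$. The triples are T-dual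 with kernel $F$ if $dF=p^*H-\hat p^*\hat H$ and if, for the component $F_0\in\wedge^\bullet\langle\Psi\cup\hat\Psi\rangle\otimes\Omega^0(M)$ of $F$, the map $\tau_{F_0}\colon\wedge^\bullet\langle\Psi\rangle\to\wedge^\bullet\langle\hat\Psi\rangle$ is an isomorphism at every point of $M$. Theorem. Let $(E,H,\Psi)$ and $(\hat E,\hat H,\hat\Psi)$ be T-dual with kernel $F$. Then the brackets of the Clifford–Courant algebroids $C_{\langle\Psi\rangle}$ (twisted by $H$) and $C_{\langle\hat\Psi\rangle}$ (twisted by $\hat H$) are well defined, that is, for any smooth sections $v,w$ the section $[\![v,w]\!]$ exists, is smooth and is unique, and there is an isomorphism of smooth vector bundles over the identity of $M$ $$\mathcal T_F\colon C_{\langle\Psi\rangle}\to C_{\langle\hat\Psi\rangle}$$ that preserves the $TM$-component, is determined by the property $$\tau_F(v\cdot\varphi)=\mathcal T_F(v)\cdot\tau_F(\varphi)\quad\text{for all }\varphi$$ ($\mathcal T_F(v)$ is the only element of $C_{\langle\hat\Psi\rangle}$ over the same point with this property), and satisfies $\mathcal T_F([\![v,w]\!]_H)=[\![\mathcal T_F(v),\mathcal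 T_F(w)]\!]_{\hat H}$ for all smooth sections $v,w$. -/

import Mathlib

open scoped Manifold ContDiff TensorProduct

noncomputable section

namespace CliffordCourant

/-! ## Functions with values in a finite-dimensional vector space without a chosen norm -/

section Weak

variable {U W : Type*} [NormedAddCommGroup U] [NormedSpace ℝ U] [AddCommGroup W] [Module ℝ W]

/-- Smoothness on `s` of a function with values in a finite-dimensional real vector space: all its
components are smooth. -/
def SmoothComponentsOn (f : U → W) (s : Set U) : Prop :=
  ∀ ℓ : Module.Dual ℝ W, ContDiffOn ℝ ∞ (fun y => ℓ (f y)) s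

/-- The directional derivative at `y` along `v` of a function with values in a finite-dimensional
real vector space, computed in a basis. -/
def directionalDeriv [Module.Finite ℝ W] (f : U → W) (y v : U) : W :=
  ∑ k, fderiv ℝ (fun z => (Module.finBasis ℝ W).coord k (f z)) y v • Module.finBasis ℝ W k

end Weak

/-! ## Exterior algebras -/

instance exteriorAlgebra_finite (W : Type*) [AddCommGroup W] [Module ℝ W] [Module.Finite ℝ W] :
    Module.Finite ℝ (ExteriorAlgebra ℝ W) := by
  have key : (⊤ : Submodule ℝ (ExteriorAlgebra ℝ W)) ≤
      ⨆ i ∈ Finset.range (Module.finrank ℝ W + 1), ⋀[ℝ]^i W := by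
    rw [← ExteriorAlgebra.ιMulti_span, Submodule.span_le]
    rintro _ ⟨⟨k, v⟩, rfl⟩
    by_cases hk : k ∈ Finset.range (Module.finrank ℝ W + 1)
    · exact Submodule.mem_iSup_of_mem k (Submodule.mem_iSup_of_mem hk
        (ExteriorAlgebra.ιMulti_range ℝ k ⟨v, rfl⟩))
    · have hv : ¬ LinearIndependent ℝ v := by
        intro h
        have := h.fintype_card_le_finrank
        simp at this hk
        omega
      have : ExteriorAlgebra.ιMulti ℝ k v = 0 := AlternatingMap.map_linearDependent _ v hv
      simp [this]
  refine ⟨?_⟩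
  have h := top_le_iff.mp key
  rw [← h]
  exact Submodule.fg_biSup _ _ fun i _ => Module.Finite.iff_fg.mp inferInstance

section Algebra

variable {W : Type*} [AddCommGroup W] [Module ℝ W]

/-- The elements of even degree of an exterior algebra. -/
def evenPart (W : Type*) [AddCommGroup W] [Module ℝ W] : Submodule ℝ (ExteriorAlgebra ℝ W) :=
  CliffordAlgebra.evenOdd (0 : QuadraticForm ℝ W) 0

/-- The elements of odd degree of an exterior algebra. -/
def oddPart (W : Type*) [AddCommGroup W] [Module ℝ W] : Submodule ℝ (ExteriorAlgebra ℝ W) :=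
  CliffordAlgebra.evenOdd (0 : QuadraticForm ℝ W) 1

theorem exteriorPower_le_oddPart {d : ℕ} (hd : Odd d) : ⋀[ℝ]^d W ≤ oddPart W := by
  have h : ((d : ℕ) : ZMod 2) = 1 := (ZMod.natCast_eq_one_iff_odd).mpr hd
  exact le_iSup (fun j : { k : ℕ // (k : ZMod 2) = 1 } =>
    LinearMap.range (CliffordAlgebra.ι (0 : QuadraticForm ℝ W)) ^ (j : ℕ)) ⟨d, h⟩

theorem ι_anticomm (m w : W) :
    ExteriorAlgebra.ι ℝ m * ExteriorAlgebra.ι ℝ w =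
      -(ExteriorAlgebra.ι ℝ w * ExteriorAlgebra.ι ℝ m) :=
  eq_neg_of_add_eq_zero_left (ExteriorAlgebra.ι_add_mul_swap m w)

theorem ι_mul_of_odd (m : W) {b : ExteriorAlgebra ℝ W} (hb : b ∈ oddPart W) :
    ExteriorAlgebra.ι ℝ m * b = -(b * ExteriorAlgebra.ι ℝ m) := by
  refine CliffordAlgebra.odd_induction (0 : QuadraticForm ℝ W)
    (P := fun b _ => ExteriorAlgebra.ι ℝ m * b = -(b * ExteriorAlgebra.ι ℝ m))
    ?_ ?_ ?_ b hb
  · intro v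
    exact ι_anticomm m v
  · intro x y _ _ hx hy
    rw [mul_add, add_mul, hx, hy, neg_add]
  · intro m₁ m₂ x _ hx
    change ExteriorAlgebra.ι ℝ m * (ExteriorAlgebra.ι ℝ m₁ * ExteriorAlgebra.ι ℝ m₂ * x) =
      -(ExteriorAlgebra.ι ℝ m₁ * ExteriorAlgebra.ι ℝ m₂ * x * ExteriorAlgebra.ι ℝ m)
    have h1 := ι_anticomm m m₁
    have h2 := ι_anticomm m m₂
    calc _ = ExteriorAlgebra.ι ℝ m * ExteriorAlgebra.ι ℝ m₁ * ExteriorAlgebra.ι ℝ m₂ * x := by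
          simp only [mul_assoc]
      _ = -(ExteriorAlgebra.ι ℝ m₁ * (ExteriorAlgebra.ι ℝ m * ExteriorAlgebra.ι ℝ m₂) * x) := by
          rw [h1]; simp only [neg_mul, mul_assoc]
      _ = ExteriorAlgebra.ι ℝ m₁ * ExteriorAlgebra.ι ℝ m₂ * (ExteriorAlgebra.ι ℝ m * x) := by
          rw [h2]; simp only [neg_mul, mul_neg, neg_neg, mul_assoc]
      _ = _ := by rw [hx]; simp only [mul_neg, mul_assoc]

theorem odd_anticomm {a b : ExteriorAlgebra ℝ W} (ha : a ∈ oddPart W) (hb : b ∈ oddPart W) :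
    a * b = -(b * a) := by
  refine CliffordAlgebra.odd_induction (0 : QuadraticForm ℝ W)
    (P := fun a _ => a * b = -(b * a)) ?_ ?_ ?_ a ha
  · intro v
    exact ι_mul_of_odd v hb
  · intro x y _ _ hx hy
    rw [mul_add, add_mul, hx, hy, neg_add]
  · intro m₁ m₂ x _ hx
    change ExteriorAlgebra.ι ℝ m₁ * ExteriorAlgebra.ι ℝ m₂ * x * b =
      -(b * (ExteriorAlgebra.ι ℝ m₁ * ExteriorAlgebra.ι ℝ m₂ * x))
    have h1 := ι_mul_of_odd m₁ hb
    have h2 := ι_mul_of_odd m₂ hb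
    rw [mul_assoc, hx, mul_neg, ← mul_assoc, mul_assoc (ExteriorAlgebra.ι ℝ m₁), h2, mul_neg,
      ← mul_assoc, h1]
    simp [mul_assoc]

theorem odd_mul_self {a : ExteriorAlgebra ℝ W} (ha : a ∈ oddPart W) : a * a = 0 := by
  have h : (2 : ℝ) • (a * a) = 0 := by
    rw [two_smul]
    exact add_eq_zero_iff_eq_neg.mpr (odd_anticomm ha ha)
  exact (smul_eq_zero.mp h).resolve_left two_ne_zero

/-- The exponential of an element `f + ν` of an exterior algebra of a finite-dimensional space,
`f` being its component of degree zero: `exp f` times the exponential series of the nilpotent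
element `ν`, whose terms vanish beyond the dimension of the space. -/
def extExp (θ : ExteriorAlgebra ℝ W) : ExteriorAlgebra ℝ W :=
  Real.exp (ExteriorAlgebra.algebraMapInv θ) •
    ∑ k ∈ Finset.range (Module.finrank ℝ W + 1), ((k.factorial : ℝ)⁻¹) •
      (θ - algebraMap ℝ _ (ExteriorAlgebra.algebraMapInv θ)) ^ k

end Algebra

/-! ## Differential forms with additional generators

For a finite set `κ` of symbols, `⟨κ⟩ = κ → ℝ` is the vector space with basis `κ`. At a point `x` of
a manifold `M`, the algebra `⋀⟨κ⟩ ⊗ ⋀T*ₓM` (graded tensor product) is realised as the exterior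
algebra `⋀(⟨κ⟩ ⊕ T*ₓM)`. -/

/-- The fibre at `x` of the bundle `⋀⟨κ⟩ ⊗ ⋀T*M`. -/
abbrev FormAt (n : ℕ) {M : Type*} [TopologicalSpace M] [ChartedSpace (EuclideanSpace ℝ (Fin n)) M]
    (κ : Type) (x : M) : Type _ :=
  ExteriorAlgebra ℝ ((κ → ℝ) × Module.Dual ℝ (TangentSpace (𝓡 n) x))

/-- Sections, smooth or not, of the bundle `⋀⟨κ⟩ ⊗ ⋀T*M`. The smooth ones, singled out by
`SmoothForm`, form `⋀⟨κ⟩ ⊗ Ω(M)`. -/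
abbrev ExtForm (n : ℕ) (M : Type*) [TopologicalSpace M]
    [ChartedSpace (EuclideanSpace ℝ (Fin n)) M] (κ : Type) : Type _ :=
  ∀ x : M, FormAt n κ x

/-- Differential forms of mixed degree (sections of `⋀T*M`): there are no additional generators. -/
abbrev Form (n : ℕ) (M : Type*) [TopologicalSpace M]
    [ChartedSpace (EuclideanSpace ℝ (Fin n)) M] : Type _ :=
  ExtForm n M Empty

section Forms

variable {n r : ℕ}
  {M : Type*} [TopologicalSpace M] [ChartedSpace (EuclideanSpace ℝ (Fin n)) M]
  {E : Type*} [TopologicalSpace E] [ChartedSpace (EuclideanSpace ℝ (Fin r)) E]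
  {κ : Type}

/-- The pull-back of forms along a map `f`; it fixes the additional generators. -/
def pullback (f : E → M) (θ : ExtForm n M κ) : ExtForm r E κ := fun x =>
  ExteriorAlgebra.map
    (LinearMap.prodMap LinearMap.id (mfderiv (𝓡 r) (𝓡 n) f x).toLinearMap.dualMap) (θ (f x))

/-- The expression of a form in the preferred chart at `x₀`: its pull-back along the inverse of the
chart. Only its values on the target of the chart are meaningful. -/
def inChart (x₀ : M) (θ : ExtForm n M κ) : EuclideanSpace ℝ (Fin n) →
    ExteriorAlgebra ℝ ((κ → ℝ) × Module.Dual ℝ (EuclideanSpace ℝ (Fin n))) :=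
  fun y => pullback (r := n) (extChartAt (𝓡 n) x₀).symm θ y

/-- Smoothness of a form: its coefficients in every preferred chart are smooth. -/
def SmoothForm (θ : ExtForm n M κ) : Prop :=
  ∀ x₀ : M, SmoothComponentsOn (inChart x₀ θ) (extChartAt (𝓡 n) x₀).target

/-- The exterior derivative `∑ⱼ dyʲ ∧ ∂θ/∂yʲ` on Euclidean space; the additional generators are
closed for it. -/
def modelExtDeriv [Finite κ]
    (θ : EuclideanSpace ℝ (Fin n) →
      ExteriorAlgebra ℝ ((κ → ℝ) × Module.Dual ℝ (EuclideanSpace ℝ (Fin n))))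
    (y : EuclideanSpace ℝ (Fin n)) :
    ExteriorAlgebra ℝ ((κ → ℝ) × Module.Dual ℝ (EuclideanSpace ℝ (Fin n))) :=
  ∑ j, ExteriorAlgebra.ι ℝ
      ((0, (EuclideanSpace.proj j : EuclideanSpace ℝ (Fin n) →L[ℝ] ℝ).toLinearMap) :
        (κ → ℝ) × Module.Dual ℝ (EuclideanSpace ℝ (Fin n))) *
    directionalDeriv θ y (EuclideanSpace.single j 1)

/-- The exterior derivative of a form on a manifold, computed at each point in the preferred chart
there; on `⋀⟨κ⟩ ⊗ Ω(M)` it is the operator for which the additional generators are closed. -/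
def extDeriv [Finite κ] (θ : ExtForm n M κ) : ExtForm n M κ := fun x =>
  ExteriorAlgebra.map
    (LinearMap.prodMap LinearMap.id
      (mfderiv (𝓡 n) (𝓡 n) (extChartAt (𝓡 n) x : M → EuclideanSpace ℝ (Fin n))
        x).toLinearMap.dualMap)
    (modelExtDeriv (inChart x θ) (extChartAt (𝓡 n) x x))

/-- Forms on `M` as elements of `⋀⟨κ⟩ ⊗ Ω(M)`. -/
def baseForm (κ : Type) (θ : Form n M) : ExtForm n M κ := fun x =>
  ExteriorAlgebra.map (LinearMap.prodMap 0 LinearMap.id) (θ x)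

/-- Contraction `∂_k` with the vector dual to the generator `k`. -/
def contractGenerator {W : Type*} [AddCommGroup W] [Module ℝ W] (k : κ) :
    ExteriorAlgebra ℝ ((κ → ℝ) × W) →ₗ[ℝ] ExteriorAlgebra ℝ ((κ → ℝ) × W) :=
  CliffordAlgebra.contractLeft (Q := (0 : QuadraticForm ℝ ((κ → ℝ) × W)))
    (LinearMap.proj k ∘ₗ LinearMap.fst ℝ (κ → ℝ) W)

/-- The differential of `⋀⟨κ⟩ ⊗ Ω(M)` with `d k = c k` for each generator `k`, that is
`d + ∑ₖ cₖ ∧ ∂ₖ`. -/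
def totalDeriv [Fintype κ] (c : κ → Form n M) (φ : ExtForm n M κ) : ExtForm n M κ := fun x =>
  extDeriv φ x + ∑ k, baseForm κ (c k) x * contractGenerator k (φ x)

/-- The twisted differential `d + H ∧`. -/
def twistedDeriv [Fintype κ] (c : κ → Form n M) (H φ : ExtForm n M κ) : ExtForm n M κ := fun x =>
  totalDeriv c φ x + H x * φ x

end Forms

/-! ## Transgressive fibrations -/

section Fibrations

/-- A local trivialisation that is a diffeomorphism. -/
def SmoothTrivialization (n l r : ℕ)
    {M : Type*} [TopologicalSpace M] [ChartedSpace (EuclideanSpace ℝ (Fin n)) M]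
    {F : Type*} [TopologicalSpace F] [ChartedSpace (EuclideanSpace ℝ (Fin l)) F]
    {E : Type*} [TopologicalSpace E] [ChartedSpace (EuclideanSpace ℝ (Fin r)) E]
    {π : E → M} (t : Bundle.Trivialization F π) : Prop :=
  ContMDiffOn (𝓡 r) ((𝓡 n).prod (𝓡 l)) ∞ t t.source ∧
  ContMDiffOn ((𝓡 n).prod (𝓡 l)) (𝓡 r) ∞ t.toOpenPartialHomeomorph.symm t.target

/-- `π : E → M` is a smooth fibre bundle with typical fibre `F`. -/
def IsSmoothFibreBundle (n l r : ℕ)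
    {M : Type*} [TopologicalSpace M] [ChartedSpace (EuclideanSpace ℝ (Fin n)) M]
    (F : Type*) [TopologicalSpace F] [ChartedSpace (EuclideanSpace ℝ (Fin l)) F]
    {E : Type*} [TopologicalSpace E] [ChartedSpace (EuclideanSpace ℝ (Fin r)) E]
    (π : E → M) : Prop :=
  ContMDiff (𝓡 r) (𝓡 n) ∞ π ∧
  ∀ x : M, ∃ t : Bundle.Trivialization F π, x ∈ t.baseSet ∧ SmoothTrivialization n l r t

/-- The inclusion of the typical fibre as the fibre over `x`, given by a local trivialisation. -/
def fibreInclusion {M F E : Type*} [TopologicalSpace M] [TopologicalSpace F] [TopologicalSpace E]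
    {π : E → M} (t : Bundle.Trivialization F π) (x : M) : F → E :=
  fun f => t.toOpenPartialHomeomorph.symm (x, f)

/-- The product `ψ_I` of the forms `ψ i`, `i ∈ I`, in increasing order. -/
def monomial {N r : ℕ} {E : Type*} [TopologicalSpace E]
    [ChartedSpace (EuclideanSpace ℝ (Fin r)) E]
    (ψ : Fin N → Form r E) (I : Finset (Fin N)) : Form r E :=
  ((I.sort (· ≤ ·)).map ψ).prod

/-- The classes of the closed forms `ψ i` freely generate the de Rham cohomology algebra: the
classes of the products `ψ_I` form a basis of closed forms modulo exact forms. -/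
structure FreelyGeneratesCohomology {N l : ℕ} {F : Type*} [TopologicalSpace F]
    [ChartedSpace (EuclideanSpace ℝ (Fin l)) F] (ψ : Fin N → Form l F) : Prop where
  closed : ∀ i, extDeriv (ψ i) = 0
  independent : ∀ (a : Finset (Fin N) → ℝ) (η : Form l F), SmoothForm η →
    ∑ I, a I • monomial ψ I = extDeriv η → a = 0
  generate : ∀ θ : Form l F, SmoothForm θ → extDeriv θ = 0 →
    ∃ (a : Finset (Fin N) → ℝ) (η : Form l F), SmoothForm η ∧
      θ = ∑ I, a I • monomial ψ I + extDeriv η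

/-- A transgressive generating set `Ψ = {ψ i}` on `π : E → M`: forms of odd degree on `E` that freely
generate the cohomology of the fibres and whose derivatives are pulled back from `M`,
`dψ i = π*c i`. -/
structure TransgressiveGeneratingSet (n l r : ℕ)
    {M : Type*} [TopologicalSpace M] [ChartedSpace (EuclideanSpace ℝ (Fin n)) M]
    (F : Type*) [TopologicalSpace F] [ChartedSpace (EuclideanSpace ℝ (Fin l)) F]
    {E : Type*} [TopologicalSpace E] [ChartedSpace (EuclideanSpace ℝ (Fin r)) E]
    (π : E → M) (N : ℕ) where
  ψ : Fin N → Form r E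
  c : Fin N → Form n M
  degree : Fin N → ℕ
  odd_degree : ∀ i, Odd (degree i)
  ψ_mem : ∀ i e, ψ i e ∈ ⋀[ℝ]^(degree i) ((Empty → ℝ) × Module.Dual ℝ (TangentSpace (𝓡 r) e))
  c_mem : ∀ i x, c i x ∈ ⋀[ℝ]^(degree i + 1) ((Empty → ℝ) × Module.Dual ℝ (TangentSpace (𝓡 n) x))
  smooth_ψ : ∀ i, SmoothForm (ψ i)
  smooth_c : ∀ i, SmoothForm (c i)
  extDeriv_ψ : ∀ i, extDeriv (ψ i) = pullback π (c i)
  freelyGenerates : ∀ (x : M) (t : Bundle.Trivialization F π), x ∈ t.baseSet →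
    SmoothTrivialization n l r t →
    FreelyGeneratesCohomology fun i => pullback (r := l) (fibreInclusion t x) (ψ i)

variable {n l r : ℕ}
  {M : Type*} [TopologicalSpace M] [ChartedSpace (EuclideanSpace ℝ (Fin n)) M]
  {F : Type*} [TopologicalSpace F] [ChartedSpace (EuclideanSpace ℝ (Fin l)) F]
  {E : Type*} [TopologicalSpace E] [ChartedSpace (EuclideanSpace ℝ (Fin r)) E]
  {π : E → M} {N : ℕ}

namespace TransgressiveGeneratingSet

/-- The linear map `(ξ, α) ↦ ∑ᵢ ξᵢ ψ i + π*α` that generates `toTotal`. -/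
def toTotalLinear (Ψ : TransgressiveGeneratingSet n l r F π N) (e : E) :
    (Fin N → ℝ) × Module.Dual ℝ (TangentSpace (𝓡 n) (π e)) →ₗ[ℝ] FormAt r Empty e :=
  LinearMap.coprod (Fintype.linearCombination ℝ (fun i => Ψ.ψ i e))
    (ExteriorAlgebra.ι ℝ ∘ₗ LinearMap.inr ℝ (Empty → ℝ) (Module.Dual ℝ (TangentSpace (𝓡 r) e)) ∘ₗ
      (mfderiv (𝓡 r) (𝓡 n) π e).toLinearMap.dualMap)

theorem toTotalLinear_mem (Ψ : TransgressiveGeneratingSet n l r F π N) (e : E)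
    (w : (Fin N → ℝ) × Module.Dual ℝ (TangentSpace (𝓡 n) (π e))) :
    Ψ.toTotalLinear e w ∈ oddPart _ := by
  rw [toTotalLinear, LinearMap.coprod_apply, Fintype.linearCombination_apply]
  refine Submodule.add_mem _ (Submodule.sum_mem _ fun i _ => Submodule.smul_mem _ _
    (exteriorPower_le_oddPart (Ψ.odd_degree i) (Ψ.ψ_mem i e))) ?_
  exact CliffordAlgebra.ι_mem_evenOdd_one _ _

/-- The inclusion `⋀⟨Ψ⟩ ⊗ Ω(M) → Ω(E)` of the transgressive subcomplex: the homomorphism of algebras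
that sends the generator `i` to `ψ i` and is `π*` on forms on `M`. -/
def toTotal (Ψ : TransgressiveGeneratingSet n l r F π N) (θ : ExtForm n M (Fin N)) : Form r E :=
  fun e => ExteriorAlgebra.lift ℝ
    ⟨Ψ.toTotalLinear e, fun w => odd_mul_self (Ψ.toTotalLinear_mem e w)⟩ (θ (π e))

end TransgressiveGeneratingSet

/-- A closed odd form `H` on `E` that lies in the transgressive subcomplex `⋀⟨Ψ⟩ ⊗ Ω(M) ⊂ Ω(E)`;
`comp` is `H` as an element of `⋀⟨Ψ⟩ ⊗ Ω(M)`. -/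
structure Twist (Ψ : TransgressiveGeneratingSet n l r F π N) where
  H : Form r E
  closed : extDeriv H = 0
  comp : ExtForm n M (Fin N)
  smooth : SmoothForm comp
  odd : ∀ x, comp x ∈ oddPart _
  toTotal_comp : Ψ.toTotal comp = H

end Fibrations

/-! ## T-duality -/

section TDuality

section Pointwise

variable (N N' : ℕ) (W : Type*) [AddCommGroup W] [Module ℝ W]

/-- `p*` : the inclusion `⋀(⟨Ψ⟩ ⊕ W) → ⋀(⟨Ψ ∪ Ψ'⟩ ⊕ W)`. -/
def pullLeft : ExteriorAlgebra ℝ ((Fin N → ℝ) × W) →ₐ[ℝ]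
    ExteriorAlgebra ℝ ((Fin N ⊕ Fin N' → ℝ) × W) :=
  ExteriorAlgebra.map (LinearMap.prodMap
    (LinearMap.pi (Sum.elim (fun i => LinearMap.proj i) (fun _ => 0))) LinearMap.id)

/-- `p'*` : the inclusion `⋀(⟨Ψ'⟩ ⊕ W) → ⋀(⟨Ψ ∪ Ψ'⟩ ⊕ W)`. -/
def pullRight : ExteriorAlgebra ℝ ((Fin N' → ℝ) × W) →ₐ[ℝ]
    ExteriorAlgebra ℝ ((Fin N ⊕ Fin N' → ℝ) × W) :=
  ExteriorAlgebra.map (LinearMap.prodMap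
    (LinearMap.pi (Sum.elim (fun _ => 0) (fun j => LinearMap.proj j))) LinearMap.id)

/-- `p'_*` : integration over the generators `Ψ`. For `β` free of `Ψ`, it sends
`β ∧ ψ₁ ∧ ⋯ ∧ ψ_N` to `β` and the products of `β` with fewer of the `ψᵢ` to `0`: contract from the
right with `∂_N`, …, `∂_1`, in this order, then put `Ψ = 0`. -/
def fibreIntegral : ExteriorAlgebra ℝ ((Fin N ⊕ Fin N' → ℝ) × W) →ₗ[ℝ]
    ExteriorAlgebra ℝ ((Fin N' → ℝ) × W) :=
  (ExteriorAlgebra.map (LinearMap.prodMap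
      (LinearMap.funLeft ℝ ℝ (Sum.inr : Fin N' → Fin N ⊕ Fin N')) LinearMap.id)).toLinearMap ∘ₗ
    (List.finRange N).foldr
      (fun i L => (CliffordAlgebra.contractRight
        (Q := (0 : QuadraticForm ℝ ((Fin N ⊕ Fin N' → ℝ) × W)))).flip
          (LinearMap.proj (Sum.inl i) ∘ₗ LinearMap.fst ℝ (Fin N ⊕ Fin N' → ℝ) W) ∘ₗ L)
      LinearMap.id

variable {N N' W}

/-- The T-duality map `τ_F = p'_* ∘ e^F ∘ p*` on `⋀(⟨Ψ⟩ ⊕ W)`. -/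
def tau (F : ExteriorAlgebra ℝ ((Fin N ⊕ Fin N' → ℝ) × W)) :
    ExteriorAlgebra ℝ ((Fin N → ℝ) × W) →ₗ[ℝ] ExteriorAlgebra ℝ ((Fin N' → ℝ) × W) :=
  fibreIntegral N N' W ∘ₗ LinearMap.mulLeft ℝ (extExp F) ∘ₗ (pullLeft N N' W).toLinearMap

/-- The component of basic-degree zero, an element of `⋀⟨κ⟩` (here `PUnit` is the zero space). -/
def basicDegreeZero {κ : Type} (F : ExteriorAlgebra ℝ ((κ → ℝ) × W)) :
    ExteriorAlgebra ℝ ((κ → ℝ) × PUnit.{1}) :=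
  ExteriorAlgebra.map (LinearMap.prodMap LinearMap.id 0) F

end Pointwise

variable {n l r l' r' : ℕ}
  {M : Type*} [TopologicalSpace M] [ChartedSpace (EuclideanSpace ℝ (Fin n)) M]
  {F : Type*} [TopologicalSpace F] [ChartedSpace (EuclideanSpace ℝ (Fin l)) F]
  {E : Type*} [TopologicalSpace E] [ChartedSpace (EuclideanSpace ℝ (Fin r)) E]
  {F' : Type*} [TopologicalSpace F'] [ChartedSpace (EuclideanSpace ℝ (Fin l')) F']
  {E' : Type*} [TopologicalSpace E'] [ChartedSpace (EuclideanSpace ℝ (Fin r')) E']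
  {π : E → M} {π' : E' → M} {N N' : ℕ}
  {Ψ : TransgressiveGeneratingSet n l r F π N} {Ψ' : TransgressiveGeneratingSet n l' r' F' π' N'}

/-- `K` is a T-duality kernel for `(E, H, Ψ)` and `(E', H', Ψ')`: an even element of the
transgressive complex `⋀⟨Ψ ∪ Ψ'⟩ ⊗ Ω(M)` of `E ×_M E'` with `dK = p*H - p'*H'` for which the map
`τ` of its component of basic-degree zero is an isomorphism at every point. -/
structure IsTDualityKernel (H : Twist Ψ) (H' : Twist Ψ') (K : ExtForm n M (Fin N ⊕ Fin N')) :
    Prop where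
  smooth : SmoothForm K
  even : ∀ x, K x ∈ evenPart _
  gerbe_trivialization : ∀ x, totalDeriv (Sum.elim Ψ.c Ψ'.c) K x =
    pullLeft N N' _ (H.comp x) - pullRight N N' _ (H'.comp x)
  nondegenerate : ∀ x, Function.Bijective (tau (basicDegreeZero (K x)))

end TDuality

/-! ## Clifford–Courant algebroids -/

section Clifford

/-- `Clif(V ⊕ V*)` for `V* = ⟨κ⟩`, with the natural pairing: `(v + ξ)² = ξ(v)`. -/
abbrev Clif (κ : Type) : Type := CliffordAlgebra (QuadraticForm.dualProd ℝ (κ → ℝ))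

section Pointwise

variable {κ : Type} {W : Type*} [AddCommGroup W] [Module ℝ W]

/-- The operator `∂_v + ξ ∧` on `⋀(⟨κ⟩ ⊕ W)`, for `(v, ξ) ∈ V ⊕ V*`. -/
def clifGenerator : Module.Dual ℝ (κ → ℝ) × (κ → ℝ) →ₗ[ℝ]
    Module.End ℝ (ExteriorAlgebra ℝ ((κ → ℝ) × W)) :=
  LinearMap.coprod
    (CliffordAlgebra.contractLeft (Q := (0 : QuadraticForm ℝ ((κ → ℝ) × W))) ∘ₗ
      (LinearMap.fst ℝ (κ → ℝ) W).dualMap)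
    (LinearMap.mul ℝ (ExteriorAlgebra ℝ ((κ → ℝ) × W)) ∘ₗ ExteriorAlgebra.ι ℝ ∘ₗ
      LinearMap.inl ℝ (κ → ℝ) W)

theorem clifGenerator_mul_self (v : Module.Dual ℝ (κ → ℝ) × (κ → ℝ)) :
    (clifGenerator v : Module.End ℝ (ExteriorAlgebra ℝ ((κ → ℝ) × W))) * clifGenerator v =
      algebraMap ℝ _ (QuadraticForm.dualProd ℝ (κ → ℝ) v) := by
  obtain ⟨v, ξ⟩ := v
  refine LinearMap.ext fun φ => ?_
  have h1 := CliffordAlgebra.contractLeft_ι_mul (Q := (0 : QuadraticForm ℝ ((κ → ℝ) × W)))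
    (v ∘ₗ LinearMap.fst ℝ (κ → ℝ) W) (ξ, 0) φ
  have h2 := CliffordAlgebra.contractLeft_contractLeft (Q := (0 : QuadraticForm ℝ ((κ → ℝ) × W)))
    (v ∘ₗ LinearMap.fst ℝ (κ → ℝ) W) φ
  have h3 := ExteriorAlgebra.ι_sq_zero (R := ℝ) ((ξ, 0) : (κ → ℝ) × W)
  change CliffordAlgebra.contractLeft (Q := (0 : QuadraticForm ℝ ((κ → ℝ) × W)))
      (v ∘ₗ LinearMap.fst ℝ (κ → ℝ) W)
      (CliffordAlgebra.contractLeft (Q := (0 : QuadraticForm ℝ ((κ → ℝ) × W)))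
        (v ∘ₗ LinearMap.fst ℝ (κ → ℝ) W) φ + ExteriorAlgebra.ι ℝ (ξ, 0) * φ) +
    ExteriorAlgebra.ι ℝ (ξ, 0) * (CliffordAlgebra.contractLeft
      (Q := (0 : QuadraticForm ℝ ((κ → ℝ) × W)))
        (v ∘ₗ LinearMap.fst ℝ (κ → ℝ) W) φ + ExteriorAlgebra.ι ℝ (ξ, 0) * φ) = v ξ • φ
  rw [map_add, h2, mul_add, ← mul_assoc (ExteriorAlgebra.ι ℝ ((ξ, 0) : (κ → ℝ) × W)), h3, zero_mul,
    zero_add, add_zero]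
  refine (congrArg (· + _) h1).trans ?_
  exact sub_add_cancel _ _

/-- The action of `Clif(V ⊕ V*)` on `⋀V* ⊗ ⋀W` by interior and exterior products. -/
def clifAction : Clif κ →ₐ[ℝ] Module.End ℝ (ExteriorAlgebra ℝ ((κ → ℝ) × W)) :=
  CliffordAlgebra.lift _ ⟨clifGenerator, clifGenerator_mul_self⟩

/-- The action of `Clif(V ⊕ V*) ⊗ ⋀W`: `(a ⊗ α) · φ = a · (α ∧ φ)`. -/
def clifFormAction : Clif κ ⊗[ℝ] ExteriorAlgebra ℝ W →ₗ[ℝ]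
    Module.End ℝ (ExteriorAlgebra ℝ ((κ → ℝ) × W)) :=
  TensorProduct.lift ((LinearMap.mul ℝ (Module.End ℝ (ExteriorAlgebra ℝ ((κ → ℝ) × W)))).compl₁₂
    clifAction.toLinearMap
    (LinearMap.mul ℝ (ExteriorAlgebra ℝ ((κ → ℝ) × W)) ∘ₗ
      (ExteriorAlgebra.map (LinearMap.inr ℝ (κ → ℝ) W)).toLinearMap))

/-- The odd part of `Clif(V ⊕ V*) ⊗ ⋀W`. The generators in `V ⊕ V*` have odd degree. -/
def oddClifForm (κ : Type) (W : Type*) [AddCommGroup W] [Module ℝ W] :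
    Submodule ℝ (Clif κ ⊗[ℝ] ExteriorAlgebra ℝ W) :=
  Submodule.map₂ (TensorProduct.mk ℝ (Clif κ) (ExteriorAlgebra ℝ W))
      (CliffordAlgebra.evenOdd (QuadraticForm.dualProd ℝ (κ → ℝ)) 0) (oddPart W) ⊔
    Submodule.map₂ (TensorProduct.mk ℝ (Clif κ) (ExteriorAlgebra ℝ W))
      (CliffordAlgebra.evenOdd (QuadraticForm.dualProd ℝ (κ → ℝ)) 1) (evenPart W)

end Pointwise

variable {n : ℕ} {M : Type*} [TopologicalSpace M] [ChartedSpace (EuclideanSpace ℝ (Fin n)) M]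
  {κ : Type}

/-- The fibre at `x` of the bundle `C_{⟨κ⟩} = TM ⊕ (Clif(V ⊕ V*) ⊗ ⋀T*M)^od`. -/
abbrev CCFibre (n : ℕ) {M : Type*} [TopologicalSpace M]
    [ChartedSpace (EuclideanSpace ℝ (Fin n)) M] (κ : Type) (x : M) : Type _ :=
  TangentSpace (𝓡 n) x × oddClifForm κ (Module.Dual ℝ (TangentSpace (𝓡 n) x))

/-- The action of `C_{⟨κ⟩}` on `⋀⟨κ⟩ ⊗ ⋀T*M`: tangent vectors act by interior product, the Clifford
part acts by `clifFormAction`. -/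
def act {x : M} (v : CCFibre n κ x) : Module.End ℝ (FormAt n κ x) :=
  CliffordAlgebra.contractLeft
      (Q := (0 : QuadraticForm ℝ ((κ → ℝ) × Module.Dual ℝ (TangentSpace (𝓡 n) x))))
      (Module.Dual.eval ℝ (TangentSpace (𝓡 n) x) v.1 ∘ₗ
        LinearMap.snd ℝ (κ → ℝ) (Module.Dual ℝ (TangentSpace (𝓡 n) x))) +
    clifFormAction (v.2 : Clif κ ⊗[ℝ] ExteriorAlgebra ℝ (Module.Dual ℝ (TangentSpace (𝓡 n) x)))

/-- The expression of a section of `Clif(V ⊕ V*) ⊗ ⋀T*M` in the preferred chart at `x₀`. -/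
def clifInChart (x₀ : M)
    (ξ : ∀ x : M, Clif κ ⊗[ℝ] ExteriorAlgebra ℝ (Module.Dual ℝ (TangentSpace (𝓡 n) x))) :
    EuclideanSpace ℝ (Fin n) →
      Clif κ ⊗[ℝ] ExteriorAlgebra ℝ (Module.Dual ℝ (EuclideanSpace ℝ (Fin n))) :=
  fun y => TensorProduct.map LinearMap.id
    (ExteriorAlgebra.map (mfderiv (𝓡 n) (𝓡 n) (extChartAt (𝓡 n) x₀).symm
      y).toLinearMap.dualMap).toLinearMap (ξ ((extChartAt (𝓡 n) x₀).symm y))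

/-- Smoothness of a section of `C_{⟨κ⟩}`. -/
def SmoothSection [IsManifold (𝓡 n) ∞ M] (v : ∀ x : M, CCFibre n κ x) : Prop :=
  ContMDiff (𝓡 n) (𝓡 n).tangent ∞ (fun x => (⟨x, (v x).1⟩ : TangentBundle (𝓡 n) M)) ∧
  ∀ x₀ : M, SmoothComponentsOn
    (clifInChart x₀ fun x =>
      ((v x).2 : Clif κ ⊗[ℝ] ExteriorAlgebra ℝ (Module.Dual ℝ (TangentSpace (𝓡 n) x))))
    (extChartAt (𝓡 n) x₀).target

/-- The action of a section of `C_{⟨κ⟩}` on `⋀⟨κ⟩ ⊗ Ω(M)`. -/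
def actSection (v : ∀ x : M, CCFibre n κ x) (φ : ExtForm n M κ) : ExtForm n M κ :=
  fun x => act (v x) (φ x)

/-- The operator `{{v, D}, w}` for odd operators `v`, `D`, `w`, with graded commutators:
`{v, D} = v D + D v` is even, so `{{v, D}, w} = {v, D} w - w {v, D}`. -/
def derivedBracket {A : Type*} [AddCommGroup A] (v D w : A → A) (φ : A) : A :=
  (v (D (w φ)) + D (v (w φ))) - w (v (D φ) + D (v φ))

/-- The section `u` is the bracket `⟦v, w⟧_H` of the Clifford–Courant algebroid of the extension
`(⟨κ⟩, d k = c k)` and the form `H`: it is smooth and acts on `⋀⟨κ⟩ ⊗ Ω(M)` as `{{v, d^H}, w}`. -/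
def IsBracket [IsManifold (𝓡 n) ∞ M] [Fintype κ] (c : κ → Form n M) (H : ExtForm n M κ)
    (v w u : ∀ x : M, CCFibre n κ x) : Prop :=
  SmoothSection u ∧ ∀ φ : ExtForm n M κ, SmoothForm φ →
    actSection u φ = derivedBracket (actSection v) (twistedDeriv c H) (actSection w) φ

end Clifford

end CliffordCourant

end

open scoped Manifold ContDiff TensorProduct

noncomputable section

namespace CliffordCourant

/-! The bundle `C` is recognised by its action. An operator on `⋀(⟨κ⟩ ⊕ T*ₓM)` comes from an element
of the fibre of `C` exactly when it is odd and its anticommutator with exterior multiplication by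
every one-form `α` on `M` is a scalar `X α`; the symbol `X` is then the tangent component. This is
`IsCliffordOp` with `IsCliffordOp.exists_eq_pairAction`, and the element is unique because the
action is faithful (`pairAction_injective`). The underlying fact is that `Clif(V ⊕ V*)` acts
faithfully and irreducibly on `⋀V*`. With coefficients in `⋀W` this says that `Clif(V ⊕ V*) ⊗ ⋀W`
acts faithfully, and that its image consists of all operators that supercommute with `W`. Both are
proved by treating the Clifford generators one at a time (`clifFormAction_injective`,
`exists_eq_clifFormAction`).

Brackets exist by a Cartan calculation. If `v` has symbol `X`, then `{v, d}` is the derivative along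
`X` plus an operator of order zero, so its commutator with `w` involves no derivative of the form
acted on (`bracketOp_apply`). The resulting operator again satisfies the criterion
(`isCliffordOp_bracketOp`), hence is the action of an element of `C`. The element is unique because
smooth forms take every value at a point, and it depends smoothly on the point because a section is
smooth as soon as it maps smooth forms to smooth forms (`smoothSection_of_actSection`).

For T-duality, three properties of `τ_K` suffice. It is linear over forms on `M` and changes parity
by `(-1)^N`, since `e^K` is even and integration over `Ψ` satisfies a projection formula and
consists of `N` contractions. It is an isomorphism: modulo the ideal generated by the one-forms on
`M` it is the map of the component of basic degree zero, and that ideal is nilpotent, so the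
argument is that of Nakayama's lemma (`surjective_tau`) together with a dimension count. It
intertwines the twisted differentials: this is the Leibniz rule with `d e^K = e^K dK`, the equation
for `dK`, and the vanishing of the integral over `Ψ` of `∂ᵢ(e^K φ)`, which moves `∂ᵢ` from `e^K` to
`φ` (`tau_intertwines`, `twistedDeriv_tau`).

Conjugation by such an isomorphism preserves the criterion and the symbol, hence maps `C`
isomorphically to its dual and fixes the `TM`-component (`exists_equiv_of_intertwiner`). The bracket
is built from actions and the twisted differential alone, all of which `τ_K` intertwines, so it is
preserved. Smoothness passes in both directions because the inverse of a smooth family of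
isomorphisms is smooth. -/

theorem eq_zero_of_eq_neg {V : Type*} [AddCommGroup V] [Module ℝ V] {v : V} (h : v = -v) :
    v = 0 := by
  have : (2 : ℝ) • v = 0 := by
    rw [two_smul]; nth_rewrite 2 [h]; exact add_neg_cancel v
  exact (smul_eq_zero.mp this).resolve_left two_ne_zero

/-! ### Contractions and the grade involution on an exterior algebra -/

section Exterior

variable {U U' : Type*} [AddCommGroup U] [Module ℝ U] [AddCommGroup U'] [Module ℝ U']

/-- Contraction of an element of an exterior algebra with a covector. -/
abbrev contract (d : Module.Dual ℝ U) : ExteriorAlgebra ℝ U →ₗ[ℝ] ExteriorAlgebra ℝ U :=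
  CliffordAlgebra.contractLeft (Q := (0 : QuadraticForm ℝ U)) d

/-- The grade involution of an exterior algebra. -/
abbrev gradeInv : ExteriorAlgebra ℝ U →ₐ[ℝ] ExteriorAlgebra ℝ U :=
  CliffordAlgebra.involute (Q := (0 : QuadraticForm ℝ U))

theorem exterior_left_induction {P : ExteriorAlgebra ℝ U → Prop}
    (algebraMap : ∀ r : ℝ, P (algebraMap ℝ _ r)) (add : ∀ x y, P x → P y → P (x + y))
    (ι_mul : ∀ u x, P x → P (ExteriorAlgebra.ι ℝ u * x)) (x : ExteriorAlgebra ℝ U) : P x :=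
  CliffordAlgebra.left_induction (Q := (0 : QuadraticForm ℝ U)) (P := P) algebraMap add
    (fun x u hx => ι_mul u x hx) x

theorem contract_ι_mul (d : Module.Dual ℝ U) (u : U) (x : ExteriorAlgebra ℝ U) :
    contract d (ExteriorAlgebra.ι ℝ u * x) = d u • x - ExteriorAlgebra.ι ℝ u * contract d x :=
  CliffordAlgebra.contractLeft_ι_mul d u x

theorem contract_algebraMap (d : Module.Dual ℝ U) (r : ℝ) :
    contract d (algebraMap ℝ (ExteriorAlgebra ℝ U) r) = 0 :=
  CliffordAlgebra.contractLeft_algebraMap _ _ r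

theorem contract_one (d : Module.Dual ℝ U) : contract d (1 : ExteriorAlgebra ℝ U) = 0 :=
  CliffordAlgebra.contractLeft_one _ _

theorem gradeInv_ι (u : U) :
    gradeInv (ExteriorAlgebra.ι ℝ u) = -ExteriorAlgebra.ι ℝ u := CliffordAlgebra.involute_ι u

theorem gradeInv_gradeInv (x : ExteriorAlgebra ℝ U) : gradeInv (gradeInv x) = x :=
  CliffordAlgebra.involute_involute x

theorem map_contract (f : U →ₗ[ℝ] U') (d : Module.Dual ℝ U') (x : ExteriorAlgebra ℝ U) :
    ExteriorAlgebra.map f (contract (d ∘ₗ f) x) = contract d (ExteriorAlgebra.map f x) := by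
  induction x using exterior_left_induction with
  | algebraMap r => rw [contract_algebraMap, AlgHom.commutes, contract_algebraMap, map_zero]
  | add x y hx hy => simp only [map_add, hx, hy]
  | ι_mul u x hx =>
    rw [contract_ι_mul, map_mul, ExteriorAlgebra.map_apply_ι, contract_ι_mul, map_sub, map_mul,
      hx, ExteriorAlgebra.map_apply_ι, map_smul]
    rfl

theorem map_gradeInv (f : U →ₗ[ℝ] U') (x : ExteriorAlgebra ℝ U) :
    ExteriorAlgebra.map f (gradeInv x) = gradeInv (ExteriorAlgebra.map f x) := by
  induction x using exterior_left_induction with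
  | algebraMap r => simp only [AlgHom.commutes]
  | add x y hx hy => simp only [map_add, hx, hy]
  | ι_mul u x hx =>
    rw [map_mul, map_mul, map_mul, map_mul, hx, gradeInv_ι, ExteriorAlgebra.map_apply_ι,
      gradeInv_ι, map_neg, ExteriorAlgebra.map_apply_ι]

/-- Moving a vector past `x` costs the sign of the degree of `x`. The grade involution carries this
sign, so no homogeneity has to be assumed here or in what depends on it. -/
theorem ι_mul_gradeInv (u : U) (x : ExteriorAlgebra ℝ U) :
    ExteriorAlgebra.ι ℝ u * gradeInv x = x * ExteriorAlgebra.ι ℝ u := by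
  induction x using exterior_left_induction with
  | algebraMap r => simp only [AlgHom.commutes, Algebra.commutes]
  | add x y hx hy => simp only [map_add, mul_add, add_mul, hx, hy]
  | ι_mul v x hx =>
    rw [map_mul, gradeInv_ι, mul_assoc, ← hx, neg_mul, mul_neg, ← mul_assoc, ← mul_assoc,
      ι_anticomm u v, neg_mul, neg_neg]

theorem contract_mul (d : Module.Dual ℝ U) (x y : ExteriorAlgebra ℝ U) :
    contract d (x * y) = contract d x * y + gradeInv x * contract d y := by
  induction x using exterior_left_induction with
  | algebraMap r =>
    rw [contract_algebraMap, AlgHom.commutes, zero_mul, zero_add, ← Algebra.smul_def, map_smul,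
      Algebra.smul_def]
  | add x z hx hz => simp only [map_add, add_mul, hx, hz]; abel
  | ι_mul v x hx =>
    rw [mul_assoc, contract_ι_mul, contract_ι_mul, hx, map_mul, gradeInv_ι]
    simp only [mul_add, sub_mul, smul_mul_assoc, mul_assoc, neg_mul]
    abel

theorem contract_gradeInv (d : Module.Dual ℝ U) (x : ExteriorAlgebra ℝ U) :
    contract d (gradeInv x) = -gradeInv (contract d x) := by
  induction x using exterior_left_induction with
  | algebraMap r => simp only [AlgHom.commutes, contract_algebraMap, map_zero, neg_zero]
  | add x z hx hz => simp only [map_add, hx, hz]; abel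
  | ι_mul v x hx =>
    rw [map_mul, gradeInv_ι, neg_mul, map_neg, contract_ι_mul, contract_ι_mul, hx, map_sub,
      map_mul, gradeInv_ι, map_smul]
    simp

theorem mem_evenPart_iff {x : ExteriorAlgebra ℝ U} : x ∈ evenPart U ↔ gradeInv x = x := by
  refine ⟨fun h => CliffordAlgebra.involute_eq_of_mem_even h, fun h => ?_⟩
  have ht : x ∈ evenPart U ⊔ oddPart U := by
    rw [evenPart, oddPart, (CliffordAlgebra.evenOdd_isCompl _).sup_eq_top]; trivial
  obtain ⟨a, ha, b, hb, rfl⟩ := Submodule.mem_sup.mp ht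
  rw [map_add, show gradeInv a = a from CliffordAlgebra.involute_eq_of_mem_even ha,
    show gradeInv b = -b from CliffordAlgebra.involute_eq_of_mem_odd hb] at h
  have : b = 0 := by
    have := add_left_cancel h
    exact eq_zero_of_eq_neg this.symm
  rw [this, add_zero]; exact ha

theorem mem_oddPart_iff {x : ExteriorAlgebra ℝ U} : x ∈ oddPart U ↔ gradeInv x = -x := by
  refine ⟨fun h => CliffordAlgebra.involute_eq_of_mem_odd h, fun h => ?_⟩
  have ht : x ∈ evenPart U ⊔ oddPart U := by
    rw [evenPart, oddPart, (CliffordAlgebra.evenOdd_isCompl _).sup_eq_top]; trivial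
  obtain ⟨a, ha, b, hb, rfl⟩ := Submodule.mem_sup.mp ht
  rw [map_add, show gradeInv a = a from CliffordAlgebra.involute_eq_of_mem_even ha,
    show gradeInv b = -b from CliffordAlgebra.involute_eq_of_mem_odd hb, neg_add] at h
  have : a = 0 := by
    have := add_right_cancel h
    exact eq_zero_of_eq_neg this
  rw [this, zero_add]; exact hb

theorem even_comm {x : ExteriorAlgebra ℝ U} (hx : gradeInv x = x) (y : ExteriorAlgebra ℝ U) :
    x * y = y * x := by
  induction y using exterior_left_induction with
  | algebraMap r => exact (Algebra.commutes r x).symm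
  | add y z hy hz => rw [mul_add, add_mul, hy, hz]
  | ι_mul u y hy => rw [← mul_assoc, ← ι_mul_gradeInv, hx, mul_assoc, hy, mul_assoc]

/-- Since `u ∧ u = 0`, a rank-one change of the identity acts on the exterior algebra with no terms
of higher order. The vanishing of a contraction thus becomes invariance under an algebra
homomorphism. -/
theorem map_id_sub_smulRight (d : Module.Dual ℝ U) (u : U) (x : ExteriorAlgebra ℝ U) :
    ExteriorAlgebra.map (LinearMap.id - d.smulRight u) x =
      x - ExteriorAlgebra.ι ℝ u * contract d x := by
  induction x using exterior_left_induction with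
  | algebraMap r => rw [AlgHom.commutes, contract_algebraMap, mul_zero, sub_zero]
  | add x y hx hy => simp only [map_add, hx, hy, mul_add]; abel
  | ι_mul v x hx =>
    have h1 : ExteriorAlgebra.ι ℝ u * (ExteriorAlgebra.ι ℝ u * contract d x) = 0 := by
      rw [← mul_assoc, ExteriorAlgebra.ι_sq_zero, zero_mul]
    have h2 : ExteriorAlgebra.ι ℝ u * (ExteriorAlgebra.ι ℝ v * contract d x) =
        -(ExteriorAlgebra.ι ℝ v * (ExteriorAlgebra.ι ℝ u * contract d x)) := by
      rw [← mul_assoc, ι_anticomm, neg_mul, mul_assoc]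
    rw [map_mul, ExteriorAlgebra.map_apply_ι, hx, contract_ι_mul]
    simp only [LinearMap.sub_apply, LinearMap.id_apply, LinearMap.smulRight_apply, map_sub,
      map_smul, mul_sub, sub_mul, smul_mul_assoc, mul_smul_comm, h1, h2, smul_zero]
    abel

/-- An element annihilated by the contractions with some of the covectors of a biorthogonal family
is invariant under the corresponding projection. -/
theorem map_eq_self_of_contract_eq_zero {κ : Type*} [DecidableEq κ] (d : κ → Module.Dual ℝ U)
    (u : κ → U) (hd : ∀ i j, d i (u j) = if i = j then 1 else 0) (s : Finset κ)
    {x : ExteriorAlgebra ℝ U} (hx : ∀ i ∈ s, contract (d i) x = 0) :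
    ExteriorAlgebra.map (LinearMap.id - ∑ i ∈ s, (d i).smulRight (u i)) x = x := by
  induction s using Finset.induction_on with
  | empty => simp
  | insert i s hi ih =>
    -- Biorthogonality removes the cross terms, so the projection is a composite of rank-one
    -- changes, which can be peeled off one at a time.
    have h1 : (LinearMap.id - ∑ j ∈ insert i s, (d j).smulRight (u j)) =
        (LinearMap.id - ∑ j ∈ s, (d j).smulRight (u j)) ∘ₗ
          (LinearMap.id - (d i).smulRight (u i)) := by
      refine LinearMap.ext fun v => ?_
      have h3 : ∑ j ∈ s, d j (u i) • u j = 0 := by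
        refine Finset.sum_eq_zero fun j hj => ?_
        rw [hd, if_neg (fun h => hi (by rwa [← h])), zero_smul]
      simp only [Finset.sum_insert hi, LinearMap.sub_apply, LinearMap.id_apply,
        LinearMap.add_apply, LinearMap.coe_sum, Finset.sum_apply, LinearMap.smulRight_apply,
        LinearMap.comp_apply, map_sub, map_smul, h3]
      abel_nf
    rw [h1, ← ExteriorAlgebra.map_comp_map, AlgHom.comp_apply,
      map_id_sub_smulRight, hx i (Finset.mem_insert_self _ _), mul_zero,
      sub_zero]
    exact ih fun j hj => hx j (Finset.mem_insert_of_mem hj)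

theorem map_zero_eq_algebraMap (x : ExteriorAlgebra ℝ U) :
    ExteriorAlgebra.map (0 : U →ₗ[ℝ] U') x =
      algebraMap ℝ _ (ExteriorAlgebra.algebraMapInv x) := by
  have : ExteriorAlgebra.map (0 : U →ₗ[ℝ] U') =
      (Algebra.ofId ℝ (ExteriorAlgebra ℝ U')).comp ExteriorAlgebra.algebraMapInv := by
    apply ExteriorAlgebra.hom_ext
    ext u
    simp [ExteriorAlgebra.algebraMapInv]
  rw [this]; rfl

/-- An element annihilated by all contractions is a scalar. -/
theorem eq_algebraMap_of_contract_eq_zero [Module.Finite ℝ U] {x : ExteriorAlgebra ℝ U}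
    (hx : ∀ d : Module.Dual ℝ U, contract d x = 0) :
    x = algebraMap ℝ _ (ExteriorAlgebra.algebraMapInv x) := by
  have b := Module.finBasis ℝ U
  have h := map_eq_self_of_contract_eq_zero (fun i => b.coord i) b
    (fun i j => by rw [Module.Basis.coord_apply, Module.Basis.repr_self, Finsupp.single_apply]; simp only [eq_comm])
    Finset.univ (x := x) fun i _ => hx _
  -- For a full basis the projection is the zero map, and the zero map induces the augmentation.
  have h2 : (LinearMap.id - ∑ i, (b.coord i).smulRight (b i)) = 0 := by
    ext v
    simp [b.sum_repr]
  rw [h2, map_zero_eq_algebraMap] at h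
  exact h.symm

end Exterior

/-! ### Functoriality in the cotangent factor -/

section FormMap

variable {κ : Type} {W W' W'' : Type*} [AddCommGroup W] [Module ℝ W] [AddCommGroup W'] [Module ℝ W']
  [AddCommGroup W''] [Module ℝ W'']

/-- The homomorphism `⋀(⟨κ⟩ ⊕ W) → ⋀(⟨κ⟩ ⊕ W')` induced by `f : W → W'`. -/
def formMap (κ : Type) (f : W →ₗ[ℝ] W') :
    ExteriorAlgebra ℝ ((κ → ℝ) × W) →ₐ[ℝ] ExteriorAlgebra ℝ ((κ → ℝ) × W') :=
  ExteriorAlgebra.map (LinearMap.prodMap LinearMap.id f)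

theorem formMap_id : formMap κ (LinearMap.id : W →ₗ[ℝ] W) = AlgHom.id ℝ _ := by
  rw [formMap, LinearMap.prodMap_id, ExteriorAlgebra.map_id]

theorem formMap_formMap (g : W' →ₗ[ℝ] W'') (f : W →ₗ[ℝ] W')
    (x : ExteriorAlgebra ℝ ((κ → ℝ) × W)) :
    formMap κ g (formMap κ f x) = formMap κ (g ∘ₗ f) x := by
  rw [formMap, formMap, ← AlgHom.comp_apply, ExteriorAlgebra.map_comp_map]
  rfl

/-- The exterior multiplication by an element of `W`. -/
def basicι (κ : Type) (α : W) : ExteriorAlgebra ℝ ((κ → ℝ) × W) := ExteriorAlgebra.ι ℝ (0, α)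

theorem formMap_basicι (f : W →ₗ[ℝ] W') (α : W) :
    formMap κ f (basicι κ α) = basicι κ (f α) := by
  rw [formMap, basicι, ExteriorAlgebra.map_apply_ι]
  simp [basicι]

theorem formMap_contractGenerator (f : W →ₗ[ℝ] W') (k : κ)
    (x : ExteriorAlgebra ℝ ((κ → ℝ) × W)) :
    formMap κ f (contractGenerator k x) = contractGenerator k (formMap κ f x) := by
  have h : LinearMap.proj k ∘ₗ LinearMap.fst ℝ (κ → ℝ) W =
      (LinearMap.proj k ∘ₗ LinearMap.fst ℝ (κ → ℝ) W') ∘ₗ LinearMap.prodMap LinearMap.id f := rfl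
  rw [formMap, contractGenerator, h]
  exact map_contract _ _ x

/-- The inclusion of `⋀W`. -/
def basicIncl (κ : Type) (W : Type*) [AddCommGroup W] [Module ℝ W] :
    ExteriorAlgebra ℝ W →ₐ[ℝ] ExteriorAlgebra ℝ ((κ → ℝ) × W) :=
  ExteriorAlgebra.map (LinearMap.inr ℝ (κ → ℝ) W)

/-- The projection onto `⋀W`. -/
def basicProj (κ : Type) (W : Type*) [AddCommGroup W] [Module ℝ W] :
    ExteriorAlgebra ℝ ((κ → ℝ) × W) →ₐ[ℝ] ExteriorAlgebra ℝ W :=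
  ExteriorAlgebra.map (LinearMap.snd ℝ (κ → ℝ) W)

theorem basicProj_basicIncl (x : ExteriorAlgebra ℝ W) : basicProj κ W (basicIncl κ W x) = x := by
  rw [basicProj, basicIncl, ← AlgHom.comp_apply, ExteriorAlgebra.map_comp_map,
    LinearMap.snd_comp_inr, ExteriorAlgebra.map_id, AlgHom.id_apply]

theorem formMap_basicIncl (f : W →ₗ[ℝ] W') (x : ExteriorAlgebra ℝ W) :
    formMap κ f (basicIncl κ W x) = basicIncl κ W' (ExteriorAlgebra.map f x) := by
  rw [formMap, basicIncl, basicIncl, ← AlgHom.comp_apply, ← AlgHom.comp_apply,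
    ExteriorAlgebra.map_comp_map, ExteriorAlgebra.map_comp_map]
  have h : LinearMap.prodMap LinearMap.id f ∘ₗ LinearMap.inr ℝ (κ → ℝ) W =
      LinearMap.inr ℝ (κ → ℝ) W' ∘ₗ f := LinearMap.ext fun α => by simp
  rw [h]

/-- An element annihilated by the contractions with all generators is basic. -/
theorem basicIncl_basicProj_of_contractGenerator_eq_zero [Fintype κ] [DecidableEq κ]
    {x : ExteriorAlgebra ℝ ((κ → ℝ) × W)} (hx : ∀ k, contractGenerator k x = 0) :
    basicIncl κ W (basicProj κ W x) = x := by
  have hd : ∀ i j : κ, (LinearMap.proj i ∘ₗ LinearMap.fst ℝ (κ → ℝ) W)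
      ((Pi.single j 1, 0) : (κ → ℝ) × W) = if i = j then 1 else 0 := fun i j => by
    rw [LinearMap.comp_apply, LinearMap.fst_apply, LinearMap.proj_apply]
    dsimp only
    rw [Pi.single_apply]
  have hx' : ∀ k ∈ Finset.univ, contract (LinearMap.proj k ∘ₗ LinearMap.fst ℝ (κ → ℝ) W) x = 0 :=
    fun k _ => by rw [← hx k]; rfl
  have h := map_eq_self_of_contract_eq_zero _ _ hd Finset.univ hx'
  rw [basicProj, basicIncl, ← AlgHom.comp_apply, ExteriorAlgebra.map_comp_map]
  have h2 : LinearMap.inr ℝ (κ → ℝ) W ∘ₗ LinearMap.snd ℝ (κ → ℝ) W = LinearMap.id -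
      ∑ k, (LinearMap.proj k ∘ₗ LinearMap.fst ℝ (κ → ℝ) W).smulRight
        ((Pi.single k 1, 0) : (κ → ℝ) × W) := by
    refine LinearMap.ext fun ξ => Prod.ext ?_ ?_
    · refine funext fun j => ?_
      simp [Prod.fst_sum, Finset.sum_apply, Pi.single_apply]
    · simp [Prod.snd_sum]
  rw [h2]
  exact h

end FormMap

/-! ### Parity and graded commutators of operators -/

section Conjugation

variable {U U' : Type*} [AddCommGroup U] [Module ℝ U] [AddCommGroup U'] [Module ℝ U']

/-- Conjugation of operators on an exterior algebra by the grade involution; even operators are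
fixed by it and odd operators change sign. -/
def conj (P : Module.End ℝ (ExteriorAlgebra ℝ U)) : Module.End ℝ (ExteriorAlgebra ℝ U) :=
  gradeInv.toLinearMap ∘ₗ P ∘ₗ gradeInv.toLinearMap

theorem conj_apply (P : Module.End ℝ (ExteriorAlgebra ℝ U)) (x : ExteriorAlgebra ℝ U) :
    conj P x = gradeInv (P (gradeInv x)) := rfl

theorem conj_mul (P R : Module.End ℝ (ExteriorAlgebra ℝ U)) :
    conj (P * R) = conj P * conj R := by
  refine LinearMap.ext fun x => ?_
  simp only [conj_apply, Module.End.mul_apply, gradeInv_gradeInv]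

theorem conj_conj (P : Module.End ℝ (ExteriorAlgebra ℝ U)) : conj (conj P) = P := by
  refine LinearMap.ext fun x => ?_
  simp only [conj_apply, gradeInv_gradeInv]

theorem conj_add (P R : Module.End ℝ (ExteriorAlgebra ℝ U)) :
    conj (P + R) = conj P + conj R := by
  refine LinearMap.ext fun x => ?_
  simp only [conj_apply, LinearMap.add_apply, map_add]

theorem conj_sub (P R : Module.End ℝ (ExteriorAlgebra ℝ U)) :
    conj (P - R) = conj P - conj R := by
  refine LinearMap.ext fun x => ?_
  simp only [conj_apply, LinearMap.sub_apply, map_sub]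

theorem conj_smul (r : ℝ) (P : Module.End ℝ (ExteriorAlgebra ℝ U)) :
    conj (r • P) = r • conj P := by
  refine LinearMap.ext fun x => ?_
  simp only [conj_apply, LinearMap.smul_apply, map_smul]

theorem conj_zero : conj (0 : Module.End ℝ (ExteriorAlgebra ℝ U)) = 0 := by
  refine LinearMap.ext fun x => ?_
  simp only [conj_apply, LinearMap.zero_apply, map_zero]

theorem conj_mulLeft (a : ExteriorAlgebra ℝ U) :
    conj (LinearMap.mulLeft ℝ a) = LinearMap.mulLeft ℝ (gradeInv a) := by
  refine LinearMap.ext fun x => ?_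
  simp only [conj_apply, LinearMap.mulLeft_apply, map_mul, gradeInv_gradeInv]

theorem conj_contract (d : Module.Dual ℝ U) :
    conj (contract d) = -(contract d : Module.End ℝ (ExteriorAlgebra ℝ U)) := by
  refine LinearMap.ext fun x => ?_
  rw [conj_apply, contract_gradeInv, map_neg, gradeInv_gradeInv]
  rfl

/-- The graded commutator of an odd operator `h` with an operator `P` of arbitrary parity. -/
def superComm (h P : Module.End ℝ (ExteriorAlgebra ℝ U)) : Module.End ℝ (ExteriorAlgebra ℝ U) :=
  h * P - conj P * h

/-- The sum of the two iterated commutators is the ordinary commutator of `P` with `{a, b}`, which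
is a scalar and hence central. In particular, for `a = b` the iterated commutator vanishes. -/
theorem superComm_superComm {a b : Module.End ℝ (ExteriorAlgebra ℝ U)} (ha : conj a = -a)
    (hb : conj b = -b) {r : ℝ} (hab : a * b + b * a = algebraMap ℝ _ r)
    (P : Module.End ℝ (ExteriorAlgebra ℝ U)) :
    superComm a (superComm b P) = -superComm b (superComm a P) := by
  have h1 : superComm a (superComm b P) + superComm b (superComm a P) =
      (a * b + b * a) * P - P * (a * b + b * a) := by
    refine LinearMap.ext fun x => ?_
    simp only [superComm, conj_sub, conj_mul, conj_conj, ha, hb, LinearMap.sub_apply,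
      LinearMap.add_apply, Module.End.mul_apply, LinearMap.neg_apply, map_sub, map_add, map_neg]
    abel
  rw [hab, Algebra.commutes, sub_self] at h1
  exact eq_neg_of_add_eq_zero_left h1

theorem superComm_mul {g : Module.End ℝ (ExteriorAlgebra ℝ U)} (hg : conj g = -g)
    (h P : Module.End ℝ (ExteriorAlgebra ℝ U)) :
    superComm h (g * P) = (h * g + g * h) * P - g * superComm h P := by
  refine LinearMap.ext fun x => ?_
  simp only [superComm, conj_mul, hg, LinearMap.sub_apply,
    LinearMap.add_apply, Module.End.mul_apply, LinearMap.neg_apply, map_sub]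
  abel

theorem superComm_add (h P R : Module.End ℝ (ExteriorAlgebra ℝ U)) :
    superComm h (P + R) = superComm h P + superComm h R := by
  refine LinearMap.ext fun x => ?_
  simp only [superComm, conj_add, LinearMap.sub_apply,
    LinearMap.add_apply, Module.End.mul_apply, map_add]
  abel

theorem superComm_sub (h P R : Module.End ℝ (ExteriorAlgebra ℝ U)) :
    superComm h (P - R) = superComm h P - superComm h R := by
  refine LinearMap.ext fun x => ?_
  simp only [superComm, conj_sub, LinearMap.sub_apply, Module.End.mul_apply, map_sub]
  abel

theorem superComm_zero (h : Module.End ℝ (ExteriorAlgebra ℝ U)) : superComm h 0 = 0 := by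
  simp only [superComm, conj_zero, zero_mul, mul_zero, sub_zero]

theorem superComm_add_left (h h' P : Module.End ℝ (ExteriorAlgebra ℝ U)) :
    superComm (h + h') P = superComm h P + superComm h' P := by
  refine LinearMap.ext fun x => ?_
  simp only [superComm, LinearMap.sub_apply, LinearMap.add_apply, Module.End.mul_apply, map_add]
  abel

theorem superComm_smul_left (r : ℝ) (h P : Module.End ℝ (ExteriorAlgebra ℝ U)) :
    superComm (r • h) P = r • superComm h P := by
  simp only [superComm, smul_sub, smul_mul_assoc, mul_smul_comm]

theorem superComm_sum_left {ι : Type*} (s : Finset ι)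
    (h : ι → Module.End ℝ (ExteriorAlgebra ℝ U)) (P : Module.End ℝ (ExteriorAlgebra ℝ U)) :
    superComm (∑ i ∈ s, h i) P = ∑ i ∈ s, superComm (h i) P := by
  simp only [superComm, Finset.sum_mul, Finset.mul_sum, Finset.sum_sub_distrib]

/-- An operator that supercommutes with all exterior multiplications is itself one. -/
theorem eq_mulLeft_of_superComm_eq_zero {P : Module.End ℝ (ExteriorAlgebra ℝ U)}
    (h : ∀ u, superComm (LinearMap.mulLeft ℝ (ExteriorAlgebra.ι ℝ u)) P = 0) :
    P = LinearMap.mulLeft ℝ (P 1) := by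
  have h1 : ∀ u x, conj P (ExteriorAlgebra.ι ℝ u * x) = ExteriorAlgebra.ι ℝ u * P x := fun u x =>
    (LinearMap.congr_fun (sub_eq_zero.mp (h u)) x).symm
  have h2 : ∀ u x, P (ExteriorAlgebra.ι ℝ u * x) = ExteriorAlgebra.ι ℝ u * conj P x := by
    intro u x
    have h3 := congrArg conj (sub_eq_zero.mp (h u))
    rw [conj_mul, conj_mul, conj_conj, conj_mulLeft, gradeInv_ι] at h3
    have h4 := LinearMap.congr_fun h3 x
    simp only [Module.End.mul_apply, LinearMap.mulLeft_apply, neg_mul, map_neg, neg_inj] at h4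
    exact h4.symm
  have h5 : gradeInv (P 1) = conj P 1 := by rw [conj_apply, map_one gradeInv]
  -- `P` may have mixed parity, so each factor `ι u` exchanges `P` and `conj P`; the two formulas
  -- have to be proved together.
  have h6 : ∀ x, P x = P 1 * x ∧ conj P x = conj P 1 * x := by
    intro x
    induction x using exterior_left_induction with
    | algebraMap r =>
      simp only [Algebra.algebraMap_eq_smul_one, map_smul, mul_smul_comm, mul_one, and_self]
    | add x y hx hy => simp only [map_add, hx, hy, mul_add, and_self]
    | ι_mul u x hx =>
      refine ⟨?_, ?_⟩
      · rw [h2, hx.2, ← h5, ← mul_assoc, ι_mul_gradeInv, mul_assoc]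
      · rw [h1, hx.1, ← mul_assoc, ← gradeInv_gradeInv (P 1), ι_mul_gradeInv, h5, mul_assoc]
  exact LinearMap.ext fun x => (h6 x).1

end Conjugation

/-! ### `Clif(V ⊕ V*) ⊗ ⋀W` as the supercommutant of `W` -/

section CliffordAction

variable {κ : Type} {W W' : Type*} [AddCommGroup W] [Module ℝ W] [AddCommGroup W'] [Module ℝ W']

theorem clifGenerator_apply (z : Module.Dual ℝ (κ → ℝ) × (κ → ℝ))
    (x : ExteriorAlgebra ℝ ((κ → ℝ) × W)) :
    clifGenerator z x = contract (z.1 ∘ₗ LinearMap.fst ℝ (κ → ℝ) W) x +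
      ExteriorAlgebra.ι ℝ ((z.2, 0) : (κ → ℝ) × W) * x := rfl

theorem clifAction_ι (z : Module.Dual ℝ (κ → ℝ) × (κ → ℝ)) :
    (clifAction (CliffordAlgebra.ι _ z) : Module.End ℝ (ExteriorAlgebra ℝ ((κ → ℝ) × W))) =
      clifGenerator z :=
  CliffordAlgebra.lift_ι_apply _ _ _

theorem clifFormAction_tmul (a : Clif κ) (α : ExteriorAlgebra ℝ W) :
    clifFormAction (a ⊗ₜ α) = clifAction a * LinearMap.mulLeft ℝ (basicIncl κ W α) := rfl

theorem conj_clifGenerator (z : Module.Dual ℝ (κ → ℝ) × (κ → ℝ)) :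
    conj (clifGenerator z : Module.End ℝ (ExteriorAlgebra ℝ ((κ → ℝ) × W))) =
      -clifGenerator z := by
  refine LinearMap.ext fun x => ?_
  rw [conj_apply, LinearMap.neg_apply, clifGenerator_apply, clifGenerator_apply, map_add,
    contract_gradeInv, map_neg, gradeInv_gradeInv, map_mul, gradeInv_gradeInv, gradeInv_ι, neg_mul,
    neg_add]

theorem clifGenerator_mul_add_swap (z z' : Module.Dual ℝ (κ → ℝ) × (κ → ℝ)) :
    (clifGenerator z * clifGenerator z' + clifGenerator z' * clifGenerator z :
      Module.End ℝ (ExteriorAlgebra ℝ ((κ → ℝ) × W))) =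
      algebraMap ℝ _ (QuadraticMap.polar (QuadraticForm.dualProd ℝ (κ → ℝ)) z z') := by
  rw [← clifAction_ι, ← clifAction_ι, ← map_mul clifAction, ← map_mul clifAction, ← map_add,
    CliffordAlgebra.ι_mul_ι_add_swap, AlgHom.commutes]

theorem conj_clifAction (a : Clif κ) :
    conj (clifAction a : Module.End ℝ (ExteriorAlgebra ℝ ((κ → ℝ) × W))) =
      clifAction (CliffordAlgebra.involute a) := by
  induction a using CliffordAlgebra.left_induction with
  | algebraMap r =>
    rw [AlgHom.commutes, AlgHom.commutes, AlgHom.commutes, Algebra.algebraMap_eq_smul_one,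
      conj_smul]
    congr 1
    refine LinearMap.ext fun x => ?_
    rw [conj_apply, Module.End.one_apply, gradeInv_gradeInv, Module.End.one_apply]
  | add a b ha hb => simp only [map_add, conj_add, ha, hb]
  | ι_mul a z ha =>
    rw [map_mul, map_mul, conj_mul, ha, clifAction_ι, conj_clifGenerator,
      CliffordAlgebra.involute_ι, map_mul, map_neg, clifAction_ι]

theorem gradeInv_basicIncl (α : ExteriorAlgebra ℝ W) :
    gradeInv (basicIncl κ W α) = basicIncl κ W (gradeInv α) := (map_gradeInv _ α).symm

theorem conj_clifFormAction (t : Clif κ ⊗[ℝ] ExteriorAlgebra ℝ W) :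
    conj (clifFormAction t) = clifFormAction
      (TensorProduct.map CliffordAlgebra.involute.toLinearMap gradeInv.toLinearMap t) := by
  induction t using TensorProduct.induction_on with
  | zero => simp only [map_zero, conj_zero]
  | add s t hs ht => simp only [map_add, conj_add, hs, ht]
  | tmul a α =>
    rw [clifFormAction_tmul, conj_mul, conj_clifAction, conj_mulLeft, gradeInv_basicIncl]
    rfl

theorem contract_basicIncl (d : Module.Dual ℝ (κ → ℝ)) (α : ExteriorAlgebra ℝ W) :
    contract (d ∘ₗ LinearMap.fst ℝ (κ → ℝ) W) (basicIncl κ W α) = 0 := by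
  have h : (d ∘ₗ LinearMap.fst ℝ (κ → ℝ) W) ∘ₗ LinearMap.inr ℝ (κ → ℝ) W = 0 := by
    rw [LinearMap.comp_assoc, LinearMap.fst_comp_inr, LinearMap.comp_zero]
  rw [basicIncl, ← map_contract, h, contract, map_zero, LinearMap.zero_apply, map_zero]

theorem clifGenerator_mul_mulLeft (z : Module.Dual ℝ (κ → ℝ) × (κ → ℝ))
    (α : ExteriorAlgebra ℝ W) :
    clifGenerator z * LinearMap.mulLeft ℝ (basicIncl κ W α) =
      LinearMap.mulLeft ℝ (basicIncl κ W (gradeInv α)) * clifGenerator z := by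
  refine LinearMap.ext fun x => ?_
  rw [Module.End.mul_apply, Module.End.mul_apply, clifGenerator_apply, clifGenerator_apply,
    LinearMap.mulLeft_apply, LinearMap.mulLeft_apply, contract_mul, contract_basicIncl, zero_mul,
    zero_add, mul_add, gradeInv_basicIncl, ← mul_assoc _ _ x,
    ← gradeInv_gradeInv (basicIncl κ W α), ι_mul_gradeInv, gradeInv_basicIncl, mul_assoc]

/-- The contraction of the Clifford factor with the covector associated with `z`. -/
def clifContract (W : Type*) [AddCommGroup W] [Module ℝ W]
    (z : Module.Dual ℝ (κ → ℝ) × (κ → ℝ)) :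
    Clif κ ⊗[ℝ] ExteriorAlgebra ℝ W →ₗ[ℝ] Clif κ ⊗[ℝ] ExteriorAlgebra ℝ W :=
  (CliffordAlgebra.contractLeft
    (QuadraticMap.polarBilin (QuadraticForm.dualProd ℝ (κ → ℝ)) z)).rTensor _

/-- The graded commutator with a vector is a graded derivation, and on generators it is the polar
form; the same describes the contraction with that covector. -/
theorem ι_mul_sub_involute_mul_ι (z : Module.Dual ℝ (κ → ℝ) × (κ → ℝ)) (a : Clif κ) :
    CliffordAlgebra.ι _ z * a - CliffordAlgebra.involute a * CliffordAlgebra.ι _ z =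
      CliffordAlgebra.contractLeft
        (QuadraticMap.polarBilin (QuadraticForm.dualProd ℝ (κ → ℝ)) z) a := by
  induction a using CliffordAlgebra.left_induction with
  | algebraMap r =>
    rw [AlgHom.commutes, CliffordAlgebra.contractLeft_algebraMap, Algebra.commutes, sub_self]
  | add a b ha hb => rw [map_add, map_add, ← ha, ← hb, mul_add, add_mul]; abel
  | ι_mul a v ha =>
    have h := CliffordAlgebra.ι_mul_ι_add_swap (Q := QuadraticForm.dualProd ℝ (κ → ℝ)) z v
    rw [CliffordAlgebra.contractLeft_ι_mul, ← ha, map_mul, CliffordAlgebra.involute_ι, mul_sub,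
      neg_mul, neg_mul, sub_neg_eq_add, ← mul_assoc, eq_sub_of_add_eq h, sub_mul,
      ← Algebra.smul_def, QuadraticMap.polarBilin_apply_apply]
    simp only [mul_assoc]
    abel

/-- Contractions of the Clifford factor can be read off from the operator alone. So if `t` acts by
zero, all its contractions do too, which drives the proof of faithfulness. -/
theorem superComm_clifFormAction (z : Module.Dual ℝ (κ → ℝ) × (κ → ℝ))
    (t : Clif κ ⊗[ℝ] ExteriorAlgebra ℝ W) :
    superComm (clifGenerator z) (clifFormAction t) = clifFormAction (clifContract W z t) := by
  induction t using TensorProduct.induction_on with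
  | zero => simp only [map_zero, superComm_zero]
  | add s t hs ht =>
    rw [map_add, map_add, map_add, ← hs, ← ht]
    simp only [superComm, conj_add, mul_add, add_mul]
    abel
  | tmul a α =>
    have h' := clifGenerator_mul_mulLeft (κ := κ) z α
    rw [clifContract, LinearMap.rTensor_tmul, clifFormAction_tmul, clifFormAction_tmul, superComm,
      conj_mul, conj_clifAction, conj_mulLeft, gradeInv_basicIncl, mul_assoc (clifAction _), ← h',
      ← ι_mul_sub_involute_mul_ι, map_sub, map_mul clifAction, map_mul clifAction, clifAction_ι]
    refine LinearMap.ext fun x => ?_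
    simp only [LinearMap.sub_apply, Module.End.mul_apply]

/-- The linear isomorphism with the exterior algebra commutes with contractions and fixes scalars,
so the exterior case applies. -/
theorem eq_algebraMap_of_clif_contract_eq_zero [Finite κ] {a : Clif κ}
    (ha : ∀ d, CliffordAlgebra.contractLeft d a = 0) : ∃ r : ℝ, a = algebraMap ℝ _ r := by
  let e := CliffordAlgebra.equivExterior (QuadraticForm.dualProd ℝ (κ → ℝ))
  have h : e a = algebraMap ℝ _ (ExteriorAlgebra.algebraMapInv (e a)) := by
    apply eq_algebraMap_of_contract_eq_zero
    intro d
    have := CliffordAlgebra.changeForm_contractLeft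
      (CliffordAlgebra.changeForm.associated_neg_proof
        (Q := QuadraticForm.dualProd ℝ (κ → ℝ))) d a
    rw [ha, map_zero] at this
    exact this.symm
  refine ⟨ExteriorAlgebra.algebraMapInv (e a), e.injective (h.trans ?_)⟩
  exact (CliffordAlgebra.changeForm_algebraMap (CliffordAlgebra.changeForm.associated_neg_proof
    (Q := QuadraticForm.dualProd ℝ (κ → ℝ))) _).symm

theorem eq_one_tmul_of_contract_eq_zero [Finite κ] {t : Clif κ ⊗[ℝ] ExteriorAlgebra ℝ W}
    (ht : ∀ d, (CliffordAlgebra.contractLeft d).rTensor (ExteriorAlgebra ℝ W) t = 0) :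
    ∃ α : ExteriorAlgebra ℝ W, t = 1 ⊗ₜ α := by
  classical
  let b := Module.Basis.ofVectorSpace ℝ (ExteriorAlgebra ℝ W)
  let e := TensorProduct.equivFinsuppOfBasisRight (M := Clif κ) b
  have h1 : ∀ d i s, e ((CliffordAlgebra.contractLeft d).rTensor (ExteriorAlgebra ℝ W) s) i =
      CliffordAlgebra.contractLeft d (e s i) := by
    intro d i s
    induction s using TensorProduct.induction_on with
    | zero => simp only [map_zero, Finsupp.zero_apply]
    | add s t hs ht => simp only [map_add, Finsupp.add_apply, hs, ht]
    | tmul a α =>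
      rw [LinearMap.rTensor_tmul, TensorProduct.equivFinsuppOfBasisRight_apply_tmul_apply,
        TensorProduct.equivFinsuppOfBasisRight_apply_tmul_apply, map_smul]
  have h2 : ∀ i, ∃ r : ℝ, e t i = algebraMap ℝ _ r := fun i =>
    eq_algebraMap_of_clif_contract_eq_zero fun d => by
      rw [← h1, ht, map_zero, Finsupp.zero_apply]
  choose r hr using h2
  refine ⟨∑ i ∈ (e t).support, r i • b i, ?_⟩
  conv_lhs => rw [← e.symm_apply_apply t]
  rw [TensorProduct.equivFinsuppOfBasisRight_symm_apply, Finsupp.sum, TensorProduct.tmul_sum]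
  refine Finset.sum_congr rfl fun i _ => ?_
  rw [hr, Algebra.algebraMap_eq_smul_one, TensorProduct.smul_tmul]

/-- The generators of the Clifford algebra: the contractions `∂ₖ` and the exterior products with the
generators `k`. -/
def clifBasis [DecidableEq κ] : κ ⊕ κ → Module.Dual ℝ (κ → ℝ) × (κ → ℝ) :=
  Sum.elim (fun k => (LinearMap.proj k, 0)) (fun k => (0, Pi.single k 1))

/-- `Sum.swap` pairs each contraction with the exterior product dual to it; generator `i.swap` is
therefore the one that undoes a commutator with generator `i`. -/
theorem polar_clifBasis [DecidableEq κ] (i j : κ ⊕ κ) :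
    QuadraticMap.polar (QuadraticForm.dualProd ℝ (κ → ℝ)) (clifBasis i) (clifBasis j.swap) =
      if i = j then 1 else 0 := by
  rcases i with i | i <;> rcases j with j | j <;>
    simp [clifBasis, QuadraticMap.polar, Pi.single_apply, eq_comm]

/-- Nondegeneracy of the pairing: a Clifford element killed by the contractions with the generators
is killed by all contractions. -/
theorem dual_eq_sum_polarBilin [Fintype κ] [DecidableEq κ]
    (d : Module.Dual ℝ (Module.Dual ℝ (κ → ℝ) × (κ → ℝ))) :
    d = ∑ k, (d (LinearMap.proj k, 0) •
        QuadraticMap.polarBilin (QuadraticForm.dualProd ℝ (κ → ℝ)) (clifBasis (.inr k)) +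
      d (0, Pi.single k 1) •
        QuadraticMap.polarBilin (QuadraticForm.dualProd ℝ (κ → ℝ)) (clifBasis (.inl k))) := by
  refine LinearMap.ext fun z => ?_
  obtain ⟨v, ξ⟩ := z
  have h1 : ((v, ξ) : Module.Dual ℝ (κ → ℝ) × (κ → ℝ)) =
      ∑ k, (v (Pi.single k 1) • ((LinearMap.proj k, 0) : Module.Dual ℝ (κ → ℝ) × (κ → ℝ)) +
        ξ k • ((0, Pi.single k 1) : Module.Dual ℝ (κ → ℝ) × (κ → ℝ))) := by
    refine Prod.ext (LinearMap.pi_ext' fun j => LinearMap.ext_ring ?_) (funext fun j => ?_)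
    · simp [Prod.fst_sum, Pi.single_apply]
    · simp [Prod.snd_sum, Pi.single_apply]
  conv_lhs => rw [h1]
  rw [map_sum, LinearMap.sum_apply]
  refine Finset.sum_congr rfl fun k _ => ?_
  rw [map_add, map_smul, map_smul]
  simp [clifBasis, QuadraticMap.polar, mul_comm]

theorem clifContract_clifContract (z z' : Module.Dual ℝ (κ → ℝ) × (κ → ℝ))
    (t : Clif κ ⊗[ℝ] ExteriorAlgebra ℝ W) :
    clifContract W z (clifContract W z' t) = -clifContract W z' (clifContract W z t) := by
  induction t using TensorProduct.induction_on with
  | zero => simp only [map_zero, neg_zero]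
  | add s t hs ht => simp only [map_add, hs, ht, neg_add]
  | tmul a α =>
    simp only [clifContract, LinearMap.rTensor_tmul]
    rw [CliffordAlgebra.contractLeft_comm, TensorProduct.neg_tmul]

theorem clifFormAction_injective [Fintype κ] [DecidableEq κ] : Function.Injective
    (clifFormAction : Clif κ ⊗[ℝ] ExteriorAlgebra ℝ W →ₗ[ℝ] _) := by
  rw [injective_iff_map_eq_zero]
  -- Induction on the set `s` of generators whose contraction of `t` is not yet known to vanish.
  -- Contractions square to zero and anticommute, so contracting `t` with `i` gives an element to
  -- which the smaller set applies; it vanishes, and then the smaller set applies to `t` itself.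
  -- With `s` empty, `t` is `1 ⊗ α`, and its value on `1` is `α`.
  have key : ∀ (s : Finset (κ ⊕ κ)) (t : Clif κ ⊗[ℝ] ExteriorAlgebra ℝ W), clifFormAction t = 0 →
      (∀ i ∉ s, clifContract W (clifBasis i) t = 0) → t = 0 := by
    intro s
    induction s using Finset.induction_on with
    | empty =>
      intro t ht h
      obtain ⟨α, rfl⟩ : ∃ α : ExteriorAlgebra ℝ W, t = 1 ⊗ₜ α := by
        refine eq_one_tmul_of_contract_eq_zero fun d => ?_
        let φ := LinearMap.applyₗ t ∘ₗ LinearMap.rTensorHom (ExteriorAlgebra ℝ W) ∘ₗ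
          CliffordAlgebra.contractLeft (Q := QuadraticForm.dualProd ℝ (κ → ℝ))
        have hφ : ∀ i, φ (QuadraticMap.polarBilin (QuadraticForm.dualProd ℝ (κ → ℝ))
          (clifBasis i)) = 0 := fun i => h i (Finset.notMem_empty i)
        change φ d = 0
        rw [dual_eq_sum_polarBilin d, map_sum]
        refine Finset.sum_eq_zero fun k _ => ?_
        rw [map_add, map_smul, map_smul, hφ, hφ, smul_zero, smul_zero, add_zero]
      have h1 := LinearMap.congr_fun ht 1
      rw [clifFormAction_tmul, map_one clifAction, one_mul, LinearMap.mulLeft_apply, mul_one,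
        LinearMap.zero_apply] at h1
      rw [← basicProj_basicIncl (κ := κ) α, h1, map_zero, TensorProduct.tmul_zero]
    | insert i s _ ih =>
      intro t ht h
      have h0 : ∀ j, clifFormAction (clifContract W (clifBasis j) t) = 0 := fun j => by
        rw [← superComm_clifFormAction, ht, superComm_zero]
      have h1 : clifContract W (clifBasis i) t = 0 := by
        refine ih _ (h0 i) fun j hj => ?_
        rcases eq_or_ne j i with rfl | hji
        · exact eq_zero_of_eq_neg (clifContract_clifContract _ _ t)
        · rw [clifContract_clifContract, h j (by simp [hj, hji]), map_zero, neg_zero]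
      refine ih t ht fun j hj => ?_
      rcases eq_or_ne j i with rfl | hji
      · exact h1
      · exact h j (by simp [hj, hji])
  exact fun t ht => key Finset.univ t ht fun i hi => absurd (Finset.mem_univ i) hi

theorem clifGenerator_mul_clifFormAction (z : Module.Dual ℝ (κ → ℝ) × (κ → ℝ))
    (t : Clif κ ⊗[ℝ] ExteriorAlgebra ℝ W) :
    ∃ s, clifGenerator z * clifFormAction t = clifFormAction s := by
  induction t using TensorProduct.induction_on with
  | zero => exact ⟨0, by rw [map_zero, mul_zero]⟩
  | add s t hs ht =>
    obtain ⟨s', hs⟩ := hs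
    obtain ⟨t', ht⟩ := ht
    exact ⟨s' + t', by rw [map_add, map_add, mul_add, hs, ht]⟩
  | tmul a α =>
    refine ⟨(CliffordAlgebra.ι _ z * a) ⊗ₜ α, ?_⟩
    rw [clifFormAction_tmul, clifFormAction_tmul, map_mul clifAction, clifAction_ι, mul_assoc]

theorem basicIncl_ι (α : W) : basicIncl κ W (ExteriorAlgebra.ι ℝ α) = basicι κ α := by
  rw [basicIncl, ExteriorAlgebra.map_apply_ι]; rfl

theorem conj_mulLeft_basicι (α : W) :
    conj (LinearMap.mulLeft ℝ (basicι κ α)) = -LinearMap.mulLeft ℝ (basicι κ α) := by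
  rw [conj_mulLeft, basicι, gradeInv_ι]
  refine LinearMap.ext fun x => ?_
  simp only [LinearMap.mulLeft_apply, LinearMap.neg_apply, neg_mul]

theorem basicι_mul_clifGenerator_add (α : W) (z : Module.Dual ℝ (κ → ℝ) × (κ → ℝ)) :
    LinearMap.mulLeft ℝ (basicι κ α) * clifGenerator z +
      clifGenerator z * LinearMap.mulLeft ℝ (basicι κ α) = 0 := by
  rw [← basicIncl_ι, clifGenerator_mul_mulLeft, gradeInv_ι, map_neg]
  refine LinearMap.ext fun x => ?_
  simp only [LinearMap.mulLeft_apply, LinearMap.add_apply, Module.End.mul_apply, neg_mul,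
    add_neg_cancel, LinearMap.zero_apply]

/-- An operator on `⋀(⟨κ⟩ ⊕ W)` that supercommutes with the exterior products with elements of `W`
is the action of an element of `Clif(V ⊕ V*) ⊗ ⋀W`. -/
theorem exists_eq_clifFormAction [Fintype κ] [DecidableEq κ]
    {P : Module.End ℝ (ExteriorAlgebra ℝ ((κ → ℝ) × W))}
    (hP : ∀ α : W, superComm (LinearMap.mulLeft ℝ (basicι κ α)) P = 0) :
    ∃ t, P = clifFormAction t := by
  -- Induction on the set `s` of generators that need not supercommute with `P`.
  have key : ∀ (s : Finset (κ ⊕ κ)) (P : Module.End ℝ (ExteriorAlgebra ℝ ((κ → ℝ) × W))),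
      (∀ α : W, superComm (LinearMap.mulLeft ℝ (basicι κ α)) P = 0) →
      (∀ i ∉ s, superComm (clifGenerator (clifBasis i)) P = 0) → ∃ t, P = clifFormAction t := by
    intro s
    induction s using Finset.induction_on with
    | empty =>
      intro P h1 h2
      -- All exterior products supercommute with `P`, so `P` is multiplication by `P 1`. As the `∂ₖ`
      -- supercommute with `P` and kill `1`, they kill `P 1`, which is therefore basic.
      have h3 : P = LinearMap.mulLeft ℝ (P 1) := by
        refine eq_mulLeft_of_superComm_eq_zero fun ⟨ξ, α⟩ => ?_
        have h4 : LinearMap.mulLeft ℝ (ExteriorAlgebra.ι ℝ ((ξ, α) : (κ → ℝ) × W)) =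
            ∑ k, ξ k • clifGenerator (clifBasis (.inr k)) +
              LinearMap.mulLeft ℝ (basicι κ α) := by
          refine LinearMap.ext fun x => ?_
          have h5 : ((ξ, α) : (κ → ℝ) × W) =
              ∑ k, ξ k • ((Pi.single k 1, 0) : (κ → ℝ) × W) + (0, α) := by
            refine Prod.ext (funext fun j => ?_) ?_
            · simp [Prod.fst_sum, Pi.single_apply]
            · simp [Prod.snd_sum]
          simp only [LinearMap.add_apply, LinearMap.coe_sum, Finset.sum_apply,
            LinearMap.smul_apply, LinearMap.mulLeft_apply, clifGenerator_apply, clifBasis,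
            Sum.elim_inr, LinearMap.zero_comp, contract, map_zero, LinearMap.zero_apply, zero_add]
          rw [h5, map_add, map_sum, add_mul, Finset.sum_mul]
          simp only [map_smul, smul_mul_assoc]
          rfl
        rw [h4, superComm_add_left, superComm_sum_left, h1, add_zero]
        refine Finset.sum_eq_zero fun k _ => ?_
        rw [superComm_smul_left, h2 _ (Finset.notMem_empty _), smul_zero]
      have h6 : basicIncl κ W (basicProj κ W (P 1)) = P 1 := by
        refine basicIncl_basicProj_of_contractGenerator_eq_zero fun k => ?_
        have h7 := LinearMap.congr_fun (h2 (.inl k) (Finset.notMem_empty _)) 1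
        simp only [superComm, LinearMap.sub_apply, Module.End.mul_apply, clifGenerator_apply,
          clifBasis, Sum.elim_inl, contract_one, Prod.mk_zero_zero, map_zero, zero_mul, add_zero,
          sub_zero, LinearMap.zero_apply] at h7
        exact h7
      refine ⟨1 ⊗ₜ basicProj κ W (P 1), ?_⟩
      rw [clifFormAction_tmul, map_one clifAction, one_mul, h6]
      exact h3
    | insert i s hi ih =>
      intro P h1 h2
      have hg := fun j => conj_clifGenerator (W := W) (κ := κ) (clifBasis j)
      have hb := fun α : W => conj_mulLeft_basicι (κ := κ) α
      have hz : (0 : Module.End ℝ (ExteriorAlgebra ℝ ((κ → ℝ) × W))) = algebraMap ℝ _ 0 :=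
        (map_zero _).symm
      have h3 : ∀ α : W, superComm (LinearMap.mulLeft ℝ (basicι κ α))
          (superComm (clifGenerator (clifBasis i)) P) = 0 := fun α => by
        rw [superComm_superComm (hb α) (hg i) ((basicι_mul_clifGenerator_add α _).trans hz), h1,
          superComm_zero, neg_zero]
      have h4 : ∀ j ∉ s, superComm (clifGenerator (clifBasis j))
          (superComm (clifGenerator (clifBasis i)) P) = 0 := fun j hj => by
        have h5 := superComm_superComm (hg j) (hg i) (clifGenerator_mul_add_swap _ _) P
        rcases eq_or_ne j i with rfl | hji
        · exact eq_zero_of_eq_neg h5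
        · rw [h5, h2 j (by simp [hj, hji]), superComm_zero, neg_zero]
      obtain ⟨t, ht⟩ := ih _ h3 h4
      -- With `g` the generator dual to `gᵢ`, subtract `g [gᵢ, P]` from `P`. Since `{gᵢ, g} = 1` and
      -- `[gᵢ, P]` supercommutes with `gᵢ`, the difference supercommutes with `gᵢ`; for the other
      -- generators outside `s` nothing is lost because they anticommute with `g`.
      obtain ⟨t', ht'⟩ := clifGenerator_mul_clifFormAction (clifBasis i.swap) t
      have h6 : ∃ t'', P - clifGenerator (clifBasis i.swap) *
          superComm (clifGenerator (clifBasis i)) P = clifFormAction t'' := by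
        refine ih _ (fun α => ?_) fun j hj => ?_
        · rw [superComm_sub, superComm_mul (hg _), h1, h3, basicι_mul_clifGenerator_add, zero_mul,
            mul_zero, sub_zero, sub_zero]
        · rw [superComm_sub, superComm_mul (hg _), h4 j hj, clifGenerator_mul_add_swap,
            polar_clifBasis, mul_zero, sub_zero]
          rcases eq_or_ne j i with rfl | hji
          · rw [if_pos rfl, map_one, one_mul, sub_self]
          · rw [h2 j (by simp [hj, hji]), if_neg hji, map_zero, zero_mul, sub_zero]
      obtain ⟨t'', ht''⟩ := h6
      refine ⟨t'' + t', ?_⟩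
      rw [map_add, ← ht'', ← ht', ht, sub_add_cancel]
  exact key Finset.univ P hP fun i hi => absurd (Finset.mem_univ i) hi

/-- The converse of the preceding criterion: elements of `W` anticommute with every Clifford
generator and with each other. -/
theorem superComm_basicι_clifFormAction (α : W) (t : Clif κ ⊗[ℝ] ExteriorAlgebra ℝ W) :
    superComm (LinearMap.mulLeft ℝ (basicι κ α)) (clifFormAction t) = 0 := by
  have h1 : ∀ a : Clif κ, LinearMap.mulLeft ℝ (basicι κ α) * clifAction a =
      clifAction (CliffordAlgebra.involute a) * LinearMap.mulLeft ℝ (basicι κ α) := by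
    intro a
    induction a using CliffordAlgebra.left_induction with
    | algebraMap r => simp only [AlgHom.commutes, Algebra.commutes]
    | add a b ha hb => rw [map_add, map_add, map_add, mul_add, add_mul, ha, hb]
    | ι_mul a z ha =>
      rw [map_mul CliffordAlgebra.involute, map_mul clifAction, map_mul clifAction, clifAction_ι,
        ← mul_assoc,
        eq_neg_of_add_eq_zero_left (basicι_mul_clifGenerator_add α z),
        CliffordAlgebra.involute_ι, map_neg clifAction, clifAction_ι]
      refine LinearMap.ext fun x => ?_
      have := LinearMap.congr_fun ha x
      simp only [Module.End.mul_apply, LinearMap.neg_apply] at this ⊢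
      rw [this]
  induction t using TensorProduct.induction_on with
  | zero => simp only [map_zero, superComm_zero]
  | add s t hs ht => rw [map_add, superComm_add, hs, ht, add_zero]
  | tmul a y =>
    rw [superComm, clifFormAction_tmul, conj_mul, conj_clifAction, conj_mulLeft, ← mul_assoc, h1,
      mul_assoc, mul_assoc]
    have h2 : LinearMap.mulLeft ℝ (basicι κ α) * LinearMap.mulLeft ℝ (basicIncl κ W y) =
        LinearMap.mulLeft ℝ (gradeInv (basicIncl κ W y)) * LinearMap.mulLeft ℝ (basicι κ α) := by
      refine LinearMap.ext fun x => ?_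
      simp only [Module.End.mul_apply, LinearMap.mulLeft_apply, ← mul_assoc, basicι]
      rw [← ι_mul_gradeInv, gradeInv_gradeInv]
    rw [h2, sub_self]

end CliffordAction

/-! ### Operator characterisation of the fibres of `C` -/

section CliffordOperators

variable {κ : Type} {W W' : Type*} [AddCommGroup W] [Module ℝ W] [AddCommGroup W'] [Module ℝ W']

/-- The grade involution of `Clif(V ⊕ V*) ⊗ ⋀W`. -/
def tensorInv (κ : Type) (W : Type*) [AddCommGroup W] [Module ℝ W] :
    Clif κ ⊗[ℝ] ExteriorAlgebra ℝ W →ₗ[ℝ] Clif κ ⊗[ℝ] ExteriorAlgebra ℝ W :=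
  TensorProduct.map CliffordAlgebra.involute.toLinearMap gradeInv.toLinearMap

theorem tensorInv_of_mem_oddClifForm {t : Clif κ ⊗[ℝ] ExteriorAlgebra ℝ W}
    (ht : t ∈ oddClifForm κ W) : tensorInv κ W t = -t := by
  have h : oddClifForm κ W ≤ LinearMap.ker (tensorInv κ W + LinearMap.id) := by
    refine sup_le (Submodule.map₂_le.mpr fun a ha α hα => ?_)
      (Submodule.map₂_le.mpr fun a ha α hα => ?_)
    · have h1 := CliffordAlgebra.involute_eq_of_mem_even ha
      have h2 := mem_oddPart_iff.mp hα
      rw [LinearMap.mem_ker, TensorProduct.mk_apply, LinearMap.add_apply, tensorInv,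
        TensorProduct.map_tmul, AlgHom.toLinearMap_apply, AlgHom.toLinearMap_apply, h1, h2,
        TensorProduct.tmul_neg, LinearMap.id_apply, neg_add_cancel]
    · have h1 := CliffordAlgebra.involute_eq_of_mem_odd ha
      have h2 := mem_evenPart_iff.mp hα
      rw [LinearMap.mem_ker, TensorProduct.mk_apply, LinearMap.add_apply, tensorInv,
        TensorProduct.map_tmul, AlgHom.toLinearMap_apply, AlgHom.toLinearMap_apply, h1, h2,
        TensorProduct.neg_tmul, LinearMap.id_apply, neg_add_cancel]
  exact eq_neg_of_add_eq_zero_left (h ht)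

theorem sub_tensorInv_mem_oddClifForm (t : Clif κ ⊗[ℝ] ExteriorAlgebra ℝ W) :
    t - tensorInv κ W t ∈ oddClifForm κ W := by
  induction t using TensorProduct.induction_on with
  | zero => rw [map_zero, sub_zero]; exact Submodule.zero_mem _
  | add s t hs ht => rw [map_add, add_sub_add_comm]; exact Submodule.add_mem _ hs ht
  | tmul a α =>
    have ha : a ∈ CliffordAlgebra.evenOdd (QuadraticForm.dualProd ℝ (κ → ℝ)) 0 ⊔
        CliffordAlgebra.evenOdd (QuadraticForm.dualProd ℝ (κ → ℝ)) 1 := by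
      rw [(CliffordAlgebra.evenOdd_isCompl _).sup_eq_top]; trivial
    have hα : α ∈ evenPart W ⊔ oddPart W := by
      rw [evenPart, oddPart, (CliffordAlgebra.evenOdd_isCompl _).sup_eq_top]; trivial
    obtain ⟨a₀, ha₀, a₁, ha₁, rfl⟩ := Submodule.mem_sup.mp ha
    obtain ⟨α₀, hα₀, α₁, hα₁, rfl⟩ := Submodule.mem_sup.mp hα
    have h : ((a₀ + a₁) ⊗ₜ (α₀ + α₁) : Clif κ ⊗[ℝ] ExteriorAlgebra ℝ W) -
        tensorInv κ W ((a₀ + a₁) ⊗ₜ (α₀ + α₁)) =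
        (2 : ℝ) • (a₀ ⊗ₜ α₁) + (2 : ℝ) • (a₁ ⊗ₜ α₀) := by
      rw [tensorInv, TensorProduct.map_tmul, AlgHom.toLinearMap_apply, AlgHom.toLinearMap_apply,
        map_add, map_add, CliffordAlgebra.involute_eq_of_mem_even ha₀,
        CliffordAlgebra.involute_eq_of_mem_odd ha₁, mem_evenPart_iff.mp hα₀,
        mem_oddPart_iff.mp hα₁]
      simp only [TensorProduct.add_tmul, TensorProduct.tmul_add, TensorProduct.neg_tmul,
        TensorProduct.tmul_neg, two_smul]
      abel
    rw [h]
    exact Submodule.add_mem _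
      (Submodule.smul_mem _ _ (Submodule.mem_sup_left (Submodule.apply_mem_map₂ _ ha₀ hα₁)))
      (Submodule.smul_mem _ _ (Submodule.mem_sup_right (Submodule.apply_mem_map₂ _ ha₁ hα₀)))

/-- The involution is `1` on the even and `-1` on the odd part, so `t` minus its image is twice its
odd part. This makes oddness of an element testable on the operator by which it acts. -/
theorem mem_oddClifForm_iff {t : Clif κ ⊗[ℝ] ExteriorAlgebra ℝ W} :
    t ∈ oddClifForm κ W ↔ tensorInv κ W t = -t := by
  refine ⟨tensorInv_of_mem_oddClifForm, fun h => ?_⟩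
  have h1 := sub_tensorInv_mem_oddClifForm t
  rw [h, sub_neg_eq_add, ← two_smul ℝ] at h1
  simpa using Submodule.smul_mem _ (2⁻¹ : ℝ) h1

/-- The contraction of the `W`-factors with a covector on `W`. -/
def vecContract (κ : Type) (X : Module.Dual ℝ W) :
    Module.End ℝ (ExteriorAlgebra ℝ ((κ → ℝ) × W)) :=
  contract (X ∘ₗ LinearMap.snd ℝ (κ → ℝ) W)

/-- The operator by which a pair of a covector `X` on `W` and an element of `Clif(V ⊕ V*) ⊗ ⋀W`
acts on `⋀(⟨κ⟩ ⊕ W)`. -/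
def pairAction (κ : Type) (W : Type*) [AddCommGroup W] [Module ℝ W] :
    Module.Dual ℝ W × (Clif κ ⊗[ℝ] ExteriorAlgebra ℝ W) →ₗ[ℝ]
      Module.End ℝ (ExteriorAlgebra ℝ ((κ → ℝ) × W)) :=
  LinearMap.coprod
    (CliffordAlgebra.contractLeft (Q := (0 : QuadraticForm ℝ ((κ → ℝ) × W))) ∘ₗ
      (LinearMap.snd ℝ (κ → ℝ) W).dualMap) clifFormAction

theorem pairAction_apply (X : Module.Dual ℝ W) (t : Clif κ ⊗[ℝ] ExteriorAlgebra ℝ W) :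
    pairAction κ W (X, t) = vecContract κ X + clifFormAction t := rfl

/-- `P` is an odd operator whose graded commutator with the exterior product with `α ∈ W` is the
scalar `X α`. -/
structure IsCliffordOp (P : Module.End ℝ (ExteriorAlgebra ℝ ((κ → ℝ) × W)))
    (X : Module.Dual ℝ W) : Prop where
  odd : conj P = -P
  anticomm : ∀ (α : W) x, P (basicι κ α * x) = X α • x - basicι κ α * P x

theorem isCliffordOp_vecContract (X : Module.Dual ℝ W) : IsCliffordOp (vecContract κ X) X where
  odd := conj_contract _
  anticomm α x := contract_ι_mul (X ∘ₗ LinearMap.snd ℝ (κ → ℝ) W) (0, α) x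

theorem superComm_basicι_apply {P : Module.End ℝ (ExteriorAlgebra ℝ ((κ → ℝ) × W))}
    (hP : conj P = -P) (α : W) (x : ExteriorAlgebra ℝ ((κ → ℝ) × W)) :
    superComm (LinearMap.mulLeft ℝ (basicι κ α)) P x =
      P (basicι κ α * x) + basicι κ α * P x := by
  rw [superComm, hP, LinearMap.sub_apply, Module.End.mul_apply, Module.End.mul_apply,
    LinearMap.mulLeft_apply, LinearMap.mulLeft_apply, LinearMap.neg_apply, sub_neg_eq_add,
    add_comm]

theorem isCliffordOp_clifFormAction {t : Clif κ ⊗[ℝ] ExteriorAlgebra ℝ W}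
    (ht : t ∈ oddClifForm κ W) : IsCliffordOp (clifFormAction t) 0 := by
  have h : conj (clifFormAction t) = -clifFormAction t := by
    rw [conj_clifFormAction, ← map_neg, ← mem_oddClifForm_iff.mp ht]; rfl
  refine ⟨h, fun α x => ?_⟩
  have h1 := superComm_basicι_apply h α x
  rw [superComm_basicι_clifFormAction] at h1
  rw [LinearMap.zero_apply, zero_smul, zero_sub]
  exact eq_neg_of_add_eq_zero_left h1.symm

theorem IsCliffordOp.add {P R : Module.End ℝ (ExteriorAlgebra ℝ ((κ → ℝ) × W))}
    {X Y : Module.Dual ℝ W} (hP : IsCliffordOp P X) (hR : IsCliffordOp R Y) :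
    IsCliffordOp (P + R) (X + Y) where
  odd := by rw [conj_add, hP.odd, hR.odd, neg_add]
  anticomm α x := by
    simp only [LinearMap.add_apply, hP.anticomm, hR.anticomm, add_smul, mul_add]
    abel

theorem IsCliffordOp.sub {P R : Module.End ℝ (ExteriorAlgebra ℝ ((κ → ℝ) × W))}
    {X Y : Module.Dual ℝ W} (hP : IsCliffordOp P X) (hR : IsCliffordOp R Y) :
    IsCliffordOp (P - R) (X - Y) where
  odd := by rw [conj_sub, hP.odd, hR.odd, neg_sub_neg, neg_sub]
  anticomm α x := by
    simp only [LinearMap.sub_apply, hP.anticomm, hR.anticomm, sub_smul, mul_sub]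
    abel

theorem IsCliffordOp.smul {P : Module.End ℝ (ExteriorAlgebra ℝ ((κ → ℝ) × W))}
    {X : Module.Dual ℝ W} (r : ℝ) (hP : IsCliffordOp P X) : IsCliffordOp (r • P) (r • X) where
  odd := by rw [conj_smul, hP.odd, smul_neg]
  anticomm α x := by
    simp only [LinearMap.smul_apply, hP.anticomm, smul_sub, mul_smul_comm, smul_assoc]

theorem IsCliffordOp.zero :
    IsCliffordOp (0 : Module.End ℝ (ExteriorAlgebra ℝ ((κ → ℝ) × W))) 0 where
  odd := by rw [conj_zero, neg_zero]
  anticomm α x := by simp only [LinearMap.zero_apply, zero_smul, mul_zero, sub_zero]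

theorem IsCliffordOp.sum {ι : Type*} (s : Finset ι)
    {P : ι → Module.End ℝ (ExteriorAlgebra ℝ ((κ → ℝ) × W))}
    {X : ι → Module.Dual ℝ W} (hP : ∀ i, IsCliffordOp (P i) (X i)) :
    IsCliffordOp (∑ i ∈ s, P i) (∑ i ∈ s, X i) := by
  classical
  induction s using Finset.induction_on with
  | empty => simpa using IsCliffordOp.zero
  | insert i s hi ih => rw [Finset.sum_insert hi, Finset.sum_insert hi]; exact (hP i).add ih

theorem isCliffordOp_pairAction (X : Module.Dual ℝ W) {t : Clif κ ⊗[ℝ] ExteriorAlgebra ℝ W}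
    (ht : t ∈ oddClifForm κ W) : IsCliffordOp (pairAction κ W (X, t)) X := by
  have := (isCliffordOp_vecContract (κ := κ) X).add (isCliffordOp_clifFormAction ht)
  rwa [add_zero] at this

/-- The symbol is read off in degree zero by evaluating the anticommutator on `1`. -/
theorem IsCliffordOp.unique {P : Module.End ℝ (ExteriorAlgebra ℝ ((κ → ℝ) × W))}
    {X Y : Module.Dual ℝ W} (hX : IsCliffordOp P X) (hY : IsCliffordOp P Y) : X = Y := by
  refine LinearMap.ext fun α => ?_
  have h := (hX.anticomm α 1).symm.trans (hY.anticomm α 1)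
  have h2 := congrArg ExteriorAlgebra.algebraMapInv (sub_left_inj.mp h)
  simpa using h2

/-- Subtracting the contraction with the symbol leaves an operator that supercommutes with `W`,
hence a Clifford element. That element is odd because its operator is and the action is faithful. -/
theorem IsCliffordOp.exists_eq_pairAction [Fintype κ] [DecidableEq κ]
    {P : Module.End ℝ (ExteriorAlgebra ℝ ((κ → ℝ) × W))}
    {X : Module.Dual ℝ W} (hP : IsCliffordOp P X) :
    ∃ t ∈ oddClifForm κ W, P = pairAction κ W (X, t) := by
  have h := hP.sub (isCliffordOp_vecContract (κ := κ) X)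
  rw [sub_self] at h
  have h0 : ∀ α : W, superComm (LinearMap.mulLeft ℝ (basicι κ α)) (P - vecContract κ X) = 0 := by
    intro α
    refine LinearMap.ext fun x => ?_
    rw [superComm_basicι_apply h.odd, h.anticomm, LinearMap.zero_apply, LinearMap.zero_apply,
      zero_smul, zero_sub, neg_add_cancel]
  obtain ⟨t, ht⟩ := exists_eq_clifFormAction h0
  refine ⟨t, mem_oddClifForm_iff.mpr (clifFormAction_injective ?_), ?_⟩
  · rw [map_neg, ← ht, ← h.odd, ht, conj_clifFormAction]; rfl
  · rw [pairAction_apply, ← ht, add_sub_cancel]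

theorem pairAction_injective [Fintype κ] [DecidableEq κ] {X Y : Module.Dual ℝ W}
    {s t : Clif κ ⊗[ℝ] ExteriorAlgebra ℝ W} (hs : s ∈ oddClifForm κ W) (ht : t ∈ oddClifForm κ W)
    (h : pairAction κ W (X, s) = pairAction κ W (Y, t)) : X = Y ∧ s = t := by
  have h1 := isCliffordOp_pairAction X hs
  rw [h] at h1
  have hX := h1.unique (isCliffordOp_pairAction Y ht)
  refine ⟨hX, clifFormAction_injective ?_⟩
  rwa [pairAction_apply, pairAction_apply, hX, add_right_inj] at h

theorem formMap_gradeInv (f : W →ₗ[ℝ] W') (x : ExteriorAlgebra ℝ ((κ → ℝ) × W)) :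
    formMap κ f (gradeInv x) = gradeInv (formMap κ f x) := map_gradeInv _ x

theorem formMap_clifGenerator (f : W →ₗ[ℝ] W') (z : Module.Dual ℝ (κ → ℝ) × (κ → ℝ))
    (x : ExteriorAlgebra ℝ ((κ → ℝ) × W)) :
    formMap κ f (clifGenerator z x) = clifGenerator z (formMap κ f x) := by
  have h1 : z.1 ∘ₗ LinearMap.fst ℝ (κ → ℝ) W =
      (z.1 ∘ₗ LinearMap.fst ℝ (κ → ℝ) W') ∘ₗ LinearMap.prodMap LinearMap.id f := rfl
  rw [clifGenerator_apply, clifGenerator_apply, map_add, map_mul, formMap,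
    ExteriorAlgebra.map_apply_ι, h1, map_contract, LinearMap.prodMap_apply, LinearMap.id_apply,
    map_zero]

theorem formMap_clifAction (f : W →ₗ[ℝ] W') (a : Clif κ)
    (x : ExteriorAlgebra ℝ ((κ → ℝ) × W)) :
    formMap κ f (clifAction a x) = clifAction a (formMap κ f x) := by
  induction a using CliffordAlgebra.left_induction generalizing x with
  | algebraMap r =>
    simp only [AlgHom.commutes, Module.algebraMap_end_apply, map_smul]
  | add a b ha hb => simp only [map_add, LinearMap.add_apply, ha, hb]
  | ι_mul a z ha =>
    rw [map_mul clifAction, map_mul clifAction, Module.End.mul_apply, Module.End.mul_apply,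
      clifAction_ι, clifAction_ι, formMap_clifGenerator, ha]

theorem formMap_clifFormAction (f : W →ₗ[ℝ] W') (t : Clif κ ⊗[ℝ] ExteriorAlgebra ℝ W)
    (x : ExteriorAlgebra ℝ ((κ → ℝ) × W)) :
    formMap κ f (clifFormAction t x) = clifFormAction
      (TensorProduct.map LinearMap.id (ExteriorAlgebra.map f).toLinearMap t) (formMap κ f x) := by
  induction t using TensorProduct.induction_on with
  | zero => simp only [map_zero, LinearMap.zero_apply]
  | add s t hs ht => simp only [map_add, LinearMap.add_apply, hs, ht]
  | tmul a α =>
    rw [TensorProduct.map_tmul, clifFormAction_tmul, clifFormAction_tmul, Module.End.mul_apply,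
      Module.End.mul_apply, formMap_clifAction, LinearMap.mulLeft_apply, LinearMap.mulLeft_apply,
      map_mul, formMap_basicIncl]
    rfl

/-- The action is natural in `W`. -/
theorem formMap_pairAction (f : W →ₗ[ℝ] W') (X : Module.Dual ℝ W')
    (t : Clif κ ⊗[ℝ] ExteriorAlgebra ℝ W) (x : ExteriorAlgebra ℝ ((κ → ℝ) × W)) :
    formMap κ f (pairAction κ W (X ∘ₗ f, t) x) = pairAction κ W'
      (X, TensorProduct.map LinearMap.id (ExteriorAlgebra.map f).toLinearMap t)
        (formMap κ f x) := by
  have h1 : (X ∘ₗ f) ∘ₗ LinearMap.snd ℝ (κ → ℝ) W =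
      (X ∘ₗ LinearMap.snd ℝ (κ → ℝ) W') ∘ₗ LinearMap.prodMap LinearMap.id f := rfl
  rw [pairAction_apply, pairAction_apply, LinearMap.add_apply, LinearMap.add_apply, map_add,
    formMap_clifFormAction, vecContract, vecContract, h1]
  congr 1
  exact map_contract _ _ x

end CliffordOperators

/-! ### The exponential in an exterior algebra -/

section Exponential

variable {U U' : Type*} [AddCommGroup U] [Module ℝ U] [AddCommGroup U'] [Module ℝ U']

theorem range_ι_pow_eq_bot [Module.Finite ℝ U] {k : ℕ} (hk : Module.finrank ℝ U < k) :
    LinearMap.range (ExteriorAlgebra.ι ℝ : U →ₗ[ℝ] _) ^ k = ⊥ := by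
  have h : Module.finrank ℝ (⋀[ℝ]^k U) = 0 := by
    rw [exteriorPower.finrank_eq, Nat.choose_eq_zero_of_lt hk]
  exact Submodule.finrank_eq_zero.mp h

theorem top_mul_range_ι_le :
    (⊤ : Submodule ℝ (ExteriorAlgebra ℝ U)) * LinearMap.range (ExteriorAlgebra.ι ℝ) ≤
      LinearMap.range (ExteriorAlgebra.ι ℝ) * ⊤ := by
  refine Submodule.mul_le.mpr ?_
  rintro x - _ ⟨u, rfl⟩
  rw [← ι_mul_gradeInv]
  exact Submodule.mul_mem_mul ⟨u, rfl⟩ trivial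

/-- The augmentation ideal is two-sided, so vectors can be collected on the left: its `k`-th power
is generated by products of `k` vectors. -/
theorem range_ι_mul_top_pow_le (k : ℕ) :
    (LinearMap.range (ExteriorAlgebra.ι ℝ : U →ₗ[ℝ] _) * ⊤) ^ k ≤
      LinearMap.range (ExteriorAlgebra.ι ℝ : U →ₗ[ℝ] _) ^ k * ⊤ := by
  induction k with
  | zero => rw [pow_zero, pow_zero, one_mul]; exact le_top
  | succ k ih =>
    calc _ ≤ LinearMap.range (ExteriorAlgebra.ι ℝ : U →ₗ[ℝ] _) ^ k * ⊤ *
          (LinearMap.range (ExteriorAlgebra.ι ℝ : U →ₗ[ℝ] _) * ⊤) := by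
            rw [pow_succ]; exact mul_le_mul' ih le_rfl
      _ = LinearMap.range (ExteriorAlgebra.ι ℝ : U →ₗ[ℝ] _) ^ k *
          (⊤ * LinearMap.range (ExteriorAlgebra.ι ℝ : U →ₗ[ℝ] _)) * ⊤ := by
            simp only [mul_assoc]
      _ ≤ LinearMap.range (ExteriorAlgebra.ι ℝ : U →ₗ[ℝ] _) ^ k *
          (LinearMap.range (ExteriorAlgebra.ι ℝ : U →ₗ[ℝ] _) * ⊤) * ⊤ :=
            mul_le_mul' (mul_le_mul' le_rfl top_mul_range_ι_le) le_rfl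
      _ = LinearMap.range (ExteriorAlgebra.ι ℝ : U →ₗ[ℝ] _) ^ (k + 1) * (⊤ * ⊤) := by
            rw [pow_succ]; simp only [mul_assoc]
      _ ≤ _ := mul_le_mul' le_rfl le_top

theorem algebraMapInv_ι_mul (u : U) (x : ExteriorAlgebra ℝ U) :
    ExteriorAlgebra.algebraMapInv (ExteriorAlgebra.ι ℝ u * x) = 0 := by
  rw [map_mul, ExteriorAlgebra.algebraMapInv, ExteriorAlgebra.lift_ι_apply, LinearMap.zero_apply,
    zero_mul]

/-- The nilpotent part of an element of an exterior algebra. -/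
def nilPart (θ : ExteriorAlgebra ℝ U) : ExteriorAlgebra ℝ U :=
  θ - algebraMap ℝ _ (ExteriorAlgebra.algebraMapInv θ)

theorem nilPart_mem (θ : ExteriorAlgebra ℝ U) :
    nilPart θ ∈ LinearMap.range (ExteriorAlgebra.ι ℝ : U →ₗ[ℝ] _) * ⊤ := by
  rw [nilPart]
  induction θ using exterior_left_induction with
  | algebraMap r =>
    rw [ExteriorAlgebra.algebraMap_leftInverse U r, sub_self]; exact Submodule.zero_mem _
  | add x y hx hy =>
    rw [map_add, map_add, add_sub_add_comm]; exact Submodule.add_mem _ hx hy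
  | ι_mul u x _ =>
    rw [algebraMapInv_ι_mul, map_zero, sub_zero]
    exact Submodule.mul_mem_mul ⟨u, rfl⟩ trivial

theorem nilPart_pow_eq_zero [Module.Finite ℝ U] (θ : ExteriorAlgebra ℝ U) {k : ℕ}
    (hk : Module.finrank ℝ U < k) : nilPart θ ^ k = 0 := by
  have h := range_ι_mul_top_pow_le k (Submodule.pow_mem_pow _ (nilPart_mem θ) k)
  rwa [range_ι_pow_eq_bot hk, Submodule.bot_mul, Submodule.mem_bot] at h

/-- The point of truncation is immaterial beyond the dimension. This freedom is needed to compare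
spaces of different dimension and to differentiate the series, which shortens it by one term. -/
theorem extExp_eq_sum [Module.Finite ℝ U] (θ : ExteriorAlgebra ℝ U) {m : ℕ}
    (hm : Module.finrank ℝ U < m) :
    extExp θ = Real.exp (ExteriorAlgebra.algebraMapInv θ) •
      ∑ k ∈ Finset.range m, ((k.factorial : ℝ)⁻¹) • nilPart θ ^ k := by
  rw [extExp]
  congr 1
  refine Finset.sum_subset (Finset.range_mono hm) fun k _ hk => ?_
  rw [Finset.mem_range, not_lt] at hk
  change _ • nilPart θ ^ k = 0
  rw [nilPart_pow_eq_zero θ hk, smul_zero]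

theorem algebraMapInv_map (f : U →ₗ[ℝ] U') (θ : ExteriorAlgebra ℝ U) :
    ExteriorAlgebra.algebraMapInv (ExteriorAlgebra.map f θ) = ExteriorAlgebra.algebraMapInv θ := by
  have : ExteriorAlgebra.algebraMapInv.comp (ExteriorAlgebra.map f) =
      ExteriorAlgebra.algebraMapInv := by
    apply ExteriorAlgebra.hom_ext
    refine LinearMap.ext fun u => ?_
    simp [ExteriorAlgebra.algebraMapInv]
  exact DFunLike.congr_fun this θ

theorem map_nilPart (f : U →ₗ[ℝ] U') (θ : ExteriorAlgebra ℝ U) :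
    ExteriorAlgebra.map f (nilPart θ) = nilPart (ExteriorAlgebra.map f θ) := by
  rw [nilPart, nilPart, map_sub, AlgHom.commutes, algebraMapInv_map]

theorem map_extExp [Module.Finite ℝ U] [Module.Finite ℝ U'] (f : U →ₗ[ℝ] U')
    (θ : ExteriorAlgebra ℝ U) :
    ExteriorAlgebra.map f (extExp θ) = extExp (ExteriorAlgebra.map f θ) := by
  -- A common truncation beyond both dimensions.
  rw [extExp_eq_sum θ (m := Module.finrank ℝ U + Module.finrank ℝ U' + 1) (by omega),
    extExp_eq_sum (ExteriorAlgebra.map f θ) (m := Module.finrank ℝ U + Module.finrank ℝ U' + 1)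
      (by omega), map_smul, map_sum, algebraMapInv_map]
  simp only [map_smul, map_pow, map_nilPart]

theorem gradeInv_nilPart {θ : ExteriorAlgebra ℝ U} (hθ : gradeInv θ = θ) :
    gradeInv (nilPart θ) = nilPart θ := by
  rw [nilPart, map_sub, hθ, AlgHom.commutes]

theorem gradeInv_extExp {θ : ExteriorAlgebra ℝ U} (hθ : gradeInv θ = θ) :
    gradeInv (extExp θ) = extExp θ := by
  have h := gradeInv_nilPart hθ
  rw [nilPart] at h
  rw [extExp, map_smul, map_sum]
  simp only [map_smul, map_pow, h]

/-- The derivative of a truncated exponential series, given those of its terms. -/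
theorem sum_inv_factorial_smul_deriv {A : Type*} [Ring A] [Algebra ℝ A] (ν δ : A) (p : ℕ → A)
    (h0 : p 0 = 0) (hp : ∀ k, p (k + 1) = ((k : ℝ) + 1) • (ν ^ k * δ)) (m : ℕ) :
    ∑ k ∈ Finset.range (m + 1), ((k.factorial : ℝ)⁻¹) • p k =
      (∑ k ∈ Finset.range m, ((k.factorial : ℝ)⁻¹) • ν ^ k) * δ := by
  rw [Finset.sum_range_succ', h0, smul_zero, add_zero, Finset.sum_mul]
  refine Finset.sum_congr rfl fun k _ => ?_
  rw [hp, smul_smul, smul_mul_assoc, Nat.factorial_succ]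
  congr 1
  have h1 : (k.factorial : ℝ) ≠ 0 := Nat.cast_ne_zero.mpr k.factorial_ne_zero
  have h2 : (k : ℝ) + 1 ≠ 0 := by positivity
  push_cast
  field_simp

/-- The power rule holds without signs because powers of an even element are central. -/
theorem contract_nilPart_pow (d : Module.Dual ℝ U) {θ : ExteriorAlgebra ℝ U}
    (hθ : gradeInv θ = θ) (k : ℕ) :
    contract d (nilPart θ ^ (k + 1)) = ((k : ℝ) + 1) • (nilPart θ ^ k * contract d θ) := by
  have h1 : contract d (nilPart θ) = contract d θ := by
    rw [nilPart, map_sub, contract_algebraMap, sub_zero]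
  have h2 := gradeInv_nilPart hθ
  induction k with
  | zero => simp [h1]
  | succ k ih =>
    rw [pow_succ', contract_mul, ih, h1, h2, mul_smul_comm, ← mul_assoc, ← pow_succ',
      ← even_comm (x := nilPart θ ^ (k + 1)) (by rw [map_pow, h2])]
    rw [Nat.cast_succ]
    module

theorem contract_extExp [Module.Finite ℝ U] (d : Module.Dual ℝ U) {θ : ExteriorAlgebra ℝ U}
    (hθ : gradeInv θ = θ) : contract d (extExp θ) = extExp θ * contract d θ := by
  -- One superfluous term is kept, so that the differentiated series is still long enough to be the
  -- exponential.
  rw [extExp_eq_sum θ (m := Module.finrank ℝ U + 1 + 1) (by omega), map_smul, map_sum]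
  simp only [map_smul]
  rw [sum_inv_factorial_smul_deriv (nilPart θ) (contract d θ) _
    (by rw [pow_zero, contract_one]) (contract_nilPart_pow d hθ),
    ← smul_mul_assoc, ← extExp_eq_sum θ (Nat.lt_succ_self _),
    ← extExp_eq_sum θ (m := Module.finrank ℝ U + 1 + 1) (by omega)]

end Exponential

/-! ### Integration over the generators `Ψ` -/

section FibreIntegral

variable {N N' : ℕ} {W W' : Type*} [AddCommGroup W] [Module ℝ W] [AddCommGroup W'] [Module ℝ W']

/-- Moving the contracted factor from one end to the other costs a sign depending on the degree, so
integration can be computed with left contractions. -/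
theorem contractRight_eq_gradeInv {U : Type*} [AddCommGroup U] [Module ℝ U]
    (d : Module.Dual ℝ U) (x : ExteriorAlgebra ℝ U) :
    CliffordAlgebra.contractRight (Q := (0 : QuadraticForm ℝ U)) x d =
      gradeInv (contract d x) := by
  induction x using CliffordAlgebra.right_induction with
  | algebraMap r =>
    rw [CliffordAlgebra.contractRight_algebraMap, CliffordAlgebra.contractLeft_algebraMap, map_zero]
  | add x y hx hy => rw [map_add, map_add, map_add, LinearMap.add_apply, hx, hy]
  | mul_ι u x hx =>
    have h1 : contract d (x * ExteriorAlgebra.ι ℝ u) =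
        contract d x * ExteriorAlgebra.ι ℝ u + gradeInv x * algebraMap ℝ _ (d u) := by
      rw [contract_mul]
      congr 2
      exact CliffordAlgebra.contractLeft_ι _ d u
    rw [CliffordAlgebra.contractRight_mul_ι, hx]
    refine Eq.trans ?_ (congrArg gradeInv h1).symm
    rw [map_add, map_mul, map_mul, gradeInv_ι, gradeInv_gradeInv, AlgHom.commutes,
      ← Algebra.commutes, ← Algebra.smul_def, mul_neg, neg_add_eq_sub]

/-- Iterated right contraction with the generators in a list. -/
def contractList (N' : ℕ) (W : Type*) [AddCommGroup W] [Module ℝ W] (l : List (Fin N)) :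
    ExteriorAlgebra ℝ ((Fin N ⊕ Fin N' → ℝ) × W) →ₗ[ℝ]
      ExteriorAlgebra ℝ ((Fin N ⊕ Fin N' → ℝ) × W) :=
  l.foldr (fun i L => (CliffordAlgebra.contractRight
    (Q := (0 : QuadraticForm ℝ ((Fin N ⊕ Fin N' → ℝ) × W)))).flip
      (LinearMap.proj (Sum.inl i) ∘ₗ LinearMap.fst ℝ (Fin N ⊕ Fin N' → ℝ) W) ∘ₗ L) LinearMap.id

theorem contractList_cons (i : Fin N) (l : List (Fin N))
    (x : ExteriorAlgebra ℝ ((Fin N ⊕ Fin N' → ℝ) × W)) :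
    contractList N' W (i :: l) x =
      gradeInv (contractGenerator (Sum.inl i) (contractList N' W l x)) :=
  contractRight_eq_gradeInv _ _

/-- The substitution of `0` for the generators of the first kind. -/
def dropLeft (N N' : ℕ) (W : Type*) [AddCommGroup W] [Module ℝ W] :
    ExteriorAlgebra ℝ ((Fin N ⊕ Fin N' → ℝ) × W) →ₐ[ℝ] ExteriorAlgebra ℝ ((Fin N' → ℝ) × W) :=
  ExteriorAlgebra.map (LinearMap.prodMap
    (LinearMap.funLeft ℝ ℝ (Sum.inr : Fin N' → Fin N ⊕ Fin N')) LinearMap.id)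

theorem fibreIntegral_apply (x : ExteriorAlgebra ℝ ((Fin N ⊕ Fin N' → ℝ) × W)) :
    fibreIntegral N N' W x = dropLeft N N' W (contractList N' W (List.finRange N) x) := rfl

theorem contractGenerator_contractGenerator_comm {κ : Type} (i j : κ)
    (x : ExteriorAlgebra ℝ ((κ → ℝ) × W)) :
    contractGenerator i (contractGenerator j x) = -contractGenerator j (contractGenerator i x) :=
  CliffordAlgebra.contractLeft_comm _ _ x

theorem contractGenerator_self {κ : Type} (i : κ) (x : ExteriorAlgebra ℝ ((κ → ℝ) × W)) :
    contractGenerator i (contractGenerator i x) = 0 := CliffordAlgebra.contractLeft_contractLeft _ x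

theorem contractGenerator_gradeInv {κ : Type} (i : κ) (x : ExteriorAlgebra ℝ ((κ → ℝ) × W)) :
    contractGenerator i (gradeInv x) = -gradeInv (contractGenerator i x) := contract_gradeInv _ x

theorem contractGenerator_mul {κ : Type} (i : κ) (x y : ExteriorAlgebra ℝ ((κ → ℝ) × W)) :
    contractGenerator i (x * y) = contractGenerator i x * y + gradeInv x * contractGenerator i y :=
  contract_mul _ x y

theorem contractList_mul (l : List (Fin N)) {γ : ExteriorAlgebra ℝ ((Fin N ⊕ Fin N' → ℝ) × W)}
    (hγ : ∀ i : Fin N, contractGenerator (Sum.inl i) γ = 0)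
    (x : ExteriorAlgebra ℝ ((Fin N ⊕ Fin N' → ℝ) × W)) :
    contractList N' W l (γ * x) = γ * contractList N' W l x := by
  induction l with
  | nil => rfl
  | cons i l ih =>
    rw [contractList_cons, contractList_cons, ih, contractGenerator_mul, hγ, zero_mul, zero_add,
      map_mul, gradeInv_gradeInv]

theorem contractList_formMap (l : List (Fin N)) (f : W →ₗ[ℝ] W')
    (x : ExteriorAlgebra ℝ ((Fin N ⊕ Fin N' → ℝ) × W)) :
    formMap _ f (contractList N' W l x) = contractList N' W' l (formMap _ f x) := by
  induction l with
  | nil => rfl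
  | cons i l ih =>
    rw [contractList_cons, contractList_cons, formMap_gradeInv, formMap_contractGenerator, ih]

/-- Contractions from opposite sides commute: the sign of two anticommuting contractions cancels
that of the grade involution. -/
theorem contractList_contractGenerator (l : List (Fin N)) (k : Fin N ⊕ Fin N')
    (x : ExteriorAlgebra ℝ ((Fin N ⊕ Fin N' → ℝ) × W)) :
    contractList N' W l (contractGenerator k x) = contractGenerator k (contractList N' W l x) := by
  induction l with
  | nil => rfl
  | cons i l ih =>
    rw [contractList_cons, contractList_cons, ih, contractGenerator_gradeInv,
      contractGenerator_contractGenerator_comm, map_neg]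

theorem contractList_contractGenerator_eq_zero {l : List (Fin N)} {i : Fin N} (hi : i ∈ l)
    (x : ExteriorAlgebra ℝ ((Fin N ⊕ Fin N' → ℝ) × W)) :
    contractList N' W l (contractGenerator (Sum.inl i) x) = 0 := by
  induction l with
  | nil => simp at hi
  | cons j l ih =>
    rw [contractList_cons]
    rcases List.mem_cons.mp hi with rfl | h
    · rw [contractList_contractGenerator, contractGenerator_self, map_zero]
    · rw [ih h, map_zero, map_zero]

theorem contractList_gradeInv (l : List (Fin N))
    (x : ExteriorAlgebra ℝ ((Fin N ⊕ Fin N' → ℝ) × W)) :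
    contractList N' W l (gradeInv x) = (-1 : ℝ) ^ l.length • gradeInv (contractList N' W l x) := by
  induction l with
  | nil => rw [List.length_nil, pow_zero, one_smul]; rfl
  | cons i l ih =>
    rw [contractList_cons, contractList_cons, ih, map_smul, contractGenerator_gradeInv, map_smul,
      map_neg, List.length_cons, pow_succ]
    simp

theorem dropLeft_pullRight (β : ExteriorAlgebra ℝ ((Fin N' → ℝ) × W)) :
    dropLeft N N' W (pullRight N N' W β) = β := by
  rw [dropLeft, pullRight, ← AlgHom.comp_apply, ExteriorAlgebra.map_comp_map]
  have h : LinearMap.prodMap (LinearMap.funLeft ℝ ℝ (Sum.inr : Fin N' → Fin N ⊕ Fin N'))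
      (LinearMap.id : W →ₗ[ℝ] W) ∘ₗ LinearMap.prodMap
        (LinearMap.pi (Sum.elim (fun _ => 0) (fun j => LinearMap.proj j))) LinearMap.id =
      LinearMap.id := LinearMap.ext fun _ => rfl
  rw [h, ExteriorAlgebra.map_id, AlgHom.id_apply]

theorem contractGenerator_inl_pullRight (i : Fin N) (β : ExteriorAlgebra ℝ ((Fin N' → ℝ) × W)) :
    contractGenerator (Sum.inl i) (pullRight N N' W β) = 0 := by
  rw [pullRight, contractGenerator]
  refine (map_contract _ _ β).symm.trans ?_
  have h : (LinearMap.proj (Sum.inl i) ∘ₗ LinearMap.fst ℝ (Fin N ⊕ Fin N' → ℝ) W) ∘ₗ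
      LinearMap.prodMap (LinearMap.pi (Sum.elim (fun _ => 0) (fun j => LinearMap.proj j)))
        (LinearMap.id : W →ₗ[ℝ] W) = (0 : Module.Dual ℝ ((Fin N' → ℝ) × W)) :=
    LinearMap.ext fun _ => rfl
  rw [h, contract, map_zero, LinearMap.zero_apply, map_zero]

theorem contractGenerator_inr_pullLeft (j : Fin N') (β : ExteriorAlgebra ℝ ((Fin N → ℝ) × W)) :
    contractGenerator (Sum.inr j) (pullLeft N N' W β) = 0 := by
  rw [pullLeft, contractGenerator]
  refine (map_contract _ _ β).symm.trans ?_
  have h : (LinearMap.proj (Sum.inr j) ∘ₗ LinearMap.fst ℝ (Fin N ⊕ Fin N' → ℝ) W) ∘ₗ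
      LinearMap.prodMap (LinearMap.pi (Sum.elim (fun i => LinearMap.proj i) (fun _ => 0)))
        (LinearMap.id : W →ₗ[ℝ] W) = (0 : Module.Dual ℝ ((Fin N → ℝ) × W)) :=
    LinearMap.ext fun _ => rfl
  rw [h, contract, map_zero, LinearMap.zero_apply, map_zero]

theorem contractGenerator_inl_pullLeft (i : Fin N) (β : ExteriorAlgebra ℝ ((Fin N → ℝ) × W)) :
    contractGenerator (Sum.inl i) (pullLeft N N' W β) =
      pullLeft N N' W (contractGenerator i β) := by
  rw [pullLeft, contractGenerator]
  refine (map_contract _ _ β).symm.trans ?_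
  rfl

/-- The projection formula. There is no sign because the integration contracts from the right, away
from the factor `β`. -/
theorem fibreIntegral_pullRight_mul (β : ExteriorAlgebra ℝ ((Fin N' → ℝ) × W))
    (x : ExteriorAlgebra ℝ ((Fin N ⊕ Fin N' → ℝ) × W)) :
    fibreIntegral N N' W (pullRight N N' W β * x) = β * fibreIntegral N N' W x := by
  rw [fibreIntegral_apply, fibreIntegral_apply,
    contractList_mul _ fun i => contractGenerator_inl_pullRight i β, map_mul, dropLeft_pullRight]

/-- Integration already contracts with `∂ᵢ`, and `∂ᵢ` squares to zero. Together with the Leibniz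
rule this gives integration by parts. -/
theorem fibreIntegral_contractGenerator_inl (i : Fin N)
    (x : ExteriorAlgebra ℝ ((Fin N ⊕ Fin N' → ℝ) × W)) :
    fibreIntegral N N' W (contractGenerator (Sum.inl i) x) = 0 := by
  rw [fibreIntegral_apply, contractList_contractGenerator_eq_zero (List.mem_finRange i), map_zero]

theorem fibreIntegral_contractGenerator_inr (j : Fin N')
    (x : ExteriorAlgebra ℝ ((Fin N ⊕ Fin N' → ℝ) × W)) :
    fibreIntegral N N' W (contractGenerator (Sum.inr j) x) =
      contractGenerator j (fibreIntegral N N' W x) := by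
  have h : LinearMap.proj (Sum.inr j) ∘ₗ LinearMap.fst ℝ (Fin N ⊕ Fin N' → ℝ) W =
      (LinearMap.proj j ∘ₗ LinearMap.fst ℝ (Fin N' → ℝ) W) ∘ₗ LinearMap.prodMap
        (LinearMap.funLeft ℝ ℝ (Sum.inr : Fin N' → Fin N ⊕ Fin N')) LinearMap.id :=
    LinearMap.ext fun _ => rfl
  rw [fibreIntegral_apply, fibreIntegral_apply, contractList_contractGenerator, contractGenerator,
    contractGenerator, dropLeft, h]
  exact map_contract _ _ _

/-- Integration consists of `N` contractions, each of odd degree. -/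
theorem fibreIntegral_gradeInv (x : ExteriorAlgebra ℝ ((Fin N ⊕ Fin N' → ℝ) × W)) :
    fibreIntegral N N' W (gradeInv x) = (-1 : ℝ) ^ N • gradeInv (fibreIntegral N N' W x) := by
  rw [fibreIntegral_apply, fibreIntegral_apply, contractList_gradeInv, map_smul,
    List.length_finRange, dropLeft, map_gradeInv]

theorem formMap_dropLeft (f : W →ₗ[ℝ] W') (x : ExteriorAlgebra ℝ ((Fin N ⊕ Fin N' → ℝ) × W)) :
    formMap _ f (dropLeft N N' W x) = dropLeft N N' W' (formMap _ f x) := by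
  have h : LinearMap.prodMap LinearMap.id f ∘ₗ LinearMap.prodMap
      (LinearMap.funLeft ℝ ℝ (Sum.inr : Fin N' → Fin N ⊕ Fin N')) LinearMap.id =
      LinearMap.prodMap (LinearMap.funLeft ℝ ℝ (Sum.inr : Fin N' → Fin N ⊕ Fin N'))
        LinearMap.id ∘ₗ LinearMap.prodMap LinearMap.id f := LinearMap.ext fun _ => rfl
  rw [dropLeft, dropLeft, formMap, formMap, ← AlgHom.comp_apply, ← AlgHom.comp_apply,
    ExteriorAlgebra.map_comp_map, ExteriorAlgebra.map_comp_map, h]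

theorem formMap_pullLeft (f : W →ₗ[ℝ] W') (x : ExteriorAlgebra ℝ ((Fin N → ℝ) × W)) :
    formMap _ f (pullLeft N N' W x) = pullLeft N N' W' (formMap _ f x) := by
  have h : LinearMap.prodMap LinearMap.id f ∘ₗ LinearMap.prodMap
      (LinearMap.pi (Sum.elim (fun i => LinearMap.proj i) (fun _ => 0))) LinearMap.id =
      LinearMap.prodMap (LinearMap.pi (Sum.elim (fun i => LinearMap.proj i)
        (fun _ : Fin N' => (0 : (Fin N → ℝ) →ₗ[ℝ] ℝ)))) LinearMap.id ∘ₗ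
        LinearMap.prodMap LinearMap.id f :=
    LinearMap.ext fun _ => rfl
  rw [pullLeft, pullLeft, formMap, formMap, ← AlgHom.comp_apply, ← AlgHom.comp_apply,
    ExteriorAlgebra.map_comp_map, ExteriorAlgebra.map_comp_map, h]

theorem formMap_fibreIntegral (f : W →ₗ[ℝ] W')
    (x : ExteriorAlgebra ℝ ((Fin N ⊕ Fin N' → ℝ) × W)) :
    formMap _ f (fibreIntegral N N' W x) = fibreIntegral N N' W' (formMap _ f x) := by
  rw [fibreIntegral_apply, fibreIntegral_apply, formMap_dropLeft, contractList_formMap]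

theorem pullLeft_basicIncl (α : ExteriorAlgebra ℝ W) :
    pullLeft N N' W (basicIncl _ W α) = basicIncl _ W α := by
  rw [pullLeft, basicIncl, basicIncl, ← AlgHom.comp_apply, ExteriorAlgebra.map_comp_map]
  have h : LinearMap.prodMap (LinearMap.pi (Sum.elim (fun i => LinearMap.proj i) (fun _ => 0)))
      (LinearMap.id : W →ₗ[ℝ] W) ∘ₗ LinearMap.inr ℝ (Fin N → ℝ) W =
      LinearMap.inr ℝ (Fin N ⊕ Fin N' → ℝ) W :=
    LinearMap.ext fun α => Prod.ext (funext fun j => by rcases j with j | j <;> rfl) rfl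
  rw [h]

theorem pullRight_basicIncl (α : ExteriorAlgebra ℝ W) :
    pullRight N N' W (basicIncl _ W α) = basicIncl _ W α := by
  rw [pullRight, basicIncl, basicIncl, ← AlgHom.comp_apply, ExteriorAlgebra.map_comp_map]
  have h : LinearMap.prodMap (LinearMap.pi (Sum.elim (fun _ => 0) (fun j => LinearMap.proj j)))
      (LinearMap.id : W →ₗ[ℝ] W) ∘ₗ LinearMap.inr ℝ (Fin N' → ℝ) W =
      LinearMap.inr ℝ (Fin N ⊕ Fin N' → ℝ) W :=
    LinearMap.ext fun α => Prod.ext (funext fun j => by rcases j with j | j <;> rfl) rfl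
  rw [h]

end FibreIntegral

/-! ### Pointwise properties of `τ_K` -/

section Tau

variable {N N' : ℕ} {W W' : Type*} [AddCommGroup W] [Module ℝ W] [AddCommGroup W'] [Module ℝ W']

theorem tau_apply (K : ExteriorAlgebra ℝ ((Fin N ⊕ Fin N' → ℝ) × W))
    (x : ExteriorAlgebra ℝ ((Fin N → ℝ) × W)) :
    tau K x = fibreIntegral N N' W (extExp K * pullLeft N N' W x) := rfl

theorem formMap_tau [Module.Finite ℝ W] [Module.Finite ℝ W'] (f : W →ₗ[ℝ] W')
    (K : ExteriorAlgebra ℝ ((Fin N ⊕ Fin N' → ℝ) × W)) (x : ExteriorAlgebra ℝ ((Fin N → ℝ) × W)) :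
    formMap _ f (tau K x) = tau (formMap _ f K) (formMap _ f x) := by
  have h : formMap _ f (extExp K) = extExp (formMap _ f K) := map_extExp _ K
  rw [tau_apply, tau_apply, formMap_fibreIntegral, map_mul, formMap_pullLeft, h]

/-- An even `e^K` is central, and the form `α` pulled back from the left factor is also pulled back
from the right one, so the projection formula applies. -/
theorem tau_basicIncl_mul {K : ExteriorAlgebra ℝ ((Fin N ⊕ Fin N' → ℝ) × W)}
    (hK : gradeInv K = K) (α : ExteriorAlgebra ℝ W) (x : ExteriorAlgebra ℝ ((Fin N → ℝ) × W)) :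
    tau K (basicIncl _ W α * x) = basicIncl _ W α * tau K x := by
  rw [tau_apply, tau_apply, map_mul (pullLeft N N' W), pullLeft_basicIncl, ← mul_assoc,
    even_comm (gradeInv_extExp hK), mul_assoc, ← pullRight_basicIncl, fibreIntegral_pullRight_mul]

theorem tau_basicι_mul {K : ExteriorAlgebra ℝ ((Fin N ⊕ Fin N' → ℝ) × W)}
    (hK : gradeInv K = K) (α : W) (x : ExteriorAlgebra ℝ ((Fin N → ℝ) × W)) :
    tau K (basicι _ α * x) = basicι _ α * tau K x := by
  rw [← basicIncl_ι, ← basicIncl_ι, tau_basicIncl_mul hK]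

theorem tau_gradeInv {K : ExteriorAlgebra ℝ ((Fin N ⊕ Fin N' → ℝ) × W)}
    (hK : gradeInv K = K) (x : ExteriorAlgebra ℝ ((Fin N → ℝ) × W)) :
    tau K (gradeInv x) = (-1 : ℝ) ^ N • gradeInv (tau K x) := by
  have h : pullLeft N N' W (gradeInv x) = gradeInv (pullLeft N N' W x) := map_gradeInv _ x
  rw [tau_apply, tau_apply, ← fibreIntegral_gradeInv, map_mul gradeInv, gradeInv_extExp hK, h]

theorem finrank_exteriorAlgebra (U : Type*) [AddCommGroup U] [Module ℝ U] [Module.Finite ℝ U] :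
    Module.finrank ℝ (ExteriorAlgebra ℝ U) = 2 ^ Module.finrank ℝ U := by
  rw [Module.finrank_eq_card_basis (Module.finBasis ℝ U).ExteriorAlgebra, Fintype.card_finset,
    Fintype.card_fin]

/-- Comparing dimensions gives `2 ^ N = 2 ^ N'`. -/
theorem eq_of_bijective_tau {K : ExteriorAlgebra ℝ ((Fin N ⊕ Fin N' → ℝ) × PUnit.{1})}
    (hK : Function.Bijective (tau K)) : N = N' := by
  have h := (LinearEquiv.ofBijective (tau K) hK).finrank_eq
  rw [finrank_exteriorAlgebra, finrank_exteriorAlgebra, Module.finrank_prod, Module.finrank_prod,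
    Module.finrank_fin_fun, Module.finrank_fin_fun] at h
  simpa using h

/-- Setting `W = 0` changes an element only by a member of the ideal generated by `W`. -/
theorem sub_formMap_zero_mem {κ : Type} (x : ExteriorAlgebra ℝ ((κ → ℝ) × W)) :
    x - formMap κ (0 : W →ₗ[ℝ] W) x ∈
      LinearMap.range (ExteriorAlgebra.ι ℝ ∘ₗ LinearMap.inr ℝ (κ → ℝ) W) * ⊤ := by
  induction x using exterior_left_induction with
  | algebraMap r => rw [AlgHom.commutes, sub_self]; exact Submodule.zero_mem _
  | add x y hx hy => rw [map_add, add_sub_add_comm]; exact Submodule.add_mem _ hx hy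
  | ι_mul u x hx =>
    obtain ⟨ξ, α⟩ := u
    have h1 : ExteriorAlgebra.ι ℝ ((ξ, α) : (κ → ℝ) × W) * x -
        formMap κ (0 : W →ₗ[ℝ] W) (ExteriorAlgebra.ι ℝ ((ξ, α) : (κ → ℝ) × W) * x) =
        ExteriorAlgebra.ι ℝ ((0, α) : (κ → ℝ) × W) * x +
          ExteriorAlgebra.ι ℝ ((ξ, 0) : (κ → ℝ) × W) * (x - formMap κ (0 : W →ₗ[ℝ] W) x) := by
      have h2 : ExteriorAlgebra.ι ℝ ((ξ, α) : (κ → ℝ) × W) =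
          ExteriorAlgebra.ι ℝ ((0, α) : (κ → ℝ) × W) +
            ExteriorAlgebra.ι ℝ ((ξ, 0) : (κ → ℝ) × W) := by
        rw [← map_add]; simp
      have h3 : formMap κ (0 : W →ₗ[ℝ] W) (ExteriorAlgebra.ι ℝ ((ξ, α) : (κ → ℝ) × W) * x) =
          ExteriorAlgebra.ι ℝ ((ξ, 0) : (κ → ℝ) × W) * formMap κ (0 : W →ₗ[ℝ] W) x := by
        rw [map_mul, formMap, ExteriorAlgebra.map_apply_ι]; rfl
      rw [h3, h2, add_mul, mul_sub, add_sub_assoc]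
    rw [h1]
    refine Submodule.add_mem _ (Submodule.mul_mem_mul ⟨α, rfl⟩ trivial) ?_
    refine Submodule.mul_induction_on hx ?_ fun a b ha hb => ?_
    · rintro _ ⟨β, rfl⟩ y -
      rw [LinearMap.comp_apply, ← mul_assoc, ι_anticomm, neg_mul, ← mul_neg, mul_assoc, mul_neg,
        ← mul_neg]
      exact Submodule.mul_mem_mul ⟨β, rfl⟩ trivial
    · rw [mul_add]; exact Submodule.add_mem _ ha hb

/-- The argument of Nakayama's lemma: the range of `τ_K` is stable under multiplication by `W`, it
is everything modulo the ideal generated by `W`, and that ideal is nilpotent. -/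
theorem surjective_tau [Module.Finite ℝ W] {K : ExteriorAlgebra ℝ ((Fin N ⊕ Fin N' → ℝ) × W)}
    (hK : gradeInv K = K) (h0 : Function.Surjective (tau (basicDegreeZero K))) :
    Function.Surjective (tau K) := by
  set R := LinearMap.range (ExteriorAlgebra.ι ℝ ∘ₗ LinearMap.inr ℝ (Fin N' → ℝ) W) with hR
  -- The zero map to the zero space forgets `W` and the zero map back includes `⋀⟨κ⟩`; by naturality
  -- `τ_K` of an included preimage has the prescribed component of basic degree zero.
  have h1 : ⊤ ≤ LinearMap.range (tau K) ⊔ R * ⊤ := by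
    intro y _
    obtain ⟨x₀, hx₀⟩ := h0 (formMap _ (0 : W →ₗ[ℝ] PUnit.{1}) y)
    have h2 : formMap _ (0 : W →ₗ[ℝ] PUnit.{1}) (tau K (formMap _ (0 : PUnit.{1} →ₗ[ℝ] W) x₀)) =
        formMap _ (0 : W →ₗ[ℝ] PUnit.{1}) y := by
      rw [formMap_tau, formMap_formMap, ← hx₀,
        show (0 : W →ₗ[ℝ] PUnit.{1}) ∘ₗ (0 : PUnit.{1} →ₗ[ℝ] W) = LinearMap.id from
          Subsingleton.elim _ _, formMap_id]
      rfl
    have h3 := sub_formMap_zero_mem (y - tau K (formMap _ (0 : PUnit.{1} →ₗ[ℝ] W) x₀))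
    have h4 : formMap (Fin N') (0 : W →ₗ[ℝ] W)
        (y - tau K (formMap _ (0 : PUnit.{1} →ₗ[ℝ] W) x₀)) = 0 := by
      have h5 : (0 : W →ₗ[ℝ] W) = (0 : PUnit.{1} →ₗ[ℝ] W) ∘ₗ (0 : W →ₗ[ℝ] PUnit.{1}) := rfl
      rw [h5, ← formMap_formMap, map_sub, h2, sub_self, map_zero]
    rw [h4, sub_zero] at h3
    rw [← sub_add_cancel y (tau K (formMap _ (0 : PUnit.{1} →ₗ[ℝ] W) x₀))]
    exact Submodule.add_mem _ (Submodule.mem_sup_right h3) (Submodule.mem_sup_left ⟨_, rfl⟩)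
  have h2 : R * LinearMap.range (tau K) ≤ LinearMap.range (tau K) := by
    refine Submodule.mul_le.mpr ?_
    rintro _ ⟨α, rfl⟩ _ ⟨x, rfl⟩
    exact ⟨_, tau_basicι_mul hK α x⟩
  have h3 : ∀ k : ℕ, R ^ k * LinearMap.range (tau K) ≤ LinearMap.range (tau K) := by
    intro k
    induction k with
    | zero => rw [pow_zero, one_mul]
    | succ k ih => rw [pow_succ, mul_assoc]; exact (mul_le_mul' le_rfl h2).trans ih
  -- Substituting the decomposition into its own remainder raises the power of `R` by one.
  have h4 : ∀ k : ℕ, ⊤ ≤ LinearMap.range (tau K) ⊔ R ^ k * ⊤ := by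
    intro k
    induction k with
    | zero => rw [pow_zero, one_mul]; exact le_sup_right
    | succ k ih =>
      refine ih.trans (sup_le le_sup_left ?_)
      refine (mul_le_mul' le_rfl h1).trans ?_
      rw [Submodule.mul_sup, ← mul_assoc, ← pow_succ]
      exact sup_le_sup_right (h3 k) _
  have h5 : R ^ (Module.finrank ℝ ((Fin N' → ℝ) × W) + 1) = ⊥ := by
    refine le_bot_iff.mp ?_
    rw [← range_ι_pow_eq_bot (U := (Fin N' → ℝ) × W) (Nat.lt_succ_self _)]
    exact pow_le_pow_left' (LinearMap.range_comp_le_range _ _) _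
  have h6 := h4 (Module.finrank ℝ ((Fin N' → ℝ) × W) + 1)
  rw [h5, Submodule.bot_mul, sup_bot_eq] at h6
  exact LinearMap.range_eq_top.mp (top_le_iff.mp h6)

/-- `τ_K` is an isomorphism if its component of basic-degree zero is. -/
theorem bijective_tau [Module.Finite ℝ W] {K : ExteriorAlgebra ℝ ((Fin N ⊕ Fin N' → ℝ) × W)}
    (hK : gradeInv K = K) (h0 : Function.Bijective (tau (basicDegreeZero K))) :
    Function.Bijective (tau K) := by
  have hs := surjective_tau hK h0.2
  refine ⟨(LinearMap.injective_iff_surjective_of_finrank_eq_finrank ?_).mpr hs, hs⟩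
  -- Source and target have equal dimension, so surjectivity is enough.
  obtain rfl := eq_of_bijective_tau h0
  rfl

end Tau

/-! ### Componentwise calculus in finite-dimensional spaces -/

section Smooth

variable {U U' V W W' W'' : Type*} [NormedAddCommGroup U] [NormedSpace ℝ U]
  [NormedAddCommGroup U'] [NormedSpace ℝ U'] [NormedAddCommGroup V] [NormedSpace ℝ V]
  [AddCommGroup W] [Module ℝ W] [AddCommGroup W'] [Module ℝ W'] [AddCommGroup W''] [Module ℝ W'']
  {s : Set U}

theorem eq_of_forall_dual {a b : W} (h : ∀ ℓ : Module.Dual ℝ W, ℓ a = ℓ b) : a = b :=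
  sub_eq_zero.mp ((Module.forall_dual_apply_eq_zero_iff ℝ (a - b)).mp fun ℓ => by
    rw [map_sub, h, sub_self])

namespace SmoothComponentsOn

theorem linear {f : U → W} (hf : SmoothComponentsOn f s) (L : W →ₗ[ℝ] W') :
    SmoothComponentsOn (fun y => L (f y)) s := fun ℓ => hf (ℓ ∘ₗ L)

theorem const (w : W) : SmoothComponentsOn (fun _ : U => w) s := fun _ => contDiffOn_const

theorem congr {f g : U → W} (hf : SmoothComponentsOn f s) (h : ∀ y ∈ s, g y = f y) :
    SmoothComponentsOn g s :=
  fun ℓ => (hf ℓ).congr fun y hy => by rw [h y hy]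

theorem mono {f : U → W} (hf : SmoothComponentsOn f s) {t : Set U} (h : t ⊆ s) :
    SmoothComponentsOn f t := fun ℓ => (hf ℓ).mono h

theorem add {f g : U → W} (hf : SmoothComponentsOn f s) (hg : SmoothComponentsOn g s) :
    SmoothComponentsOn (fun y => f y + g y) s := fun ℓ => by
  simpa only [map_add] using (hf ℓ).add (hg ℓ)

theorem sub {f g : U → W} (hf : SmoothComponentsOn f s) (hg : SmoothComponentsOn g s) :
    SmoothComponentsOn (fun y => f y - g y) s := fun ℓ => by
  simpa only [map_sub] using (hf ℓ).sub (hg ℓ)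

theorem sum {ι : Type*} {t : Finset ι} {f : ι → U → W}
    (hf : ∀ i ∈ t, SmoothComponentsOn (f i) s) :
    SmoothComponentsOn (fun y => ∑ i ∈ t, f i y) s := fun ℓ => by
  simpa only [map_sum] using ContDiffOn.sum fun i hi => hf i hi ℓ

theorem smul {c : U → ℝ} {f : U → W} (hc : ContDiffOn ℝ ∞ c s) (hf : SmoothComponentsOn f s) :
    SmoothComponentsOn (fun y => c y • f y) s := fun ℓ => by
  exact (hc.smul (hf ℓ)).congr fun y _ => map_smul ℓ _ _

theorem bilin [Module.Finite ℝ W] (B : W →ₗ[ℝ] W' →ₗ[ℝ] W'') {f : U → W} {g : U → W'}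
    (hf : SmoothComponentsOn f s) (hg : SmoothComponentsOn g s) :
    SmoothComponentsOn (fun y => B (f y) (g y)) s := by
  have h : ∀ y, B (f y) (g y) = ∑ k, (Module.finBasis ℝ W).coord k (f y) •
      B (Module.finBasis ℝ W k) (g y) := by
    intro y
    conv_lhs => rw [← (Module.finBasis ℝ W).sum_repr (f y)]
    simp only [map_sum, map_smul, LinearMap.coe_sum, Finset.sum_apply, LinearMap.smul_apply,
      Module.Basis.coord_apply]
  refine (sum fun k _ => ?_).congr fun y _ => h y
  exact smul (hf _) (hg.linear _)

theorem apply [Module.Finite ℝ W] [Module.Finite ℝ W'] {P : U → W →ₗ[ℝ] W'} {f : U → W}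
    (hP : SmoothComponentsOn P s) (hf : SmoothComponentsOn f s) :
    SmoothComponentsOn (fun y => P y (f y)) s := bilin LinearMap.id hP hf

theorem mul {A : Type*} [Ring A] [Algebra ℝ A] [Module.Finite ℝ A] {f g : U → A}
    (hf : SmoothComponentsOn f s) (hg : SmoothComponentsOn g s) :
    SmoothComponentsOn (fun y => f y * g y) s := bilin (LinearMap.mul ℝ A) hf hg

theorem pow {A : Type*} [Ring A] [Algebra ℝ A] [Module.Finite ℝ A] {f : U → A}
    (hf : SmoothComponentsOn f s) (k : ℕ) : SmoothComponentsOn (fun y => f y ^ k) s := by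
  induction k with
  | zero => simpa only [pow_zero] using const 1
  | succ k ih => simpa only [pow_succ] using ih.mul hf

/-- An injective linear map has a linear left inverse, which recovers the components. -/
theorem of_injective {f : U → W} (L : W →ₗ[ℝ] W') (hL : Function.Injective L)
    (hf : SmoothComponentsOn (fun y => L (f y)) s) : SmoothComponentsOn f s := by
  obtain ⟨R, hR⟩ := L.exists_leftInverse_of_injective (LinearMap.ker_eq_bot.mpr hL)
  exact (hf.linear R).congr fun y _ => (LinearMap.congr_fun hR (f y)).symm

/-- A family of linear maps is smooth if its values on each vector are. -/
theorem of_apply [Module.Finite ℝ W] [Module.Finite ℝ W'] {P : U → W →ₗ[ℝ] W'}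
    (hP : ∀ w, SmoothComponentsOn (fun y => P y w) s) : SmoothComponentsOn P s := by
  refine of_injective ((Module.finBasis ℝ W).constr ℝ).symm.toLinearMap
    (LinearEquiv.injective _) fun ℓ => ?_
  have h : ∀ y, ((Module.finBasis ℝ W).constr ℝ).symm.toLinearMap (P y) =
      ∑ k, Pi.single k (P y (Module.finBasis ℝ W k)) := by
    intro y
    rw [Finset.univ_sum_single]
    rfl
  refine (sum (t := Finset.univ) (f := fun k y => LinearMap.single ℝ (fun _ => W') k
    (P y (Module.finBasis ℝ W k))) fun k _ => (hP _).linear _) |>.congr (fun y _ => h y) |>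
    fun h => h ℓ

theorem of_contDiffOn {f : U → V} [FiniteDimensional ℝ V] (hf : ContDiffOn ℝ ∞ f s) :
    SmoothComponentsOn f s := fun ℓ =>
  (LinearMap.toContinuousLinearMap ℓ).contDiff.comp_contDiffOn hf

theorem contDiffOn {f : U → V} [FiniteDimensional ℝ V] (hf : SmoothComponentsOn f s) :
    ContDiffOn ℝ ∞ f s := by
  have h : f = fun y => ∑ k, (Module.finBasis ℝ V).coord k (f y) • Module.finBasis ℝ V k :=
    funext fun y => ((Module.finBasis ℝ V).sum_repr (f y)).symm
  rw [h]
  exact ContDiffOn.sum fun k _ => (hf _).smul contDiffOn_const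

theorem of_locally {f : U → W}
    (h : ∀ y ∈ s, ∃ u, IsOpen u ∧ y ∈ u ∧ SmoothComponentsOn f (s ∩ u)) :
    SmoothComponentsOn f s := fun ℓ =>
  contDiffOn_of_locally_contDiffOn fun y hy =>
    let ⟨u, hu, hyu, hf⟩ := h y hy
    ⟨u, hu, hyu, hf ℓ⟩

/-- The inverse of a smooth family of isomorphisms is smooth. -/
theorem inverse [Module.Finite ℝ W] [Module.Finite ℝ W'] (hs : IsOpen s) {P : U → W →ₗ[ℝ] W'}
    {R : U → W' →ₗ[ℝ] W} (hP : SmoothComponentsOn P s)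
    (h1 : ∀ y ∈ s, R y ∘ₗ P y = LinearMap.id) (h2 : ∀ y ∈ s, P y ∘ₗ R y = LinearMap.id) :
    SmoothComponentsOn R s := by
  rcases s.eq_empty_or_nonempty with rfl | ⟨y₀, hy₀⟩
  · exact fun ℓ => contDiffOn_empty
  -- A fixed identification of the two spaces, taken at a base point (for empty `s` they need not be
  -- isomorphic). It reduces the claim to inversion in the Banach algebra of endomorphisms of a
  -- coordinate space, where inversion is smooth at units.
  have e : W' ≃ₗ[ℝ] W := LinearEquiv.ofLinearMap (R y₀) (P y₀) (h1 _ hy₀) (h2 _ hy₀)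
  let b := (Module.finBasis ℝ W).equivFun
  let T : (W →ₗ[ℝ] W) ≃ₗ[ℝ] ((Fin (Module.finrank ℝ W) → ℝ) →L[ℝ] Fin (Module.finrank ℝ W) → ℝ) :=
    b.conj.trans LinearMap.toContinuousLinearMap
  have hT : ∀ A B : W →ₗ[ℝ] W, T (A ∘ₗ B) = T A * T B := by
    intro A B
    refine ContinuousLinearMap.ext fun v => ?_
    change b (A (B (b.symm v))) = b (A (b.symm (b (B (b.symm v)))))
    rw [b.symm_apply_apply]
  have hT1 : T LinearMap.id = 1 := by
    refine ContinuousLinearMap.ext fun v => ?_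
    exact b.apply_symm_apply v
  have h3 : ∀ y ∈ s, T (R y ∘ₗ e.symm.toLinearMap) =
      Ring.inverse (T (e.toLinearMap ∘ₗ P y)) := by
    intro y hy
    have ha : T (R y ∘ₗ e.symm.toLinearMap) * T (e.toLinearMap ∘ₗ P y) = 1 := by
      rw [← hT, ← hT1]
      congr 1
      refine LinearMap.ext fun v => ?_
      have := LinearMap.congr_fun (h1 y hy) v
      simpa using this
    have hb : T (e.toLinearMap ∘ₗ P y) * T (R y ∘ₗ e.symm.toLinearMap) = 1 := by
      rw [← hT, ← hT1]
      congr 1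
      refine LinearMap.ext fun v => ?_
      have := LinearMap.congr_fun (h2 y hy) (e.symm v)
      simp only [LinearMap.comp_apply, LinearMap.id_apply, LinearEquiv.coe_coe] at this ⊢
      rw [this, e.apply_symm_apply]
    exact (Ring.inverse_unit ⟨_, _, hb, ha⟩).symm
  have h4 : ContDiffOn ℝ ∞ (fun y => T (e.toLinearMap ∘ₗ P y)) s :=
    ((hP.linear (LinearMap.llcomp ℝ W W' W e.toLinearMap)).linear T.toLinearMap).contDiffOn
  have h5 : ContDiffOn ℝ ∞ (fun y => T (R y ∘ₗ e.symm.toLinearMap)) s := by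
    intro y hy
    have hu : IsUnit (T (e.toLinearMap ∘ₗ P y)) := by
      rw [← isUnit_ringInverse, ← h3 y hy]
      refine ⟨⟨_, T (e.toLinearMap ∘ₗ P y), ?_, ?_⟩, rfl⟩ <;> rw [← hT, ← hT1] <;> congr 1
      · refine LinearMap.ext fun v => ?_
        have := LinearMap.congr_fun (h1 y hy) v
        simpa using this
      · refine LinearMap.ext fun v => ?_
        have := LinearMap.congr_fun (h2 y hy) (e.symm v)
        simp only [LinearMap.comp_apply, LinearMap.id_apply, LinearEquiv.coe_coe] at this ⊢
        rw [this, e.apply_symm_apply]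
    obtain ⟨u, hu⟩ := hu
    have h6 : ContDiffAt ℝ ∞ Ring.inverse (T (e.toLinearMap ∘ₗ P y)) :=
      hu ▸ contDiffAt_ringInverse ℝ u
    have h8 : ContDiffWithinAt ℝ ∞ (fun z => Ring.inverse (T (e.toLinearMap ∘ₗ P z))) s y :=
      ContDiffAt.comp_contDiffWithinAt (g := Ring.inverse) y h6 (h4 y hy)
    exact h8.congr (fun z hz => h3 z hz) (h3 y hy)
  have h7 := ((of_contDiffOn h5).linear T.symm.toLinearMap).linear
    (LinearMap.lcomp ℝ W e.toLinearMap)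
  refine h7.congr fun y _ => LinearMap.ext fun v => ?_
  simp

end SmoothComponentsOn

/-- Componentwise differentiability of a function with values in a finite-dimensional space. -/
def HasDerivComponents (f : U → W) (y : U) : Prop :=
  ∀ ℓ : Module.Dual ℝ W, DifferentiableAt ℝ (fun z => ℓ (f z)) y

theorem SmoothComponentsOn.hasDerivComponents {f : U → W} (hf : SmoothComponentsOn f s)
    (hs : IsOpen s) {y : U} (hy : y ∈ s) : HasDerivComponents f y := fun ℓ =>
  ((hf ℓ).contDiffAt (hs.mem_nhds hy)).differentiableAt (by simp)

section Deriv

variable [Module.Finite ℝ W] [Module.Finite ℝ W'] [Module.Finite ℝ W''] {f g : U → W} {y : U}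

/-- The derivative, defined in a basis, is characterised by all functionals and so is independent of
the basis. The rules below are checked against functionals. -/
theorem dual_directionalDeriv (hf : HasDerivComponents f y) (v : U) (ℓ : Module.Dual ℝ W) :
    ℓ (directionalDeriv f y v) = fderiv ℝ (fun z => ℓ (f z)) y v := by
  have h : (fun z => ℓ (f z)) = fun z => ∑ k, (Module.finBasis ℝ W).coord k (f z) •
      ℓ (Module.finBasis ℝ W k) := by
    funext z
    conv_lhs => rw [← (Module.finBasis ℝ W).sum_repr (f z)]
    simp only [map_sum, map_smul, Module.Basis.coord_apply]
  rw [h, fderiv_fun_sum fun k _ => (hf _).smul_const _, directionalDeriv, map_sum]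
  simp only [FunLike.coe_sum, Finset.sum_apply, map_smul]
  refine Finset.sum_congr rfl fun k _ => ?_
  rw [fderiv_smul_const (hf _)]
  rfl

theorem directionalDeriv_linear (hf : HasDerivComponents f y) (L : W →ₗ[ℝ] W') (v : U) :
    directionalDeriv (fun z => L (f z)) y v = L (directionalDeriv f y v) :=
  eq_of_forall_dual fun ℓ => by
    rw [dual_directionalDeriv (fun ℓ => hf (ℓ ∘ₗ L))]
    exact (dual_directionalDeriv hf v (ℓ ∘ₗ L)).symm

theorem directionalDeriv_congr (h : f =ᶠ[nhds y] g) (v : U) :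
    directionalDeriv f y v = directionalDeriv g y v := by
  simp only [directionalDeriv]
  refine Finset.sum_congr rfl fun k _ => ?_
  have h2 : (fun z => (Module.finBasis ℝ W).coord k (f z)) =ᶠ[nhds y]
      fun z => (Module.finBasis ℝ W).coord k (g z) := h.mono fun z hz => by simp only [hz]
  rw [h2.fderiv_eq]

theorem directionalDeriv_const (w : W) (v : U) : directionalDeriv (fun _ => w) y v = 0 := by
  simp [directionalDeriv]

theorem directionalDeriv_add (hf : HasDerivComponents f y) (hg : HasDerivComponents g y) (v : U) :
    directionalDeriv (fun z => f z + g z) y v =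
      directionalDeriv f y v + directionalDeriv g y v :=
  eq_of_forall_dual fun ℓ => by
    have h : HasDerivComponents (fun z => f z + g z) y := fun ℓ => by
      simpa only [map_add] using (hf ℓ).fun_add (hg ℓ)
    rw [dual_directionalDeriv h, map_add, dual_directionalDeriv hf, dual_directionalDeriv hg]
    simp only [map_add]
    rw [fderiv_fun_add (hf ℓ) (hg ℓ)]
    rfl

theorem directionalDeriv_vec_sum {ι : Type*} (t : Finset ι) (a : ι → ℝ) (v : ι → U) :
    directionalDeriv f y (∑ i ∈ t, a i • v i) = ∑ i ∈ t, a i • directionalDeriv f y (v i) := by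
  simp only [directionalDeriv, map_sum, map_smul, Finset.sum_smul, Finset.smul_sum, smul_smul,
    smul_eq_mul]
  exact Finset.sum_comm

theorem directionalDeriv_bilin (B : W →ₗ[ℝ] W' →ₗ[ℝ] W'') {g : U → W'}
    (hf : HasDerivComponents f y) (hg : HasDerivComponents g y) (v : U) :
    directionalDeriv (fun z => B (f z) (g z)) y v =
      B (directionalDeriv f y v) (g y) + B (f y) (directionalDeriv g y v) := by
  refine eq_of_forall_dual fun ℓ => ?_
  have h : ∀ ℓ : Module.Dual ℝ W'', (fun z => ℓ (B (f z) (g z))) =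
      fun z => ∑ k, (Module.finBasis ℝ W).coord k (f z) *
        (ℓ ∘ₗ B (Module.finBasis ℝ W k)) (g z) := by
    intro ℓ
    funext z
    conv_lhs => rw [← (Module.finBasis ℝ W).sum_repr (f z)]
    simp only [map_sum, map_smul, LinearMap.coe_sum, Finset.sum_apply, LinearMap.smul_apply,
      Module.Basis.coord_apply, LinearMap.comp_apply, smul_eq_mul]
  have h2 : ∀ w w', ℓ (B w w') = ∑ k, (Module.finBasis ℝ W).coord k w *
      (ℓ ∘ₗ B (Module.finBasis ℝ W k)) w' := by
    intro w w'
    conv_lhs => rw [← (Module.finBasis ℝ W).sum_repr w]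
    simp only [map_sum, map_smul, LinearMap.coe_sum, Finset.sum_apply, LinearMap.smul_apply,
      Module.Basis.coord_apply, LinearMap.comp_apply, smul_eq_mul]
  have hd : HasDerivComponents (fun z => B (f z) (g z)) y := fun ℓ => by
    rw [h]
    exact DifferentiableAt.fun_sum fun k _ => (hf _).fun_mul (hg _)
  rw [dual_directionalDeriv hd, h, fderiv_fun_sum fun k _ => (hf _).fun_mul (hg _), map_add, h2, h2,
    ← Finset.sum_add_distrib]
  simp only [FunLike.coe_sum, Finset.sum_apply]
  refine Finset.sum_congr rfl fun k _ => ?_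
  rw [fderiv_fun_mul (hf _) (hg _), dual_directionalDeriv hf, dual_directionalDeriv hg]
  simp only [add_apply, smul_apply, smul_eq_mul]
  ring

theorem directionalDeriv_apply {P : U → W →ₗ[ℝ] W'} (hP : HasDerivComponents P y)
    (hf : HasDerivComponents f y) (v : U) :
    directionalDeriv (fun z => P z (f z)) y v =
      directionalDeriv P y v (f y) + P y (directionalDeriv f y v) :=
  directionalDeriv_bilin LinearMap.id hP hf v

theorem directionalDeriv_mul {A : Type*} [Ring A] [Algebra ℝ A] [Module.Finite ℝ A] {f g : U → A}
    (hf : HasDerivComponents f y) (hg : HasDerivComponents g y) (v : U) :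
    directionalDeriv (fun z => f z * g z) y v =
      directionalDeriv f y v * g y + f y * directionalDeriv g y v :=
  directionalDeriv_bilin (LinearMap.mul ℝ A) hf hg v

theorem directionalDeriv_smul {c : U → ℝ} (hc : DifferentiableAt ℝ c y)
    (hf : HasDerivComponents f y) (v : U) :
    directionalDeriv (fun z => c z • f z) y v =
      fderiv ℝ c y v • f y + c y • directionalDeriv f y v := by
  have hc' : HasDerivComponents c y := fun ℓ =>
    (LinearMap.toContinuousLinearMap ℓ).differentiableAt.comp y hc
  have h := directionalDeriv_bilin (LinearMap.lsmul ℝ W) hc' hf v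
  have h2 : directionalDeriv c y v = fderiv ℝ c y v := dual_directionalDeriv hc' v LinearMap.id
  rw [h2] at h
  exact h

/-- The derivative of a function with values in a linear subspace has values there. -/
theorem directionalDeriv_mem (hf : HasDerivComponents f y) {S : Submodule ℝ W}
    (h : ∀ᶠ z in nhds y, f z ∈ S) (v : U) : directionalDeriv f y v ∈ S := by
  -- A subspace of a finite-dimensional space is the common kernel of the functionals that vanish on
  -- it.
  rw [← Subspace.dualAnnihilator_dualCoannihilator_eq (W := S), Submodule.mem_dualCoannihilator]
  intro ℓ hℓ
  rw [dual_directionalDeriv hf]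
  have h2 : (fun z => ℓ (f z)) =ᶠ[nhds y] fun _ => (0 : ℝ) := by
    filter_upwards [h] with z hz
    exact (Submodule.mem_dualAnnihilator ℓ).mp hℓ _ hz
  rw [h2.fderiv_eq]
  simp

theorem directionalDeriv_comp {f : U' → W} {g : U → U'} (hf : HasDerivComponents f (g y))
    (hg : DifferentiableAt ℝ g y) (v : U) :
    directionalDeriv (fun z => f (g z)) y v = directionalDeriv f (g y) (fderiv ℝ g y v) := by
  simp only [directionalDeriv]
  refine Finset.sum_congr rfl fun k _ => ?_
  have := fderiv_comp (g := fun z => (Module.finBasis ℝ W).coord k (f z)) y (hf _) hg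
  rw [show (fun z => (Module.finBasis ℝ W).coord k (f (g z))) =
    (fun z => (Module.finBasis ℝ W).coord k (f z)) ∘ g from rfl, this]
  rfl

theorem SmoothComponentsOn.directionalDeriv (hf : SmoothComponentsOn f s) (hs : IsOpen s) (v : U) :
    SmoothComponentsOn (fun y => directionalDeriv f y v) s := fun ℓ => by
  have h : ContDiffOn ℝ ∞ (fun y => fderiv ℝ (fun z => ℓ (f z)) y v) s :=
    ((hf ℓ).fderiv_of_isOpen hs (by simp)).clm_apply contDiffOn_const
  exact h.congr fun y hy => dual_directionalDeriv (hf.hasDerivComponents hs hy) v ℓ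

theorem HasDerivComponents.mul {A : Type*} [Ring A] [Algebra ℝ A] [Module.Finite ℝ A] {f g : U → A}
    (hf : HasDerivComponents f y) (hg : HasDerivComponents g y) :
    HasDerivComponents (fun z => f z * g z) y := fun ℓ => by
  have h : (fun z => ℓ (f z * g z)) =
      fun z => ∑ k, (Module.finBasis ℝ A).coord k (f z) *
        (ℓ ∘ₗ LinearMap.mulLeft ℝ (Module.finBasis ℝ A k)) (g z) := by
    funext z
    conv_lhs => rw [← (Module.finBasis ℝ A).sum_repr (f z)]
    simp only [Finset.sum_mul, map_sum, map_smul, smul_mul_assoc, Module.Basis.coord_apply,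
      LinearMap.comp_apply, smul_eq_mul, LinearMap.mulLeft_apply]
  rw [h]
  exact DifferentiableAt.fun_sum fun k _ => (hf _).fun_mul (hg _)

end Deriv

end Smooth

/-! ### Smooth families of exponentials, pull-backs and maps `τ` -/

section Families

variable {U : Type*} [NormedAddCommGroup U] [NormedSpace ℝ U] {s : Set U}
  {W W' : Type*} [AddCommGroup W] [Module ℝ W] [AddCommGroup W'] [Module ℝ W']
  [Module.Finite ℝ W] [Module.Finite ℝ W'] {κ : Type}

theorem exists_linearMap_eq_nilPart (W : Type*) [AddCommGroup W] [Module ℝ W] :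
    ∃ L : ExteriorAlgebra ℝ W →ₗ[ℝ] ExteriorAlgebra ℝ W, ∀ x, L x = nilPart x :=
  ⟨LinearMap.id - Algebra.linearMap ℝ _ ∘ₗ ExteriorAlgebra.algebraMapInv.toLinearMap,
    fun _ => rfl⟩

theorem directionalDeriv_nilPart_pow {θ : U → ExteriorAlgebra ℝ W} {y : U}
    (hθ : HasDerivComponents θ y) (he : ∀ᶠ z in nhds y, gradeInv (θ z) = θ z) (v : U) (k : ℕ) :
    HasDerivComponents (fun z => nilPart (θ z) ^ k) y ∧
    directionalDeriv (fun z => nilPart (θ z) ^ (k + 1)) y v =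
      ((k : ℝ) + 1) • (nilPart (θ y) ^ k * directionalDeriv (fun z => nilPart (θ z)) y v) := by
  have h1 : HasDerivComponents (fun z => nilPart (θ z)) y := fun ℓ =>
    hθ (ℓ ∘ₗ (LinearMap.id - Algebra.linearMap ℝ _ ∘ₗ ExteriorAlgebra.algebraMapInv.toLinearMap))
  induction k with
  | zero =>
    refine ⟨fun ℓ => ?_, ?_⟩
    · simp only [pow_zero]; exact differentiableAt_const _
    · simp
  | succ k ih =>
    have h2 : HasDerivComponents (fun z => nilPart (θ z) ^ (k + 1)) y := by
      simp only [pow_succ]; exact ih.1.mul h1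
    refine ⟨h2, ?_⟩
    have h3 : (fun z => nilPart (θ z) ^ (k + 1 + 1)) =
        fun z => nilPart (θ z) * nilPart (θ z) ^ (k + 1) := funext fun z => pow_succ' _ _
    rw [h3, directionalDeriv_mul h1 h2, ih.2, mul_smul_comm, ← mul_assoc, ← pow_succ',
      ← even_comm (x := nilPart (θ y) ^ (k + 1)) (by
        rw [map_pow, gradeInv_nilPart he.self_of_nhds])]
    push_cast
    module

/-- The scalar factor contributes the derivative of the component of degree zero, the truncated
series that of the nilpotent part; they add up to the derivative of `θ`. Evenness lets the factors
commute. -/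
theorem directionalDeriv_extExp {θ : U → ExteriorAlgebra ℝ W} {y : U}
    (hθ : HasDerivComponents θ y) (he : ∀ᶠ z in nhds y, gradeInv (θ z) = θ z) (v : U) :
    HasDerivComponents (fun z => extExp (θ z)) y ∧
    directionalDeriv (fun z => extExp (θ z)) y v = extExp (θ y) * directionalDeriv θ y v := by
  have h1 : HasDerivComponents (fun z => nilPart (θ z)) y := fun ℓ =>
    hθ (ℓ ∘ₗ (LinearMap.id - Algebra.linearMap ℝ _ ∘ₗ ExteriorAlgebra.algebraMapInv.toLinearMap))
  have h0 : DifferentiableAt ℝ (fun z => ExteriorAlgebra.algebraMapInv (θ z)) y :=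
    hθ ExteriorAlgebra.algebraMapInv.toLinearMap
  set m := Module.finrank ℝ W + 1 with hm
  -- The range has one term beyond `m`, which differentiation uses up; the remaining `m` terms still
  -- give the whole exponential.
  have h2 : (fun z => extExp (θ z)) = fun z => Real.exp (ExteriorAlgebra.algebraMapInv (θ z)) •
      ∑ k ∈ Finset.range (m + 1), ((k.factorial : ℝ)⁻¹) • nilPart (θ z) ^ k :=
    funext fun z => extExp_eq_sum (θ z) (by omega)
  have h3 : HasDerivComponents (fun z => ∑ k ∈ Finset.range (m + 1),
      ((k.factorial : ℝ)⁻¹) • nilPart (θ z) ^ k) y := fun ℓ => by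
    simp only [map_sum, map_smul]
    exact DifferentiableAt.fun_sum fun k _ =>
      ((directionalDeriv_nilPart_pow hθ he v k).1 ℓ).fun_const_smul _
  have h4 : directionalDeriv (fun z => ∑ k ∈ Finset.range (m + 1),
      ((k.factorial : ℝ)⁻¹) • nilPart (θ z) ^ k) y v = ∑ k ∈ Finset.range (m + 1),
      ((k.factorial : ℝ)⁻¹) • directionalDeriv (fun z => nilPart (θ z) ^ k) y v := by
    refine eq_of_forall_dual fun ℓ => ?_
    rw [dual_directionalDeriv h3]
    simp only [map_sum, map_smul]
    rw [fderiv_fun_sum fun k _ =>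
      ((directionalDeriv_nilPart_pow hθ he v k).1 ℓ).fun_const_smul _]
    simp only [FunLike.coe_sum, Finset.sum_apply]
    refine Finset.sum_congr rfl fun k _ => ?_
    rw [dual_directionalDeriv (directionalDeriv_nilPart_pow hθ he v k).1,
      fderiv_fun_const_smul ((directionalDeriv_nilPart_pow hθ he v k).1 ℓ)]
    rfl
  rw [sum_inv_factorial_smul_deriv (nilPart (θ y)) (directionalDeriv (fun z => nilPart (θ z)) y v)
    (fun k => directionalDeriv (fun z => nilPart (θ z) ^ k) y v)
    (by simp only [pow_zero]; exact directionalDeriv_const _ _)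
    (fun k => (directionalDeriv_nilPart_pow hθ he v k).2)] at h4
  have h5 : directionalDeriv (fun z => nilPart (θ z)) y v = directionalDeriv θ y v -
      algebraMap ℝ _ (fderiv ℝ (fun z => ExteriorAlgebra.algebraMapInv (θ z)) y v) := by
    obtain ⟨L, hL⟩ := exists_linearMap_eq_nilPart W
    have h6 := dual_directionalDeriv hθ v ExteriorAlgebra.algebraMapInv.toLinearMap
    simp only [AlgHom.toLinearMap_apply] at h6
    rw [← h6]
    simp only [← hL]
    rw [directionalDeriv_linear hθ, hL, nilPart]
  refine ⟨fun ℓ => ?_, ?_⟩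
  · rw [h2]
    simp only [map_smul]
    exact h0.exp.smul (h3 ℓ)
  · rw [h2, directionalDeriv_smul h0.exp h3, h4, fderiv_exp h0, smul_apply, h5]
    have h7 : extExp (θ y) = Real.exp (ExteriorAlgebra.algebraMapInv (θ y)) •
      ∑ k ∈ Finset.range (m + 1), ((k.factorial : ℝ)⁻¹) • nilPart (θ y) ^ k :=
        extExp_eq_sum (θ y) (by omega)
    rw [← smul_mul_assoc, ← extExp_eq_sum (θ y) (m := m) (by omega), smul_eq_mul, mul_comm, mul_smul,
      ← h7, mul_sub, ← Algebra.commutes, ← Algebra.smul_def, add_sub_cancel]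

theorem SmoothComponentsOn.extExp {θ : U → ExteriorAlgebra ℝ W} (hθ : SmoothComponentsOn θ s) :
    SmoothComponentsOn (fun z => extExp (θ z)) s :=
  .smul (ContDiffOn.exp (hθ ExteriorAlgebra.algebraMapInv.toLinearMap)) <| .sum fun k _ =>
    .smul contDiffOn_const <| SmoothComponentsOn.pow (hθ.linear
      (LinearMap.id - Algebra.linearMap ℝ _ ∘ₗ ExteriorAlgebra.algebraMapInv.toLinearMap)) k

theorem SmoothComponentsOn.formMap [Finite κ] {L : U → W →ₗ[ℝ] W'} (hL : SmoothComponentsOn L s) :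
    SmoothComponentsOn (fun y => (formMap κ (L y)).toLinearMap) s := by
  refine .of_apply fun x => ?_
  simp only [AlgHom.toLinearMap_apply]
  induction x using exterior_left_induction with
  | algebraMap r => simp only [AlgHom.commutes]; exact .const _
  | add a b ha hb => simp only [map_add]; exact ha.add hb
  | ι_mul u x hx =>
    have h : ∀ y, CliffordCourant.formMap κ (L y) (ExteriorAlgebra.ι ℝ u) =
        ExteriorAlgebra.ι ℝ (LinearMap.inl ℝ (κ → ℝ) W' u.1 +
          LinearMap.inr ℝ (κ → ℝ) W' (L y u.2)) := by
      intro y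
      rw [CliffordCourant.formMap, ExteriorAlgebra.map_apply_ι]
      simp
    simp only [map_mul, h]
    refine SmoothComponentsOn.mul (.linear (.add (.const _) ?_) _) hx
    exact (hL.linear (LinearMap.applyₗ u.2)).linear _

theorem SmoothComponentsOn.tau {N N' : ℕ}
    {K : U → ExteriorAlgebra ℝ ((Fin N ⊕ Fin N' → ℝ) × W)} (hK : SmoothComponentsOn K s) :
    SmoothComponentsOn (fun y => tau (K y)) s := by
  let B : ExteriorAlgebra ℝ ((Fin N ⊕ Fin N' → ℝ) × W) →ₗ[ℝ]
      ExteriorAlgebra ℝ ((Fin N → ℝ) × W) →ₗ[ℝ] ExteriorAlgebra ℝ ((Fin N' → ℝ) × W) :=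
    (LinearMap.lcomp ℝ _ (pullLeft N N' W).toLinearMap ∘ₗ
      LinearMap.llcomp ℝ _ _ _ (fibreIntegral N N' W)) ∘ₗ LinearMap.mul ℝ _
  exact (hK.extExp).linear B

end Families

/-! ### Exterior products with one-forms on the base -/

section Basic

variable {κ : Type} {W : Type*} [AddCommGroup W] [Module ℝ W]

theorem basicι_anticomm (α β : W) :
    basicι κ α * basicι κ β = -(basicι κ β * basicι κ α) := ι_anticomm _ _

theorem basicι_eq (α : W) :
    basicι κ α = (ExteriorAlgebra.ι ℝ ∘ₗ LinearMap.inr ℝ (κ → ℝ) W) α := rfl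

end Basic

/-! ### The exterior derivative on Euclidean space -/

section ModelDeriv

variable {n m : ℕ} {κ : Type} [Finite κ]

local notation "𝔼" n => EuclideanSpace ℝ (Fin n)
local notation "𝔸[" κ "," n "]" =>
  ExteriorAlgebra ℝ ((κ → ℝ) × Module.Dual ℝ (EuclideanSpace ℝ (Fin n)))

/-- The coordinate covector `dyʲ`. -/
def coordForm (n : ℕ) (j : Fin n) : Module.Dual ℝ (𝔼 n) :=
  (EuclideanSpace.proj j : EuclideanSpace ℝ (Fin n) →L[ℝ] ℝ).toLinearMap

theorem coordForm_apply (j : Fin n) (v : 𝔼 n) : coordForm n j v = v j := rfl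

theorem sum_coordForm (α : Module.Dual ℝ (𝔼 n)) :
    α = ∑ j, α (EuclideanSpace.single j 1) • coordForm n j := by
  refine LinearMap.ext fun v => ?_
  have h := (EuclideanSpace.basisFun (Fin n) ℝ).sum_repr v
  conv_lhs => rw [← h]
  simp [coordForm_apply, mul_comm]

theorem modelExtDeriv_apply (θ : (𝔼 n) → 𝔸[κ, n]) (y : 𝔼 n) :
    modelExtDeriv θ y =
      ∑ j, basicι κ (coordForm n j) * directionalDeriv θ y (EuclideanSpace.single j 1) := rfl

theorem modelExtDeriv_congr {θ η : (𝔼 n) → 𝔸[κ, n]} {y : 𝔼 n} (h : θ =ᶠ[nhds y] η) :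
    modelExtDeriv θ y = modelExtDeriv η y := by
  simp only [modelExtDeriv_apply, directionalDeriv_congr h]

theorem SmoothComponentsOn.modelExtDeriv {θ : (𝔼 n) → 𝔸[κ, n]} {s : Set (𝔼 n)}
    (hθ : SmoothComponentsOn θ s) (hs : IsOpen s) : SmoothComponentsOn (modelExtDeriv θ) s :=
  .sum fun _ _ => .mul (.const _) (hθ.directionalDeriv hs _)

theorem smoothComponentsOn_dualMap_fderiv {s : Set (𝔼 n)} (hs : IsOpen s) {g : (𝔼 n) → 𝔼 m}
    (hg : ContDiffOn ℝ ∞ g s) :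
    SmoothComponentsOn (fun z => (fderiv ℝ g z).toLinearMap.dualMap) s := by
  have h1 : ContDiffOn ℝ ∞ (fderiv ℝ g) s := hg.fderiv_of_isOpen hs (by simp)
  refine .of_apply fun α => .of_apply fun w => .of_contDiffOn ?_
  exact (LinearMap.toContinuousLinearMap α).contDiff.comp_contDiffOn
    (h1.clm_apply contDiffOn_const)

/-- The pull-back of a constant form is closed. -/
theorem modelExtDeriv_formMap_const {s : Set (𝔼 n)} (hs : IsOpen s) {g : (𝔼 n) → 𝔼 m}
    (hg : ContDiffOn ℝ ∞ g s) (a : 𝔸[κ, m]) {y : 𝔼 n} (hy : y ∈ s) :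
    modelExtDeriv (fun z => formMap κ (fderiv ℝ g z).toLinearMap.dualMap a) y = 0 := by
  have hD := smoothComponentsOn_dualMap_fderiv hs hg
  have ha' : ∀ a, HasDerivComponents
      (fun z => formMap κ (fderiv ℝ g z).toLinearMap.dualMap a) y := fun a =>
    ((hD.formMap (κ := κ)).linear (LinearMap.applyₗ a)).hasDerivComponents hs hy
  induction a using exterior_left_induction with
  | algebraMap r => simp [modelExtDeriv_apply, AlgHom.commutes, directionalDeriv_const]
  | add a b ha hb =>
    simp only [modelExtDeriv_apply, map_add] at ha hb ⊢
    simp only [directionalDeriv_add (ha' a) (ha' b), mul_add, Finset.sum_add_distrib, ha, hb,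
      add_zero]
  | ι_mul u x hx =>
    obtain ⟨ξ, α⟩ := u
    have hι : ∀ z, formMap κ (fderiv ℝ g z).toLinearMap.dualMap (ExteriorAlgebra.ι ℝ (ξ, α)) =
        ExteriorAlgebra.ι ℝ (ξ, (fderiv ℝ g z).toLinearMap.dualMap α) := fun z => by
      rw [formMap, ExteriorAlgebra.map_apply_ι]; rfl
    have hα : SmoothComponentsOn (fun z => (fderiv ℝ g z).toLinearMap.dualMap α) s :=
      hD.linear (LinearMap.applyₗ α)
    have hdι : ∀ v, directionalDeriv (fun z =>
        formMap κ (fderiv ℝ g z).toLinearMap.dualMap (ExteriorAlgebra.ι ℝ (ξ, α))) y v =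
        basicι κ (directionalDeriv (fun z => (fderiv ℝ g z).toLinearMap.dualMap α) y v) := by
      intro v
      have h1 : (fun z => formMap κ (fderiv ℝ g z).toLinearMap.dualMap
          (ExteriorAlgebra.ι ℝ (ξ, α))) = fun z =>
          ExteriorAlgebra.ι ℝ ((ξ, 0) : (κ → ℝ) × Module.Dual ℝ (𝔼 n)) +
          (ExteriorAlgebra.ι ℝ ∘ₗ LinearMap.inr ℝ (κ → ℝ) _)
            ((fderiv ℝ g z).toLinearMap.dualMap α) := by
        funext z
        rw [hι, LinearMap.comp_apply, ← map_add]
        simp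
      rw [h1, directionalDeriv_add (fun ℓ => differentiableAt_const _)
        ((hα.linear _).hasDerivComponents hs hy), directionalDeriv_const, zero_add,
        directionalDeriv_linear (hα.hasDerivComponents hs hy)]
      rfl
    -- The pull-back of the constant covector `α` is the differential of `α ∘ g`; its derivative is
    -- the Hessian of `α ∘ g`, and antisymmetrising a symmetric form gives zero.
    have h2 : ∑ j, basicι κ (coordForm n j) * basicι κ (directionalDeriv
        (fun z => (fderiv ℝ g z).toLinearMap.dualMap α) y (EuclideanSpace.single j 1)) = 0 := by
      have hαg : ContDiffAt ℝ ∞ (fun z => α (g z)) y :=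
        (LinearMap.toContinuousLinearMap α).contDiff.contDiffAt.comp y
          (hg.contDiffAt (hs.mem_nhds hy))
      have hsymm : IsSymmSndFDerivAt ℝ (fun z => α (g z)) y := hαg.isSymmSndFDerivAt (by
        rw [minSmoothness_of_isRCLikeNormedField]; exact WithTop.coe_le_coe.mpr le_top)
      have h3 : ∀ v w, directionalDeriv (fun z => (fderiv ℝ g z).toLinearMap.dualMap α) y v w =
          fderiv ℝ (fderiv ℝ (fun z => α (g z))) y v w := by
        intro v w
        refine (dual_directionalDeriv (hα.hasDerivComponents hs hy) v
          (Module.Dual.eval ℝ _ w)).trans ?_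
        have h4 : (fun z => Module.Dual.eval ℝ _ w ((fderiv ℝ g z).toLinearMap.dualMap α))
            =ᶠ[nhds y] fun z => fderiv ℝ (fun z => α (g z)) z w := by
          filter_upwards [hs.mem_nhds hy] with z hz
          have hgz : DifferentiableAt ℝ g z :=
            (hg.contDiffAt (hs.mem_nhds hz)).differentiableAt (by simp)
          have := ((LinearMap.toContinuousLinearMap α).hasFDerivAt.comp z hgz.hasFDerivAt).fderiv
          exact (DFunLike.congr_fun this w).symm
        rw [h4.fderiv_eq]
        have h5 : DifferentiableAt ℝ (fderiv ℝ (fun z => α (g z))) y :=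
          (hαg.fderiv_right (m := ∞) (by simp)).differentiableAt (by simp)
        rw [fderiv_clm_apply h5 (differentiableAt_const w)]
        simp
      have h6 : ∀ v, basicι κ (directionalDeriv
          (fun z => (fderiv ℝ g z).toLinearMap.dualMap α) y v) =
          ∑ k, fderiv ℝ (fderiv ℝ (fun z => α (g z))) y v (EuclideanSpace.single k 1) •
            basicι κ (coordForm n k) := by
        intro v
        conv_lhs => rw [sum_coordForm (directionalDeriv _ y v)]
        simp only [basicι_eq, map_sum, map_smul, h3]
      simp only [h6, Finset.mul_sum, mul_smul_comm]
      refine eq_zero_of_eq_neg ?_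
      -- Exchanging the indices changes the sign of the product of covectors and fixes the Hessian,
      -- so the sum is its own negative.
      conv_lhs => rw [Finset.sum_comm]
      rw [← Finset.sum_neg_distrib]
      refine Finset.sum_congr rfl fun j _ => ?_
      rw [← Finset.sum_neg_distrib]
      refine Finset.sum_congr rfl fun k _ => ?_
      rw [basicι_anticomm, smul_neg, hsymm.eq]
    have h7 : ∀ z, formMap κ (fderiv ℝ g z).toLinearMap.dualMap (ExteriorAlgebra.ι ℝ (ξ, α) * x) =
        formMap κ (fderiv ℝ g z).toLinearMap.dualMap (ExteriorAlgebra.ι ℝ (ξ, α)) *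
          formMap κ (fderiv ℝ g z).toLinearMap.dualMap x := fun z => map_mul _ _ _
    simp only [h7, modelExtDeriv_apply] at hx ⊢
    simp only [directionalDeriv_mul (ha' _) (ha' x), hdι, mul_add, ← mul_assoc,
      Finset.sum_add_distrib]
    rw [← Finset.sum_mul, h2, zero_mul, zero_add, hι]
    have h8 : ∀ j, basicι κ (coordForm n j) *
        ExteriorAlgebra.ι ℝ (ξ, (fderiv ℝ g y).toLinearMap.dualMap α) =
        -(ExteriorAlgebra.ι ℝ (ξ, (fderiv ℝ g y).toLinearMap.dualMap α) *
          basicι κ (coordForm n j)) := fun j => ι_anticomm _ _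
    simp only [h8, neg_mul, mul_assoc]
    rw [Finset.sum_neg_distrib, ← Finset.mul_sum, hx, mul_zero, neg_zero]

/-- The exterior derivative commutes with pull-backs. -/
theorem modelExtDeriv_formMap {s : Set (𝔼 n)} (hs : IsOpen s) {g : (𝔼 n) → 𝔼 m}
    (hg : ContDiffOn ℝ ∞ g s) {θ : (𝔼 m) → 𝔸[κ, m]} {y : 𝔼 n} (hy : y ∈ s)
    (hθ : HasDerivComponents θ (g y)) :
    modelExtDeriv (fun z => formMap κ (fderiv ℝ g z).toLinearMap.dualMap (θ (g z))) y =
      formMap κ (fderiv ℝ g y).toLinearMap.dualMap (modelExtDeriv θ (g y)) := by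
  have hgy : DifferentiableAt ℝ g y :=
    (hg.contDiffAt (hs.mem_nhds hy)).differentiableAt (by simp)
  have hA : SmoothComponentsOn
      (fun z => (formMap κ (fderiv ℝ g z).toLinearMap.dualMap).toLinearMap) s :=
    (smoothComponentsOn_dualMap_fderiv hs hg).formMap
  have hA' := hA.hasDerivComponents hs hy
  have hθg : HasDerivComponents (fun z => θ (g z)) y := fun ℓ =>
    DifferentiableAt.comp (g := fun z => ℓ (θ z)) y (hθ ℓ) hgy
  -- The product rule separates the derivative of the pull-back operator, which contributes the
  -- closed pull-back of the constant `θ (g y)`, from that of the coefficients, given by the chain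
  -- rule.
  have h1 : ∀ v, directionalDeriv
      (fun z => formMap κ (fderiv ℝ g z).toLinearMap.dualMap (θ (g z))) y v =
      directionalDeriv (fun z => formMap κ (fderiv ℝ g z).toLinearMap.dualMap (θ (g y))) y v +
      ∑ i, coordForm m i (fderiv ℝ g y v) • formMap κ (fderiv ℝ g y).toLinearMap.dualMap
        (directionalDeriv θ (g y) (EuclideanSpace.single i 1)) := by
    intro v
    refine (directionalDeriv_apply hA' hθg v).trans ?_
    congr 1
    · exact (directionalDeriv_linear hA' (LinearMap.applyₗ (θ (g y))) v).symm
    · rw [directionalDeriv_comp hθ hgy]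
      have h2 : fderiv ℝ g y v = ∑ i, coordForm m i (fderiv ℝ g y v) •
          (EuclideanSpace.single i 1 : 𝔼 m) := by
        simpa [coordForm_apply] using ((EuclideanSpace.basisFun (Fin m) ℝ).sum_repr (fderiv ℝ g y v)).symm
      conv_lhs => rw [h2, directionalDeriv_vec_sum, map_sum]
      simp only [map_smul, AlgHom.toLinearMap_apply]
  have h3 : ∀ i, basicι κ ((fderiv ℝ g y).toLinearMap.dualMap (coordForm m i)) =
      ∑ j, coordForm m i (fderiv ℝ g y (EuclideanSpace.single j 1)) •
        basicι κ (coordForm n j) := by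
    intro i
    conv_lhs => rw [sum_coordForm ((fderiv ℝ g y).toLinearMap.dualMap (coordForm m i))]
    simp only [basicι_eq, map_sum, map_smul]
    rfl
  have h4 := modelExtDeriv_formMap_const hs hg (θ (g y)) hy
  rw [modelExtDeriv_apply] at h4
  rw [modelExtDeriv_apply, modelExtDeriv_apply]
  simp only [h1, mul_add, Finset.sum_add_distrib, h4, zero_add, map_sum, map_mul, formMap_basicι,
    h3, Finset.mul_sum, Finset.sum_mul, mul_smul_comm, smul_mul_assoc]
  exact Finset.sum_comm

/-- The Leibniz rule for `e^K φ`. The covectors `dyʲ` pass through `e^K`, which is even, and out of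
the integral by the projection formula, so no signs occur. -/
theorem modelExtDeriv_tau {N N' : ℕ} {K : (𝔼 n) → 𝔸[Fin N ⊕ Fin N', n]} {f : (𝔼 n) → 𝔸[Fin N, n]}
    {y : 𝔼 n} (hK : HasDerivComponents K y) (he : ∀ᶠ z in nhds y, gradeInv (K z) = K z)
    (hf : HasDerivComponents f y) :
    modelExtDeriv (fun z => tau (K z) (f z)) y =
      fibreIntegral N N' _ (extExp (K y) * modelExtDeriv K y * pullLeft N N' _ (f y)) +
        tau (K y) (modelExtDeriv f y) := by
  have hE := fun v => directionalDeriv_extExp hK he v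
  have hf' : HasDerivComponents (fun z => pullLeft N N' _ (f z)) y :=
    fun ℓ => hf (ℓ ∘ₗ (pullLeft N N' _).toLinearMap)
  have h1 : ∀ v, directionalDeriv (fun z => tau (K z) (f z)) y v =
      fibreIntegral N N' _ (extExp (K y) * directionalDeriv K y v * pullLeft N N' _ (f y)) +
        tau (K y) (directionalDeriv f y v) := by
    intro v
    refine (directionalDeriv_linear ((hE v).1.mul hf') (fibreIntegral N N' _) v).trans ?_
    rw [directionalDeriv_mul (hE v).1 hf', (hE v).2, map_add, tau_apply]
    congr 3
    exact directionalDeriv_linear hf (pullLeft N N' _).toLinearMap v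
  simp only [modelExtDeriv_apply, h1, mul_add, Finset.sum_add_distrib, map_sum, Finset.mul_sum,
    Finset.sum_mul, tau_basicι_mul he.self_of_nhds]
  congr 1
  refine Finset.sum_congr rfl fun j _ => ?_
  rw [← fibreIntegral_pullRight_mul, ← basicIncl_ι, pullRight_basicIncl, ← basicIncl_ι,
    ← mul_assoc (extExp (K y)), ← mul_assoc, ← mul_assoc,
    even_comm (gradeInv_extExp he.self_of_nhds)]

end ModelDeriv

/-! ### Forms on a manifold in charts -/

section Charts

variable {n : ℕ} {M : Type*} [TopologicalSpace M] [ChartedSpace (EuclideanSpace ℝ (Fin n)) M]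
  {κ κ' : Type}

instance tangentSpace_finite (x : M) : Module.Finite ℝ (TangentSpace (𝓡 n) x) :=
  inferInstanceAs (Module.Finite ℝ (EuclideanSpace ℝ (Fin n)))

/-- The derivative of the preferred chart at `x₀`. -/
def chartVec (x₀ x : M) : TangentSpace (𝓡 n) x →ₗ[ℝ] EuclideanSpace ℝ (Fin n) :=
  (mfderiv (𝓡 n) (𝓡 n) (extChartAt (𝓡 n) x₀ : M → EuclideanSpace ℝ (Fin n)) x).toLinearMap

/-- The derivative of the inverse of the preferred chart at `x₀`. -/
def symmVec (x₀ : M) (y : EuclideanSpace ℝ (Fin n)) :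
    EuclideanSpace ℝ (Fin n) →ₗ[ℝ] TangentSpace (𝓡 n) ((extChartAt (𝓡 n) x₀).symm y) :=
  (mfderiv (𝓡 n) (𝓡 n) (extChartAt (𝓡 n) x₀).symm y).toLinearMap

/-- The expression of a form at `x` in the preferred chart at `x₀`. -/
def toChart (κ : Type) (x₀ : M) (y : EuclideanSpace ℝ (Fin n)) :
    FormAt n κ ((extChartAt (𝓡 n) x₀).symm y) →ₐ[ℝ]
      ExteriorAlgebra ℝ ((κ → ℝ) × Module.Dual ℝ (EuclideanSpace ℝ (Fin n))) :=
  formMap κ (symmVec x₀ y).dualMap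

/-- The form at `x` with the given expression in the preferred chart at `x₀`. -/
def ofChart (κ : Type) (x₀ x : M) :
    ExteriorAlgebra ℝ ((κ → ℝ) × Module.Dual ℝ (EuclideanSpace ℝ (Fin n))) →ₐ[ℝ] FormAt n κ x :=
  formMap κ (chartVec x₀ x).dualMap

theorem inChart_apply (x₀ : M) (θ : ExtForm n M κ) (y : EuclideanSpace ℝ (Fin n)) :
    inChart x₀ θ y = toChart κ x₀ y (θ ((extChartAt (𝓡 n) x₀).symm y)) := rfl

theorem extDeriv_apply [Finite κ] (θ : ExtForm n M κ) (x : M) :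
    extDeriv θ x = ofChart κ x x (modelExtDeriv (inChart x θ) (extChartAt (𝓡 n) x x)) := rfl

theorem isOpen_chart_target (x₀ : M) : IsOpen (extChartAt (𝓡 n) x₀).target :=
  isOpen_extChartAt_target x₀

/-- The domain in the chart at `x₀` of the change of coordinates to the chart at `x₁`. -/
def overlap (x₀ x₁ : M) : Set (EuclideanSpace ℝ (Fin n)) :=
  (extChartAt (𝓡 n) x₀).target ∩ (extChartAt (𝓡 n) x₀).symm ⁻¹' (extChartAt (𝓡 n) x₁).source

/-- The change of coordinates from the chart at `x₀` to the chart at `x₁`. -/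
def transition (x₀ x₁ : M) (y : EuclideanSpace ℝ (Fin n)) : EuclideanSpace ℝ (Fin n) :=
  extChartAt (𝓡 n) x₁ ((extChartAt (𝓡 n) x₀).symm y)

theorem isOpen_overlap (x₀ x₁ : M) : IsOpen (overlap (n := n) x₀ x₁) :=
  (continuousOn_extChartAt_symm x₀).isOpen_inter_preimage (isOpen_chart_target x₀)
    (isOpen_extChartAt_source x₁)

theorem transition_mem {x₀ x₁ : M} {y : EuclideanSpace ℝ (Fin n)} (hy : y ∈ overlap x₀ x₁) :
    transition x₀ x₁ y ∈ (extChartAt (𝓡 n) x₁).target := (extChartAt (𝓡 n) x₁).map_source hy.2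

theorem mem_overlap {x₀ : M} {y : EuclideanSpace ℝ (Fin n)}
    (hy : y ∈ (extChartAt (𝓡 n) x₀).target) : y ∈ overlap x₀ ((extChartAt (𝓡 n) x₀).symm y) :=
  ⟨hy, mem_extChartAt_source _⟩

theorem inChart_baseForm (κ : Type) (x₀ : M) (θ : Form n M) (y : EuclideanSpace ℝ (Fin n)) :
    inChart x₀ (baseForm κ θ) y =
      ExteriorAlgebra.map (LinearMap.prodMap 0 LinearMap.id) (inChart x₀ θ y) := by
  have h : LinearMap.prodMap LinearMap.id (symmVec x₀ y).dualMap ∘ₗ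
      LinearMap.prodMap (0 : (Empty → ℝ) →ₗ[ℝ] κ → ℝ) LinearMap.id =
      LinearMap.prodMap 0 LinearMap.id ∘ₗ
        LinearMap.prodMap LinearMap.id (symmVec x₀ y).dualMap := LinearMap.ext fun _ => rfl
  rw [inChart_apply, inChart_apply, baseForm, toChart, toChart, formMap, formMap,
    ← AlgHom.comp_apply, ← AlgHom.comp_apply, ExteriorAlgebra.map_comp_map,
    ExteriorAlgebra.map_comp_map, h]

theorem SmoothForm.baseForm [Finite κ] {θ : Form n M} (hθ : SmoothForm θ) :
    SmoothForm (baseForm κ θ) := fun x₀ =>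
  ((hθ x₀).linear (ExteriorAlgebra.map (LinearMap.prodMap (0 : (Empty → ℝ) →ₗ[ℝ] κ → ℝ)
    (LinearMap.id : Module.Dual ℝ (EuclideanSpace ℝ (Fin n)) →ₗ[ℝ] _))).toLinearMap).congr
    fun y _ => inChart_baseForm κ x₀ θ y

theorem SmoothForm.mul [Finite κ] {θ η : ExtForm n M κ} (hθ : SmoothForm θ) (hη : SmoothForm η) :
    SmoothForm (fun x => θ x * η x) := fun x₀ =>
  ((hθ x₀).mul (hη x₀)).congr fun _ _ => map_mul (toChart κ x₀ _) _ _

theorem SmoothForm.add {θ η : ExtForm n M κ} (hθ : SmoothForm θ) (hη : SmoothForm η) :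
    SmoothForm (fun x => θ x + η x) := fun x₀ =>
  ((hθ x₀).add (hη x₀)).congr fun _ _ => map_add (toChart κ x₀ _) _ _

theorem SmoothForm.sub {θ η : ExtForm n M κ} (hθ : SmoothForm θ) (hη : SmoothForm η) :
    SmoothForm (fun x => θ x - η x) := fun x₀ =>
  ((hθ x₀).sub (hη x₀)).congr fun _ _ => map_sub (toChart κ x₀ _) _ _

theorem SmoothForm.sum {ι : Type*} {t : Finset ι} {θ : ι → ExtForm n M κ}
    (hθ : ∀ i ∈ t, SmoothForm (θ i)) : SmoothForm (fun x => ∑ i ∈ t, θ i x) := fun x₀ =>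
  (SmoothComponentsOn.sum fun i hi => hθ i hi x₀).congr fun _ _ => map_sum (toChart κ x₀ _) _ _

theorem SmoothForm.contractGenerator {θ : ExtForm n M κ} (hθ : SmoothForm θ) (k : κ) :
    SmoothForm (fun x => contractGenerator k (θ x)) := fun x₀ =>
  ((hθ x₀).linear (CliffordCourant.contractGenerator k)).congr fun _ _ =>
    formMap_contractGenerator _ k _

variable [IsManifold (𝓡 n) ∞ M]

theorem mdifferentiableAt_chart_symm {x₀ : M} {y : EuclideanSpace ℝ (Fin n)}
    (hy : y ∈ (extChartAt (𝓡 n) x₀).target) :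
    MDifferentiableAt (𝓡 n) (𝓡 n) (extChartAt (𝓡 n) x₀).symm y := by
  have : IsManifold (𝓡 n) 1 M := IsManifold.of_le (n := ∞) (by simp)
  have := mdifferentiableWithinAt_extChartAt_symm hy
  rwa [modelWithCornersSelf_coe, Set.range_id, mdifferentiableWithinAt_univ] at this

theorem mdifferentiableAt_chart {x₀ x : M} (hx : x ∈ (extChartAt (𝓡 n) x₀).source) :
    MDifferentiableAt (𝓡 n) (𝓡 n) (extChartAt (𝓡 n) x₀ : M → EuclideanSpace ℝ (Fin n)) x := by
  have : IsManifold (𝓡 n) 1 M := IsManifold.of_le (n := ∞) (by simp)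
  exact mdifferentiableAt_extChartAt (by rwa [extChartAt_source] at hx)

theorem chartVec_symmVec {x₀ : M} {y : EuclideanSpace ℝ (Fin n)}
    (hy : y ∈ (extChartAt (𝓡 n) x₀).target) (v : EuclideanSpace ℝ (Fin n)) :
    chartVec x₀ ((extChartAt (𝓡 n) x₀).symm y) (symmVec x₀ y v) = v := by
  have : IsManifold (𝓡 n) 1 M := IsManifold.of_le (n := ∞) (by simp)
  have h := mfderiv_extChartAt_comp_mfderivWithin_extChartAt_symm hy
  rw [modelWithCornersSelf_coe, Set.range_id, mfderivWithin_univ] at h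
  exact DFunLike.congr_fun h v

theorem symmVec_chartVec {x₀ : M} {y : EuclideanSpace ℝ (Fin n)}
    (hy : y ∈ (extChartAt (𝓡 n) x₀).target)
    (v : TangentSpace (𝓡 n) ((extChartAt (𝓡 n) x₀).symm y)) :
    symmVec x₀ y (chartVec x₀ ((extChartAt (𝓡 n) x₀).symm y) v) = v := by
  have : IsManifold (𝓡 n) 1 M := IsManifold.of_le (n := ∞) (by simp)
  have h := mfderivWithin_extChartAt_symm_comp_mfderiv_extChartAt hy
  rw [modelWithCornersSelf_coe, Set.range_id, mfderivWithin_univ] at h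
  exact DFunLike.congr_fun h v

theorem toChart_ofChart {x₀ : M} {y : EuclideanSpace ℝ (Fin n)}
    (hy : y ∈ (extChartAt (𝓡 n) x₀).target)
    (a : ExteriorAlgebra ℝ ((κ → ℝ) × Module.Dual ℝ (EuclideanSpace ℝ (Fin n)))) :
    toChart κ x₀ y (ofChart κ x₀ ((extChartAt (𝓡 n) x₀).symm y) a) = a := by
  have h : (symmVec x₀ y).dualMap ∘ₗ (chartVec x₀ ((extChartAt (𝓡 n) x₀).symm y)).dualMap =
      LinearMap.id := LinearMap.ext fun α => LinearMap.ext fun v =>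
    congrArg α (chartVec_symmVec hy v)
  rw [toChart, ofChart, formMap_formMap, h, formMap_id, AlgHom.id_apply]

theorem ofChart_toChart {x₀ : M} {y : EuclideanSpace ℝ (Fin n)}
    (hy : y ∈ (extChartAt (𝓡 n) x₀).target)
    (a : FormAt n κ ((extChartAt (𝓡 n) x₀).symm y)) :
    ofChart κ x₀ ((extChartAt (𝓡 n) x₀).symm y) (toChart κ x₀ y a) = a := by
  have h : (chartVec x₀ ((extChartAt (𝓡 n) x₀).symm y)).dualMap ∘ₗ (symmVec x₀ y).dualMap =
      LinearMap.id := LinearMap.ext fun α => LinearMap.ext fun v =>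
    congrArg α (symmVec_chartVec hy v)
  rw [toChart, ofChart, formMap_formMap, h, formMap_id, AlgHom.id_apply]

theorem ofChart_inChart {x₀ x : M} (hx : x ∈ (extChartAt (𝓡 n) x₀).source) (θ : ExtForm n M κ) :
    ofChart κ x₀ x (inChart x₀ θ (extChartAt (𝓡 n) x₀ x)) = θ x := by
  obtain ⟨y, hy, rfl⟩ : ∃ y ∈ (extChartAt (𝓡 n) x₀).target, (extChartAt (𝓡 n) x₀).symm y = x :=
    ⟨_, (extChartAt (𝓡 n) x₀).map_source hx, (extChartAt (𝓡 n) x₀).left_inv hx⟩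
  rw [(extChartAt (𝓡 n) x₀).right_inv hy, inChart_apply, ofChart_toChart hy]

theorem contDiffOn_transition (x₀ x₁ : M) :
    ContDiffOn ℝ ∞ (transition (n := n) x₀ x₁) (overlap x₀ x₁) :=
  contDiffOn_ext_coord_change x₁ x₀

theorem fderiv_transition {x₀ x₁ : M} {y : EuclideanSpace ℝ (Fin n)} (hy : y ∈ overlap x₀ x₁) :
    (fderiv ℝ (transition x₀ x₁) y).toLinearMap =
      chartVec x₁ ((extChartAt (𝓡 n) x₀).symm y) ∘ₗ symmVec x₀ y := by
  have h := mfderiv_comp y (mdifferentiableAt_chart hy.2) (mdifferentiableAt_chart_symm hy.1)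
  rw [mfderiv_eq_fderiv] at h
  exact congrArg ContinuousLinearMap.toLinearMap h

theorem toChart_ofChart_of_mem_overlap {x₀ x₁ : M} {y : EuclideanSpace ℝ (Fin n)}
    (hy : y ∈ overlap x₀ x₁)
    (a : ExteriorAlgebra ℝ ((κ → ℝ) × Module.Dual ℝ (EuclideanSpace ℝ (Fin n)))) :
    toChart κ x₀ y (ofChart κ x₁ ((extChartAt (𝓡 n) x₀).symm y) a) =
      formMap κ (fderiv ℝ (transition x₀ x₁) y).toLinearMap.dualMap a := by
  rw [toChart, ofChart, formMap_formMap, fderiv_transition hy]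
  rfl

theorem inChart_eq_of_mem_overlap {x₀ x₁ : M} {y : EuclideanSpace ℝ (Fin n)}
    (hy : y ∈ overlap x₀ x₁) (θ : ExtForm n M κ) :
    inChart x₀ θ y = formMap κ (fderiv ℝ (transition x₀ x₁) y).toLinearMap.dualMap
      (inChart x₁ θ (transition x₀ x₁ y)) := by
  rw [← toChart_ofChart_of_mem_overlap hy, transition, ofChart_inChart hy.2, inChart_apply]

/-- The exterior derivative can be computed in any preferred chart. -/
theorem inChart_extDeriv [Finite κ] {θ : ExtForm n M κ} (hθ : SmoothForm θ) {x₀ : M}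
    {y : EuclideanSpace ℝ (Fin n)} (hy : y ∈ (extChartAt (𝓡 n) x₀).target) :
    inChart x₀ (extDeriv θ) y = modelExtDeriv (inChart x₀ θ) y := by
  -- The definition of `extDeriv` at this point uses the preferred chart there; the transition to
  -- the chart at `x₀` is covered by naturality of the model derivative.
  set x := (extChartAt (𝓡 n) x₀).symm y with hx
  have hy' : y ∈ overlap x₀ x := mem_overlap hy
  have h1 : inChart x₀ θ =ᶠ[nhds y] fun z => formMap κ
      (fderiv ℝ (transition x₀ x) z).toLinearMap.dualMap (inChart x θ (transition x₀ x z)) := by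
    filter_upwards [(isOpen_overlap x₀ x).mem_nhds hy'] with z hz
    exact inChart_eq_of_mem_overlap hz θ
  rw [modelExtDeriv_congr h1, modelExtDeriv_formMap (isOpen_overlap x₀ x)
    (contDiffOn_transition x₀ x) hy'
    ((hθ x).hasDerivComponents (isOpen_chart_target x) (transition_mem hy')),
    ← toChart_ofChart_of_mem_overlap hy', inChart_apply, extDeriv_apply]
  rfl

theorem SmoothForm.extDeriv [Finite κ] {θ : ExtForm n M κ} (hθ : SmoothForm θ) :
    SmoothForm (extDeriv θ) := fun x₀ =>
  ((hθ x₀).modelExtDeriv (isOpen_chart_target x₀)).congr fun _ hy => inChart_extDeriv hθ hy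

theorem SmoothForm.twistedDeriv [Fintype κ] {c : κ → Form n M} {H φ : ExtForm n M κ}
    (hc : ∀ k, SmoothForm (c k)) (hH : SmoothForm H) (hφ : SmoothForm φ) :
    SmoothForm (twistedDeriv c H φ) :=
  .add (.add hφ.extDeriv (.sum fun k _ => .mul (hc k).baseForm (hφ.contractGenerator k)))
    (hH.mul hφ)

/-- A form with a given value at a point. -/
theorem exists_smoothForm_inChart_eq [T2Space M] [Finite κ] (x₀ : M)
    {y : EuclideanSpace ℝ (Fin n)} (hy : y ∈ (extChartAt (𝓡 n) x₀).target)
    (a : ExteriorAlgebra ℝ ((κ → ℝ) × Module.Dual ℝ (EuclideanSpace ℝ (Fin n)))) :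
    ∃ φ : ExtForm n M κ, SmoothForm φ ∧ ∀ᶠ z in nhds y, inChart x₀ φ z = a := by
  classical
  set x := (extChartAt (𝓡 n) x₀).symm y with hx
  have hxs : x ∈ (extChartAt (𝓡 n) x₀).source := (extChartAt (𝓡 n) x₀).map_target hy
  obtain ⟨f, -, hf⟩ := (SmoothBumpFunction.nhds_basis_tsupport (I := 𝓡 n) x).mem_iff.mp
    ((isOpen_extChartAt_source x₀).mem_nhds hxs)
  -- A bump function, equal to `1` near the point and supported in the chart domain, times the form
  -- that is constant in the chart.
  let φ : ExtForm n M κ := fun z => f z • ofChart κ x₀ z a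
  refine ⟨φ, fun x₁ => ?_, ?_⟩
  · have hf1 : ContDiffOn ℝ ∞ (fun z => f ((extChartAt (𝓡 n) x₁).symm z))
        (extChartAt (𝓡 n) x₁).target :=
      contMDiffOn_iff_contDiffOn.mp
        (f.contMDiff.comp_contMDiffOn (contMDiffOn_extChartAt_symm x₁))
    refine .of_locally fun z hz => ?_
    by_cases hzs : (extChartAt (𝓡 n) x₁).symm z ∈ (extChartAt (𝓡 n) x₀).source
    · refine ⟨overlap x₁ x₀, isOpen_overlap _ _, ⟨hz, hzs⟩, ?_⟩
      have h1 := ((smoothComponentsOn_dualMap_fderiv (isOpen_overlap x₁ x₀)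
        (contDiffOn_transition x₁ x₀)).formMap (κ := κ)).linear (LinearMap.applyₗ a)
      refine ((h1.mono Set.inter_subset_right).smul (hf1.mono Set.inter_subset_left)).congr
        fun w hw => ?_
      rw [inChart_apply, map_smul, toChart_ofChart_of_mem_overlap hw.2]
      rfl
    · have ho : IsOpen ((extChartAt (𝓡 n) x₁).target ∩
          (extChartAt (𝓡 n) x₁).symm ⁻¹' (tsupport f)ᶜ) :=
        (continuousOn_extChartAt_symm x₁).isOpen_inter_preimage (isOpen_chart_target x₁)
          (isClosed_tsupport _).isOpen_compl
      refine ⟨_, ho, ⟨hz, fun h => hzs (hf h)⟩, ?_⟩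
      refine (SmoothComponentsOn.const 0).congr fun w hw => ?_
      have h0 : f ((extChartAt (𝓡 n) x₁).symm w) = 0 := image_eq_zero_of_notMem_tsupport hw.2.2
      change toChart κ x₁ w (f _ • _) = 0
      rw [h0, zero_smul, map_zero]
  · have h1 : ∀ᶠ z in nhds y, f ((extChartAt (𝓡 n) x₀).symm z) = 1 :=
      ((continuousOn_extChartAt_symm x₀).continuousAt
        ((isOpen_chart_target x₀).mem_nhds hy)).eventually f.eventuallyEq_one
    filter_upwards [h1, (isOpen_chart_target x₀).mem_nhds hy] with z hz hz'
    change toChart κ x₀ z (f _ • _) = a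
    rw [hz, one_smul, toChart_ofChart hz']

/-- Operators of order zero that agree on smooth forms therefore agree on each fibre, which is the
source of uniqueness of brackets. -/
theorem exists_smoothForm_apply_eq [T2Space M] [Finite κ] (x : M) (a : FormAt n κ x) :
    ∃ φ : ExtForm n M κ, SmoothForm φ ∧ φ x = a := by
  have hx := mem_extChartAt_source (I := 𝓡 n) x
  obtain ⟨y, hy, hyx⟩ : ∃ y ∈ (extChartAt (𝓡 n) x).target, (extChartAt (𝓡 n) x).symm y = x :=
    ⟨_, (extChartAt (𝓡 n) x).map_source hx, (extChartAt (𝓡 n) x).left_inv hx⟩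
  obtain ⟨b, hb⟩ : ∃ b, ofChart κ x x b = a := by
    have : ∀ x' (a : FormAt n κ x'), (extChartAt (𝓡 n) x).symm y = x' →
        ∃ b, ofChart κ x x' b = a := by
      rintro _ a rfl
      exact ⟨_, ofChart_toChart hy a⟩
    exact this x a hyx
  obtain ⟨φ, hφ, h⟩ := exists_smoothForm_inChart_eq x hy b
  refine ⟨φ, hφ, ?_⟩
  have hxy : extChartAt (𝓡 n) x x = y :=
    (congrArg (extChartAt (𝓡 n) x) hyx).symm.trans ((extChartAt (𝓡 n) x).right_inv hy)
  rw [← ofChart_inChart hx φ, ← hb, ← h.self_of_nhds, hxy]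

end Charts

/-! ### Sections of `C` and their smoothness -/

section Sections

variable {n : ℕ} {M : Type*} [TopologicalSpace M] [ChartedSpace (EuclideanSpace ℝ (Fin n)) M]
  {κ : Type}

/-- The covector on the cotangent space given by a tangent vector. -/
def tangentEval (n : ℕ) {M : Type*} [TopologicalSpace M]
    [ChartedSpace (EuclideanSpace ℝ (Fin n)) M] (x : M) :
    TangentSpace (𝓡 n) x →ₗ[ℝ] Module.Dual ℝ (Module.Dual ℝ (TangentSpace (𝓡 n) x)) :=
  Module.Dual.eval ℝ (TangentSpace (𝓡 n) x)

theorem tangentEval_bijective (x : M) : Function.Bijective (tangentEval n x) :=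
  (Module.evalEquiv ℝ (TangentSpace (𝓡 n) x)).bijective

theorem act_eq_pairAction {x : M} (v : CCFibre n κ x) :
    act v = pairAction κ (Module.Dual ℝ (TangentSpace (𝓡 n) x)) (tangentEval n x v.1, v.2) := rfl

theorem isCliffordOp_act {x : M} (v : CCFibre n κ x) :
    IsCliffordOp (act v) (tangentEval n x v.1) := by
  rw [act_eq_pairAction]
  exact isCliffordOp_pairAction (tangentEval n x v.1) v.2.2

/-- The action `act` as a linear map. -/
def actLinear (n : ℕ) {M : Type*} [TopologicalSpace M] [ChartedSpace (EuclideanSpace ℝ (Fin n)) M]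
    (κ : Type) (x : M) : CCFibre n κ x →ₗ[ℝ] Module.End ℝ (FormAt n κ x) :=
  pairAction κ (Module.Dual ℝ (TangentSpace (𝓡 n) x)) ∘ₗ
    LinearMap.prodMap (tangentEval n x) (Submodule.subtype _)

theorem act_injective [Fintype κ] [DecidableEq κ] {x : M} :
    Function.Injective (act : CCFibre n κ x → _) := by
  intro v w h
  rw [act_eq_pairAction, act_eq_pairAction] at h
  obtain ⟨h1, h2⟩ := pairAction_injective v.2.2 w.2.2 h
  exact Prod.ext ((tangentEval_bijective x).1 h1) (Subtype.ext h2)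

/-- The odd operators that are elements of `C_{⟨κ⟩}`. -/
theorem exists_act_eq [Fintype κ] [DecidableEq κ] {x : M} {P : Module.End ℝ (FormAt n κ x)}
    {X : Module.Dual ℝ (Module.Dual ℝ (TangentSpace (𝓡 n) x))} (hP : IsCliffordOp P X) :
    ∃ v : CCFibre n κ x, act v = P ∧ tangentEval n x v.1 = X := by
  obtain ⟨t, ht, h⟩ := hP.exists_eq_pairAction
  obtain ⟨Y, rfl⟩ := (tangentEval_bijective x).2 X
  exact ⟨(Y, ⟨t, ht⟩), h.symm, rfl⟩

/-- The expression of a field of operators in the preferred chart at `x₀`. -/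
def opInChart (x₀ : M) (P : ∀ x : M, Module.End ℝ (FormAt n κ x)) (y : EuclideanSpace ℝ (Fin n)) :
    Module.End ℝ (ExteriorAlgebra ℝ ((κ → ℝ) × Module.Dual ℝ (EuclideanSpace ℝ (Fin n)))) :=
  (toChart κ x₀ y).toLinearMap ∘ₗ P ((extChartAt (𝓡 n) x₀).symm y) ∘ₗ
    (ofChart κ x₀ ((extChartAt (𝓡 n) x₀).symm y)).toLinearMap

theorem clifInChart_mem (x₀ : M) (v : ∀ x : M, CCFibre n κ x) (y : EuclideanSpace ℝ (Fin n)) :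
    clifInChart x₀ (fun x => ((v x).2 : Clif κ ⊗[ℝ] _)) y ∈ oddClifForm κ _ := by
  have h := mem_oddClifForm_iff.mp (v ((extChartAt (𝓡 n) x₀).symm y)).2.2
  have hn : ∀ t, tensorInv κ _ (TensorProduct.map LinearMap.id
      (ExteriorAlgebra.map (symmVec x₀ y).dualMap).toLinearMap t) =
      TensorProduct.map LinearMap.id
        (ExteriorAlgebra.map (symmVec x₀ y).dualMap).toLinearMap (tensorInv κ _ t) := by
    intro t
    induction t using TensorProduct.induction_on with
    | zero => simp only [map_zero]
    | add s t hs ht => simp only [map_add, hs, ht]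
    | tmul a α =>
      rw [TensorProduct.map_tmul, tensorInv, tensorInv, TensorProduct.map_tmul,
        TensorProduct.map_tmul, TensorProduct.map_tmul]
      exact congrArg _ (map_gradeInv _ α).symm
  refine mem_oddClifForm_iff.mpr ((hn _).trans ?_)
  rw [h, map_neg]
  rfl

variable [IsManifold (𝓡 n) ∞ M]

theorem inChart_op {x₀ : M} {y : EuclideanSpace ℝ (Fin n)}
    (hy : y ∈ (extChartAt (𝓡 n) x₀).target) (P : ∀ x : M, Module.End ℝ (FormAt n κ x))
    (θ : ExtForm n M κ) :
    inChart x₀ (fun x => P x (θ x)) y = opInChart x₀ P y (inChart x₀ θ y) := by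
  rw [opInChart, LinearMap.comp_apply, LinearMap.comp_apply, AlgHom.toLinearMap_apply,
    AlgHom.toLinearMap_apply, inChart_apply, inChart_apply, ofChart_toChart hy]

/-- Writing the symbol as a composite with the change of coordinates puts it in the form required by
naturality of the action. -/
theorem tangentEval_eq {x₀ : M} {y : EuclideanSpace ℝ (Fin n)}
    (hy : y ∈ (extChartAt (𝓡 n) x₀).target) (v : CCFibre n κ ((extChartAt (𝓡 n) x₀).symm y)) :
    tangentEval n _ v.1 =
      Module.Dual.eval ℝ (EuclideanSpace ℝ (Fin n)) (chartVec x₀ _ v.1) ∘ₗ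
        (symmVec x₀ y).dualMap := by
  refine LinearMap.ext fun α => ?_
  exact (congrArg α (symmVec_chartVec hy _)).symm

theorem toChart_act {x₀ : M} {y : EuclideanSpace ℝ (Fin n)}
    (hy : y ∈ (extChartAt (𝓡 n) x₀).target) (v : CCFibre n κ ((extChartAt (𝓡 n) x₀).symm y)) (a) :
    toChart κ x₀ y (act v (ofChart κ x₀ _ a)) = pairAction κ _
      (Module.Dual.eval ℝ (EuclideanSpace ℝ (Fin n)) (chartVec x₀ _ v.1),
       TensorProduct.map LinearMap.id (ExteriorAlgebra.map (symmVec x₀ y).dualMap).toLinearMap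
        v.2.1) a := by
  rw [act_eq_pairAction, tangentEval_eq hy]
  exact (formMap_pairAction (symmVec x₀ y).dualMap
    (Module.Dual.eval ℝ (EuclideanSpace ℝ (Fin n)) (chartVec x₀ _ v.1))
    v.2.1 (ofChart κ x₀ _ a)).trans
    (congrArg (pairAction κ _ (Module.Dual.eval ℝ (EuclideanSpace ℝ (Fin n)) (chartVec x₀ _ v.1),
       TensorProduct.map LinearMap.id (ExteriorAlgebra.map (symmVec x₀ y).dualMap).toLinearMap
        v.2.1)) (toChart_ofChart hy a))

theorem opInChart_act {x₀ : M} {y : EuclideanSpace ℝ (Fin n)}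
    (hy : y ∈ (extChartAt (𝓡 n) x₀).target) (v : ∀ x : M, CCFibre n κ x) :
    opInChart x₀ (fun x => act (v x)) y = pairAction κ _
      (Module.Dual.eval ℝ (EuclideanSpace ℝ (Fin n))
          (chartVec x₀ _ (v ((extChartAt (𝓡 n) x₀).symm y)).1),
        clifInChart x₀ (fun x => ((v x).2 : Clif κ ⊗[ℝ] _)) y) := by
  refine LinearMap.ext fun a => ?_
  exact toChart_act hy (v ((extChartAt (𝓡 n) x₀).symm y)) a

/-- On fibres the trivialisation of the tangent bundle at `x₀` is the derivative of the preferred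
chart, so smoothness of a vector field is smoothness of its components there. -/
theorem contMDiff_tangent_iff (X : ∀ x : M, TangentSpace (𝓡 n) x) :
    ContMDiff (𝓡 n) (𝓡 n).tangent ∞ (fun x => (⟨x, X x⟩ : TangentBundle (𝓡 n) M)) ↔
      ∀ x₀ : M, ContDiffOn ℝ ∞
        (fun y => chartVec x₀ ((extChartAt (𝓡 n) x₀).symm y) (X ((extChartAt (𝓡 n) x₀).symm y)))
        (extChartAt (𝓡 n) x₀).target := by
  have : IsManifold (𝓡 n) 1 M := IsManifold.of_le (n := ∞) (by simp)
  have hkey : ∀ x₀ : M, ContMDiffOn (𝓡 n) (𝓡 n).tangent ∞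
      (fun x => (⟨x, X x⟩ : TangentBundle (𝓡 n) M)) (chartAt (EuclideanSpace ℝ (Fin n)) x₀).source ↔
      ContDiffOn ℝ ∞
        (fun y => chartVec x₀ ((extChartAt (𝓡 n) x₀).symm y) (X ((extChartAt (𝓡 n) x₀).symm y)))
        (extChartAt (𝓡 n) x₀).target := by
    intro x₀
    have h1 := (trivializationAt (EuclideanSpace ℝ (Fin n)) (TangentSpace (𝓡 n))
      x₀).contMDiffOn_section_baseSet_iff (IB := 𝓡 n) (n := ∞) (s := X)
    rw [TangentBundle.trivializationAt_baseSet] at h1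
    refine h1.trans ?_
    have h2 : ∀ x ∈ (chartAt (EuclideanSpace ℝ (Fin n)) x₀).source,
        (trivializationAt (EuclideanSpace ℝ (Fin n)) (TangentSpace (𝓡 n)) x₀ ⟨x, X x⟩).2 =
          chartVec x₀ x (X x) := by
      intro x hx
      have h3 := DFunLike.congr_fun
        (TangentBundle.continuousLinearMapAt_trivializationAt (I := 𝓡 n) hx) (X x)
      have hx' : x ∈ (trivializationAt (EuclideanSpace ℝ (Fin n))
          (TangentSpace (𝓡 n)) x₀).baseSet := by
        rwa [TangentBundle.trivializationAt_baseSet]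
      exact ((trivializationAt (EuclideanSpace ℝ (Fin n)) (TangentSpace (𝓡 n))
        x₀).continuousLinearMapAt_apply_of_mem (R := ℝ) hx' (X x)).symm.trans h3
    refine (contMDiffOn_congr h2).trans ⟨fun h => ?_, fun h => ?_⟩
    · refine contMDiffOn_iff_contDiffOn.mp (h.comp (contMDiffOn_extChartAt_symm x₀) fun y hy => ?_)
      rw [← extChartAt_source (𝓡 n)]
      exact (extChartAt (𝓡 n) x₀).map_target hy
    · have h4 := (contMDiffOn_iff_contDiffOn.mpr h).comp
        (contMDiffOn_extChartAt (I := 𝓡 n) (x := x₀) (n := ∞)) (fun x hx => by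
          rw [← extChartAt_source (𝓡 n)] at hx
          exact (extChartAt (𝓡 n) x₀).map_source hx)
      refine h4.congr fun x hx => ?_
      rw [← extChartAt_source (𝓡 n)] at hx
      exact congrArg (fun z => chartVec x₀ z (X z)) ((extChartAt (𝓡 n) x₀).left_inv hx).symm
  refine ⟨fun h x₀ => (hkey x₀).mp h.contMDiffOn, fun h x => ?_⟩
  exact ((hkey x).mpr (h x)).contMDiffAt
    ((chartAt (EuclideanSpace ℝ (Fin n)) x).open_source.mem_nhds (mem_chart_source _ x))

/-- A section of `C_{⟨κ⟩}` is smooth if and only if the operators by which it acts are. -/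
theorem smoothSection_iff [Fintype κ] [DecidableEq κ] (v : ∀ x : M, CCFibre n κ x) :
    SmoothSection v ↔ ∀ x₀ : M, SmoothComponentsOn (opInChart x₀ fun x => act (v x))
      (extChartAt (𝓡 n) x₀).target := by
  -- In coordinates the action is one fixed linear map, injective on the odd part; a linear left
  -- inverse recovers the components of a section from its operators.
  let L : EuclideanSpace ℝ (Fin n) × oddClifForm κ (Module.Dual ℝ (EuclideanSpace ℝ (Fin n))) →ₗ[ℝ]
      Module.End ℝ (ExteriorAlgebra ℝ ((κ → ℝ) × Module.Dual ℝ (EuclideanSpace ℝ (Fin n)))) :=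
    pairAction κ _ ∘ₗ LinearMap.prodMap (Module.Dual.eval ℝ (EuclideanSpace ℝ (Fin n))) (Submodule.subtype _)
  have hL : Function.Injective L := by
    intro a b h
    obtain ⟨h1, h2⟩ := pairAction_injective a.2.2 b.2.2 h
    exact Prod.ext ((Module.evalEquiv ℝ (EuclideanSpace ℝ (Fin n))).injective h1) (Subtype.ext h2)
  rw [SmoothSection, contMDiff_tangent_iff, ← forall_and]
  refine forall_congr' fun x₀ => ⟨fun ⟨h1, h2⟩ => ?_, fun h => ?_⟩
  · refine SmoothComponentsOn.congr (SmoothComponentsOn.linear (W := Module.Dual ℝ (Module.Dual ℝ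
      (EuclideanSpace ℝ (Fin n))) × (Clif κ ⊗[ℝ] ExteriorAlgebra ℝ (Module.Dual ℝ
        (EuclideanSpace ℝ (Fin n))))) ?_ (pairAction κ _)) fun y hy => opInChart_act hy v
    have h3 := ((SmoothComponentsOn.of_contDiffOn h1).linear (Module.Dual.eval ℝ (EuclideanSpace ℝ (Fin n)))).linear
      (LinearMap.inl ℝ _ (Clif κ ⊗[ℝ] ExteriorAlgebra ℝ (Module.Dual ℝ
        (EuclideanSpace ℝ (Fin n)))))
    have h4 := h2.linear (LinearMap.inr ℝ (Module.Dual ℝ (Module.Dual ℝ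
      (EuclideanSpace ℝ (Fin n)))) _)
    refine (h3.add h4).congr fun y _ => ?_
    simp
  · have h3 : SmoothComponentsOn (fun y =>
        ((chartVec x₀ _ (v ((extChartAt (𝓡 n) x₀).symm y)).1,
          ⟨clifInChart x₀ (fun x => ((v x).2 : Clif κ ⊗[ℝ] _)) y, clifInChart_mem x₀ v y⟩) :
            EuclideanSpace ℝ (Fin n) × oddClifForm κ (Module.Dual ℝ (EuclideanSpace ℝ (Fin n)))))
        (extChartAt (𝓡 n) x₀).target :=
      .of_injective L hL (h.congr fun y hy => (opInChart_act hy v).symm)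
    exact ⟨(h3.linear (LinearMap.fst ℝ _ _)).contDiffOn,
      h3.linear (Submodule.subtype _ ∘ₗ LinearMap.snd ℝ _ _)⟩

theorem SmoothForm.actSection [Fintype κ] [DecidableEq κ] {v : ∀ x : M, CCFibre n κ x}
    (hv : SmoothSection v) {φ : ExtForm n M κ} (hφ : SmoothForm φ) :
    SmoothForm (actSection v φ) := fun x₀ =>
  (((smoothSection_iff v).mp hv x₀).apply (hφ x₀)).congr fun _ hy =>
    inChart_op hy (fun x => act (v x)) φ

/-- A section is smooth if it maps smooth forms to smooth forms. -/
theorem smoothSection_of_actSection [T2Space M] [Fintype κ] [DecidableEq κ]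
    {v : ∀ x : M, CCFibre n κ x}
    (h : ∀ φ : ExtForm n M κ, SmoothForm φ → SmoothForm (actSection v φ)) : SmoothSection v := by
  refine (smoothSection_iff v).mpr fun x₀ => .of_apply fun a => .of_locally fun y hy => ?_
  -- Near the given point `φ` has the constant expression `a`, so the operators applied to `a` are
  -- the chart expression of a smooth form.
  obtain ⟨φ, hφ, hy'⟩ := exists_smoothForm_inChart_eq x₀ hy a
  obtain ⟨u, hu, ho, hyu⟩ := eventually_nhds_iff.mp hy'
  refine ⟨u, ho, hyu, ((h φ hφ x₀).mono Set.inter_subset_left).congr fun z hz => ?_⟩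
  rw [← hu z hz.2]
  exact (inChart_op hz.1 (fun x => act (v x)) φ).symm

end Sections

/-! ### Commutators that preserve Clifford operators -/

section Commutators

variable {κ : Type} {W W' : Type*} [AddCommGroup W] [Module ℝ W] [AddCommGroup W'] [Module ℝ W']

/-- The commutator of a Clifford operator with an even operator whose commutators with exterior
products with elements of `W` are again such products. -/
theorem IsCliffordOp.commutator {P R : Module.End ℝ (ExteriorAlgebra ℝ ((κ → ℝ) × W))}
    {X : Module.Dual ℝ W} (hP : IsCliffordOp P X) (hR : conj R = R) {β : W →ₗ[ℝ] W}
    (h : ∀ α x, R (basicι κ α * x) = basicι κ α * R x - basicι κ (β α) * x) :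
    IsCliffordOp (R * P - P * R) (X ∘ₗ β) where
  odd := by
    rw [conj_sub, conj_mul, conj_mul, hP.odd, hR]
    refine LinearMap.ext fun x => ?_
    simp only [LinearMap.sub_apply, LinearMap.neg_apply, Module.End.mul_apply, map_neg]
    abel
  anticomm α x := by
    simp only [LinearMap.sub_apply, Module.End.mul_apply, hP.anticomm, h, map_sub, map_smul,
      mul_sub, LinearMap.comp_apply]
    abel

/-- The commutator of `e ∧ P` with `α` is `X α` times `e`, again a covector. This is the hypothesis
of `IsCliffordOp.commutator` for the terms `dyʲ ∧ ∂ⱼV` of the bracket. -/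
theorem IsCliffordOp.basicι_mul {P : Module.End ℝ (ExteriorAlgebra ℝ ((κ → ℝ) × W))}
    {X : Module.Dual ℝ W} (hP : IsCliffordOp P X) (e α : W)
    (x : ExteriorAlgebra ℝ ((κ → ℝ) × W)) :
    (LinearMap.mulLeft ℝ (basicι κ e) * P) (basicι κ α * x) =
      basicι κ α * (LinearMap.mulLeft ℝ (basicι κ e) * P) x -
        basicι κ (-X.smulRight e α) * x := by
  have h : basicι κ (-X.smulRight e α) = -(X α • basicι κ e) := by
    rw [basicι_eq, map_neg, LinearMap.smulRight_apply, map_smul]; rfl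
  rw [h, Module.End.mul_apply, Module.End.mul_apply, LinearMap.mulLeft_apply,
    LinearMap.mulLeft_apply, hP.anticomm, mul_sub, ← mul_assoc, ← mul_assoc, basicι_anticomm e α,
    neg_mul, neg_mul, mul_smul_comm, smul_mul_assoc, sub_neg_eq_add, sub_neg_eq_add, add_comm]

/-- The terms with `X α` cancel between the two products, so the anticommutator is linear over basic
forms. -/
theorem IsCliffordOp.anticommutator_basicι {P B : Module.End ℝ (ExteriorAlgebra ℝ ((κ → ℝ) × W))}
    {X : Module.Dual ℝ W} (hP : IsCliffordOp P X)
    (hB : ∀ α x, B (basicι κ α * x) = -(basicι κ α * B x)) (α : W)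
    (x : ExteriorAlgebra ℝ ((κ → ℝ) × W)) :
    (P * B + B * P) (basicι κ α * x) = basicι κ α * (P * B + B * P) x := by
  simp only [LinearMap.add_apply, Module.End.mul_apply, hB, hP.anticomm, map_neg, map_sub,
    map_smul, mul_add]
  abel

/-- Clifford operators form a linear space. -/
def cliffordOps (κ : Type) (W : Type*) [AddCommGroup W] [Module ℝ W] :
    Submodule ℝ (Module.End ℝ (ExteriorAlgebra ℝ ((κ → ℝ) × W))) where
  carrier := {P | ∃ X, IsCliffordOp P X}
  add_mem' := fun ⟨X, hP⟩ ⟨Y, hR⟩ => ⟨X + Y, hP.add hR⟩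
  zero_mem' := ⟨0, .zero⟩
  smul_mem' := fun r _ ⟨X, hP⟩ => ⟨r • X, hP.smul r⟩

theorem IsCliffordOp.formMap_conj {P : Module.End ℝ (ExteriorAlgebra ℝ ((κ → ℝ) × W))}
    {X : Module.Dual ℝ W} (hP : IsCliffordOp P X) {f : W →ₗ[ℝ] W'} {g : W' →ₗ[ℝ] W}
    (hfg : f ∘ₗ g = LinearMap.id) :
    IsCliffordOp ((formMap κ f).toLinearMap ∘ₗ P ∘ₗ (formMap κ g).toLinearMap) (X ∘ₗ g) where
  odd := by
    refine LinearMap.ext fun x => ?_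
    have h := LinearMap.congr_fun hP.odd (formMap κ g x)
    rw [conj_apply, LinearMap.neg_apply] at h
    rw [conj_apply]
    simp only [LinearMap.comp_apply, AlgHom.toLinearMap_apply, LinearMap.neg_apply]
    rw [formMap_gradeInv, ← formMap_gradeInv, h, map_neg]
  anticomm α x := by
    simp only [LinearMap.comp_apply, AlgHom.toLinearMap_apply, map_mul, formMap_basicι,
      hP.anticomm, map_sub, map_smul, formMap_formMap, hfg, formMap_id, AlgHom.id_apply]
    rw [← LinearMap.comp_apply f g, hfg, LinearMap.id_apply]

end Commutators

/-! ### The bracket on Euclidean space -/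

section ModelBracket

variable {n : ℕ} {κ : Type} [Finite κ]

local notation "𝔼" n => EuclideanSpace ℝ (Fin n)
local notation "𝔸[" κ "," n "]" =>
  ExteriorAlgebra ℝ ((κ → ℝ) × Module.Dual ℝ (EuclideanSpace ℝ (Fin n)))

/-- The operator `{{V, d + B}, W}` at a point, for Clifford operators `V` with symbol `X` and
`W`. -/
def bracketOp (V W : (𝔼 n) → Module.End ℝ 𝔸[κ, n]) (B : Module.End ℝ 𝔸[κ, n])
    (X : Module.Dual ℝ (Module.Dual ℝ (𝔼 n))) (y : 𝔼 n) : Module.End ℝ 𝔸[κ, n] :=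
  ∑ j, X (coordForm n j) • directionalDeriv W y (EuclideanSpace.single j 1) +
  ∑ j, ((LinearMap.mulLeft ℝ (basicι κ (coordForm n j)) *
    directionalDeriv V y (EuclideanSpace.single j 1)) * W y -
    W y * (LinearMap.mulLeft ℝ (basicι κ (coordForm n j)) *
      directionalDeriv V y (EuclideanSpace.single j 1))) +
  ((V y * B + B * V y) * W y - W y * (V y * B + B * V y))

/-- Clifford operators form a linear subspace, and derivatives of functions with values in a
subspace stay in it. -/
theorem isCliffordOp_directionalDeriv {V : (𝔼 n) → Module.End ℝ 𝔸[κ, n]} {s : Set (𝔼 n)}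
    (hs : IsOpen s) (hV : SmoothComponentsOn V s) (hX : ∀ z ∈ s, ∃ X, IsCliffordOp (V z) X)
    {y : 𝔼 n} (hy : y ∈ s) (e : 𝔼 n) : ∃ X, IsCliffordOp (directionalDeriv V y e) X :=
  directionalDeriv_mem (S := cliffordOps κ (Module.Dual ℝ (𝔼 n))) (hV.hasDerivComponents hs hy)
    (by filter_upwards [hs.mem_nhds hy] with z hz using hX z hz) e

/-- Each of the three groups of terms is of this kind: derivatives of `W`, commutators of `W` with
`dyʲ ∧ ∂ⱼV`, and the commutator of `W` with `{V, B}`, which is linear over basic forms. -/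
theorem isCliffordOp_bracketOp {V W : (𝔼 n) → Module.End ℝ 𝔸[κ, n]} {s : Set (𝔼 n)}
    (hs : IsOpen s) (hV : SmoothComponentsOn V s) (hW : SmoothComponentsOn W s)
    (hVX : ∀ z ∈ s, ∃ X, IsCliffordOp (V z) X) (hWX : ∀ z ∈ s, ∃ X, IsCliffordOp (W z) X)
    {B : Module.End ℝ 𝔸[κ, n]} (hB : conj B = -B)
    (hB' : ∀ α x, B (basicι κ α * x) = -(basicι κ α * B x))
    (X : Module.Dual ℝ (Module.Dual ℝ (𝔼 n))) {y : 𝔼 n} (hy : y ∈ s) :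
    ∃ Y, IsCliffordOp (bracketOp V W B X y) Y := by
  obtain ⟨XV, hV0⟩ := hVX y hy
  obtain ⟨XW, hW0⟩ := hWX y hy
  choose Xw hw using fun j => isCliffordOp_directionalDeriv hs hW hWX hy
    (EuclideanSpace.single j 1)
  choose Xv hv using fun j => isCliffordOp_directionalDeriv hs hV hVX hy
    (EuclideanSpace.single j 1)
  refine ⟨_, ((IsCliffordOp.sum Finset.univ fun j => (hw j).smul (X (coordForm n j))).add
    (IsCliffordOp.sum Finset.univ fun j => hW0.commutator (β := -(Xv j).smulRight (coordForm n j))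
      ?_ ?_)).add (hW0.commutator (β := 0) ?_ ?_)⟩
  · rw [conj_mul, conj_mulLeft_basicι, (hv j).odd]
    refine LinearMap.ext fun x => ?_
    simp only [Module.End.mul_apply, LinearMap.neg_apply, map_neg, neg_neg]
  · exact (hv j).basicι_mul (coordForm n j)
  · rw [conj_add, conj_mul, conj_mul, hV0.odd, hB]
    refine LinearMap.ext fun x => ?_
    simp only [Module.End.mul_apply, LinearMap.neg_apply, LinearMap.add_apply, map_neg, neg_neg]
  · intro α x
    have h0 : basicι κ (0 : Module.Dual ℝ (𝔼 n)) = 0 := by rw [basicι_eq, map_zero]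
    rw [hV0.anticommutator_basicι hB', LinearMap.zero_apply, h0, zero_mul, sub_zero]

/-- A Cartan formula: since `V` anticommutes with `dyʲ` up to `X (dyʲ)`, the operator `{V, d}` is
the derivative along `X` plus the sum of the `dyʲ ∧ ∂ⱼV`. In the commutator with `W` the derivatives
of `f` cancel. -/
theorem bracketOp_apply {V W : (𝔼 n) → Module.End ℝ 𝔸[κ, n]} {s : Set (𝔼 n)}
    (hs : IsOpen s) (hV : SmoothComponentsOn V s) (hW : SmoothComponentsOn W s)
    {f : (𝔼 n) → 𝔸[κ, n]} (hf : SmoothComponentsOn f s) (B : Module.End ℝ 𝔸[κ, n]) {y : 𝔼 n}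
    (hy : y ∈ s) {X : Module.Dual ℝ (Module.Dual ℝ (𝔼 n))} (hX : IsCliffordOp (V y) X) :
    bracketOp V W B X y (f y) =
      V y (modelExtDeriv (fun z => W z (f z)) y + B (W y (f y))) +
        (modelExtDeriv (fun z => V z (W z (f z))) y + B (V y (W y (f y)))) -
      W y (V y (modelExtDeriv f y + B (f y)) +
        (modelExtDeriv (fun z => V z (f z)) y + B (V y (f y)))) := by
  have hWf := hW.apply hf
  have dV := hV.hasDerivComponents hs hy
  have dW := hW.hasDerivComponents hs hy
  have df := hf.hasDerivComponents hs hy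
  simp only [modelExtDeriv_apply, directionalDeriv_apply dW df, directionalDeriv_apply dV df,
    directionalDeriv_apply dV (hWf.hasDerivComponents hs hy), bracketOp, map_add, map_sum, mul_add,
    hX.anticomm, LinearMap.add_apply, LinearMap.sub_apply, LinearMap.coe_sum, Finset.sum_apply,
    LinearMap.smul_apply, Module.End.mul_apply, LinearMap.mulLeft_apply, Finset.sum_add_distrib,
    Finset.sum_sub_distrib, map_sub, map_smul]
  abel

end ModelBracket

/-! ### Existence and uniqueness of brackets -/

section Bracket

variable {n : ℕ} {M : Type*} [TopologicalSpace M] [ChartedSpace (EuclideanSpace ℝ (Fin n)) M]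
  {κ : Type} [Fintype κ]

/-- The operator of order zero `∑ₖ cₖ ∧ ∂ₖ + H ∧`. -/
def zerothOrder {W : Type*} [AddCommGroup W] [Module ℝ W]
    (c : κ → ExteriorAlgebra ℝ ((κ → ℝ) × W)) (H : ExteriorAlgebra ℝ ((κ → ℝ) × W)) :
    Module.End ℝ (ExteriorAlgebra ℝ ((κ → ℝ) × W)) :=
  ∑ k, LinearMap.mulLeft ℝ (c k) * contractGenerator k + LinearMap.mulLeft ℝ H

theorem zerothOrder_apply {W : Type*} [AddCommGroup W] [Module ℝ W]
    (c : κ → ExteriorAlgebra ℝ ((κ → ℝ) × W)) (H x : ExteriorAlgebra ℝ ((κ → ℝ) × W)) :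
    zerothOrder c H x = ∑ k, c k * contractGenerator k x + H * x := by
  simp only [zerothOrder, LinearMap.add_apply, LinearMap.coe_sum, Finset.sum_apply,
    Module.End.mul_apply, LinearMap.mulLeft_apply]

theorem conj_zerothOrder {W : Type*} [AddCommGroup W] [Module ℝ W]
    {c : κ → ExteriorAlgebra ℝ ((κ → ℝ) × W)} {H : ExteriorAlgebra ℝ ((κ → ℝ) × W)}
    (hc : ∀ k, gradeInv (c k) = c k) (hH : gradeInv H = -H) :
    conj (zerothOrder c H) = -zerothOrder c H := by
  refine LinearMap.ext fun x => ?_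
  rw [conj_apply, LinearMap.neg_apply, zerothOrder_apply, zerothOrder_apply, map_add, map_sum,
    neg_add, ← Finset.sum_neg_distrib]
  simp only [map_mul, hc, hH, contractGenerator_gradeInv, map_neg, gradeInv_gradeInv, mul_neg,
    neg_mul]

/-- The `cₖ` are even while `∂ₖ` and `H` are odd, so every term anticommutes with one-forms on the
base. -/
theorem zerothOrder_basicι_mul {W : Type*} [AddCommGroup W] [Module ℝ W]
    {c : κ → ExteriorAlgebra ℝ ((κ → ℝ) × W)} {H : ExteriorAlgebra ℝ ((κ → ℝ) × W)}
    (hc : ∀ k, gradeInv (c k) = c k) (hH : gradeInv H = -H) (α : W)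
    (x : ExteriorAlgebra ℝ ((κ → ℝ) × W)) :
    zerothOrder c H (basicι κ α * x) = -(basicι κ α * zerothOrder c H x) := by
  have h1 : ∀ k, contractGenerator k (basicι κ α * x) = -(basicι κ α * contractGenerator k x) := by
    intro k
    refine (contract_ι_mul _ _ _).trans ?_
    have : (LinearMap.proj k ∘ₗ LinearMap.fst ℝ (κ → ℝ) W) ((0, α) : (κ → ℝ) × W) = 0 := rfl
    rw [this, zero_smul, zero_sub]
    rfl
  have h2 : H * basicι κ α = -(basicι κ α * H) := by
    have := ι_mul_gradeInv ((0, α) : (κ → ℝ) × W) H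
    rw [hH, mul_neg] at this
    exact this.symm
  rw [zerothOrder_apply, zerothOrder_apply, mul_add, neg_add, Finset.mul_sum,
    ← Finset.sum_neg_distrib, ← mul_assoc, h2, neg_mul, mul_assoc]
  congr 1
  refine Finset.sum_congr rfl fun k _ => ?_
  rw [h1, mul_neg, ← mul_assoc, even_comm (hc k), mul_assoc]

variable [IsManifold (𝓡 n) ∞ M]

theorem inChart_twistedDeriv {c : κ → Form n M} {H φ : ExtForm n M κ} (hφ : SmoothForm φ) {x₀ : M}
    {y : EuclideanSpace ℝ (Fin n)} (hy : y ∈ (extChartAt (𝓡 n) x₀).target) :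
    inChart x₀ (twistedDeriv c H φ) y = modelExtDeriv (inChart x₀ φ) y +
      zerothOrder (fun k => inChart x₀ (baseForm κ (c k)) y) (inChart x₀ H y)
        (inChart x₀ φ y) := by
  rw [zerothOrder_apply, ← inChart_extDeriv hφ hy, inChart_apply, twistedDeriv, totalDeriv, map_add,
    map_add, map_sum, add_assoc]
  simp only [map_mul, inChart_apply]
  congr 2
  refine Finset.sum_congr rfl fun k _ => ?_
  congr 1
  exact formMap_contractGenerator _ k _

variable [DecidableEq κ]

theorem exists_act_eq_derivedBracket {c : κ → Form n M} {H : ExtForm n M κ}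
    (hc : ∀ k x, gradeInv (c k x) = c k x) (hH : ∀ x, gradeInv (H x) = -H x)
    {v w : ∀ x : M, CCFibre n κ x} (hv : SmoothSection v) (hw : SmoothSection w) (x : M) :
    ∃ u : CCFibre n κ x, ∀ φ : ExtForm n M κ, SmoothForm φ →
      act u (φ x) = derivedBracket (actSection v) (twistedDeriv c H) (actSection w) φ x := by
  -- The claim is proved at points written as images of the inverse chart, where the maps `toChart`
  -- and `ofChart` have the right types; `x` is such a point.
  suffices h : ∀ (y : EuclideanSpace ℝ (Fin n)), y ∈ (extChartAt (𝓡 n) x).target →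
      ∃ u : CCFibre n κ ((extChartAt (𝓡 n) x).symm y), ∀ φ : ExtForm n M κ, SmoothForm φ →
        act u (φ ((extChartAt (𝓡 n) x).symm y)) =
          derivedBracket (actSection v) (twistedDeriv c H) (actSection w) φ
            ((extChartAt (𝓡 n) x).symm y) by
    have hx := mem_extChartAt_source (I := 𝓡 n) x
    have := h _ ((extChartAt (𝓡 n) x).map_source hx)
    rwa [(extChartAt (𝓡 n) x).left_inv hx] at this
  intro y hy
  have hs := isOpen_chart_target (n := n) x
  set V := opInChart x fun x => act (v x) with hVdef
  set Z := opInChart x fun x => act (w x) with hZdef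
  have hV := (smoothSection_iff v).mp hv x
  have hZ := (smoothSection_iff w).mp hw x
  have hcl : ∀ v : ∀ x : M, CCFibre n κ x, ∀ z ∈ (extChartAt (𝓡 n) x).target,
      ∃ X, IsCliffordOp (opInChart x (fun x => act (v x)) z) X := fun v z hz => by
    rw [opInChart_act hz]
    exact ⟨_, isCliffordOp_pairAction _ (clifInChart_mem x v z)⟩
  obtain ⟨X, hX⟩ := hcl v y hy
  set B := zerothOrder (fun k => inChart x (baseForm κ (c k)) y) (inChart x H y) with hBdef
  have hc' : ∀ k, gradeInv (inChart x (baseForm κ (c k)) y) = inChart x (baseForm κ (c k)) y := by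
    intro k
    rw [inChart_baseForm, ← map_gradeInv, inChart_apply, toChart, ← formMap_gradeInv, hc]
  have hH' : gradeInv (inChart x H y) = -inChart x H y := by
    rw [inChart_apply, toChart, ← formMap_gradeInv, hH, map_neg]
  obtain ⟨Y, hY⟩ := isCliffordOp_bracketOp hs hV hZ (hcl v) (hcl w) (conj_zerothOrder hc' hH')
    (zerothOrder_basicι_mul hc' hH') X hy
  have hfg : (chartVec x ((extChartAt (𝓡 n) x).symm y)).dualMap ∘ₗ (symmVec x y).dualMap =
      LinearMap.id := LinearMap.ext fun α => LinearMap.ext fun v =>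
    congrArg α (symmVec_chartVec hy v)
  -- The model operator is carried back to the fibre by the derivative of the chart, which preserves
  -- Clifford operators, and is then the action of an element.
  obtain ⟨u, hu, -⟩ := exists_act_eq (hY.formMap_conj hfg)
  refine ⟨u, fun φ hφ => ?_⟩
  have hwφ := SmoothForm.actSection hw hφ
  have hvφ := SmoothForm.actSection hv hφ
  have hvwφ := SmoothForm.actSection hv hwφ
  have e1 : ∀ (v : ∀ x : M, CCFibre n κ x) (φ : ExtForm n M κ),
      ∀ z ∈ (extChartAt (𝓡 n) x).target, inChart x (actSection v φ) z =
        opInChart x (fun x => act (v x)) z (inChart x φ z) := fun v φ z hz =>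
    inChart_op hz (fun x => act (v x)) φ
  have e2 : ∀ (v : ∀ x : M, CCFibre n κ x) (φ : ExtForm n M κ),
      inChart x (actSection v φ) =ᶠ[nhds y] fun z =>
        opInChart x (fun x => act (v x)) z (inChart x φ z) := fun v φ => by
    filter_upwards [hs.mem_nhds hy] with z hz using e1 v φ z hz
  have e3 : inChart x (actSection v (actSection w φ)) =ᶠ[nhds y] fun z =>
      V z (Z z (inChart x φ z)) := by
    filter_upwards [hs.mem_nhds hy] with z hz
    rw [e1 _ _ z hz, e1 _ _ z hz]
  have key : inChart x (derivedBracket (actSection v) (twistedDeriv c H) (actSection w) φ) y =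
      bracketOp V Z B X y (inChart x φ y) := by
    rw [bracketOp_apply hs hV hZ (hφ x) B hy hX, ← modelExtDeriv_congr (e2 w φ),
      ← modelExtDeriv_congr (e2 v φ), ← modelExtDeriv_congr e3]
    have e4 : ∀ θ η : ExtForm n M κ, inChart x (θ + η) y = inChart x θ y + inChart x η y :=
      fun θ η => map_add (toChart κ x y) _ _
    have e5 : ∀ θ η : ExtForm n M κ, inChart x (θ - η) y = inChart x θ y - inChart x η y :=
      fun θ η => map_sub (toChart κ x y) _ _
    rw [derivedBracket, e5, e4, e1 _ _ y hy, e1 w _ y hy, e4, e1 v _ y hy,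
      inChart_twistedDeriv hwφ hy, inChart_twistedDeriv hvwφ hy, inChart_twistedDeriv hφ hy,
      inChart_twistedDeriv hvφ hy, e1 v _ y hy, e1 w _ y hy, e1 v _ y hy]
  have h1 := congrArg (ofChart κ x ((extChartAt (𝓡 n) x).symm y)) key
  rw [inChart_apply, ofChart_toChart hy] at h1
  rw [h1, hu]
  rfl

/-- The brackets of a Clifford–Courant algebroid are well defined. -/
theorem existsUnique_isBracket [T2Space M] {c : κ → Form n M} {H : ExtForm n M κ}
    (hc : ∀ k x, gradeInv (c k x) = c k x) (hH : ∀ x, gradeInv (H x) = -H x)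
    (hcs : ∀ k, SmoothForm (c k)) (hHs : SmoothForm H)
    {v w : ∀ x : M, CCFibre n κ x} (hv : SmoothSection v) (hw : SmoothSection w) :
    ∃! u, IsBracket c H v w u := by
  choose u hu using exists_act_eq_derivedBracket hc hH hv hw
  have hu' : ∀ φ : ExtForm n M κ, SmoothForm φ →
      actSection u φ = derivedBracket (actSection v) (twistedDeriv c H) (actSection w) φ :=
    fun φ hφ => funext fun x => hu x φ hφ
  refine ⟨u, ⟨smoothSection_of_actSection fun φ hφ => ?_, hu'⟩, fun u' hu'' => ?_⟩
  · have hwφ := SmoothForm.actSection hw hφ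
    have hvφ := SmoothForm.actSection hv hφ
    rw [hu' φ hφ]
    exact .sub (.add (.actSection hv (.twistedDeriv hcs hHs hwφ))
      (.twistedDeriv hcs hHs (.actSection hv hwφ)))
      (.actSection hw (.add (.actSection hv (.twistedDeriv hcs hHs hφ))
        (.twistedDeriv hcs hHs hvφ)))
  · refine funext fun x => act_injective (LinearMap.ext fun a => ?_)
    obtain ⟨φ, hφ, rfl⟩ := exists_smoothForm_apply_eq x a
    exact congrFun ((hu''.2 φ hφ).trans (hu' φ hφ).symm) x

end Bracket

/-! ### Conjugation of Clifford operators and the algebra of `τ_K` -/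

section TauAlgebra

theorem exteriorPower_le_evenPart {W : Type*} [AddCommGroup W] [Module ℝ W] {d : ℕ} (hd : Even d) :
    ⋀[ℝ]^d W ≤ evenPart W := by
  have h : ((d : ℕ) : ZMod 2) = 0 := (ZMod.natCast_eq_zero_iff_even).mpr hd
  exact le_iSup (fun j : { k : ℕ // (k : ZMod 2) = 0 } =>
    LinearMap.range (CliffordAlgebra.ι (0 : QuadraticForm ℝ W)) ^ (j : ℕ)) ⟨d, h⟩

/-- The sign `r` enters once with `e` and once with its inverse, so conjugation preserves parity
even if `e` is odd. Linearity over `W` keeps the symbol. -/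
theorem IsCliffordOp.conj_equiv {κ κ' : Type} {W : Type*} [AddCommGroup W] [Module ℝ W]
    {P : Module.End ℝ (ExteriorAlgebra ℝ ((κ → ℝ) × W))} {X : Module.Dual ℝ W}
    (hP : IsCliffordOp P X)
    (e : ExteriorAlgebra ℝ ((κ → ℝ) × W) ≃ₗ[ℝ] ExteriorAlgebra ℝ ((κ' → ℝ) × W)) {r : ℝ}
    (hr : r * r = 1) (he : ∀ x, e (gradeInv x) = r • gradeInv (e x))
    (hα : ∀ α x, e (basicι κ α * x) = basicι κ' α * e x) :
    IsCliffordOp (e.toLinearMap ∘ₗ P ∘ₗ e.symm.toLinearMap) X where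
  odd := by
    refine LinearMap.ext fun x => ?_
    obtain ⟨z, rfl⟩ := e.surjective x
    have h1 : gradeInv (e z) = r • e (gradeInv z) := by rw [he, smul_smul, hr, one_smul]
    have h2 : P (gradeInv z) = -gradeInv (P z) := by
      have h := LinearMap.congr_fun hP.odd (gradeInv z)
      rw [conj_apply, gradeInv_gradeInv, LinearMap.neg_apply] at h
      rw [h, neg_neg]
    rw [conj_apply, LinearMap.neg_apply]
    simp only [LinearMap.comp_apply, LinearEquiv.coe_coe, LinearEquiv.symm_apply_apply, h1,
      map_smul, h2, map_neg]
    rw [he, smul_neg, map_smul, gradeInv_gradeInv, smul_smul, hr, one_smul]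
  anticomm α x := by
    obtain ⟨z, rfl⟩ := e.surjective x
    rw [← hα]
    simp only [LinearMap.comp_apply, LinearEquiv.coe_coe, LinearEquiv.symm_apply_apply,
      hP.anticomm, map_sub, map_smul]
    rw [hα]

variable {N N' : ℕ} {W W' : Type*} [AddCommGroup W] [Module ℝ W] [AddCommGroup W'] [Module ℝ W']

theorem basicDegreeZero_formMap {κ : Type} (f : W →ₗ[ℝ] W')
    (K : ExteriorAlgebra ℝ ((κ → ℝ) × W)) :
    basicDegreeZero (formMap κ f K) = basicDegreeZero K := formMap_formMap 0 f K

/-- The pointwise content of the compatibility of `τ_K` with the twisted differentials. -/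
theorem tau_intertwines [Module.Finite ℝ W] {K : ExteriorAlgebra ℝ ((Fin N ⊕ Fin N' → ℝ) × W)}
    (hK : gradeInv K = K) (c : Fin N → ExteriorAlgebra ℝ W) (c' : Fin N' → ExteriorAlgebra ℝ W)
    (H : ExteriorAlgebra ℝ ((Fin N → ℝ) × W)) (H' : ExteriorAlgebra ℝ ((Fin N' → ℝ) × W))
    {dK : ExteriorAlgebra ℝ ((Fin N ⊕ Fin N' → ℝ) × W)}
    (hdK : dK + (∑ i, basicIncl _ W (c i) * contractGenerator (Sum.inl i) K +
      ∑ j, basicIncl _ W (c' j) * contractGenerator (Sum.inr j) K) =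
        pullLeft N N' W H - pullRight N N' W H')
    (φ dφ : ExteriorAlgebra ℝ ((Fin N → ℝ) × W)) :
    fibreIntegral N N' W (extExp K * dK * pullLeft N N' W φ) + tau K dφ +
        ∑ j, basicIncl _ W (c' j) * contractGenerator j (tau K φ) + H' * tau K φ =
      tau K (dφ + ∑ i, basicIncl _ W (c i) * contractGenerator i φ + H * φ) := by
  have hE := gradeInv_extExp hK
  have hd : ∀ k, contractGenerator k (extExp K * pullLeft N N' W φ) =
      extExp K * contractGenerator k K * pullLeft N N' W φ +
        extExp K * contractGenerator k (pullLeft N N' W φ) := by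
    intro k
    have h : contractGenerator k (extExp K) = extExp K * contractGenerator k K :=
      contract_extExp _ hK
    rw [contractGenerator_mul, h, hE]
  have hcomm : ∀ a b, a * (extExp K * b) = extExp K * (a * b) := fun a b => by
    rw [← mul_assoc, ← mul_assoc, even_comm hE a]
  -- The generators of the dual side do not occur in `φ`, so `∂ⱼ` acts on `e^K` only.
  have h1 : ∀ j, basicIncl _ W (c' j) * contractGenerator j (tau K φ) =
      fibreIntegral N N' W (extExp K *
        (basicIncl _ W (c' j) * contractGenerator (Sum.inr j) K) * pullLeft N N' W φ) := by
    intro j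
    rw [tau_apply, ← fibreIntegral_contractGenerator_inr, hd, contractGenerator_inr_pullLeft,
      mul_zero, add_zero, ← fibreIntegral_pullRight_mul, pullRight_basicIncl, mul_assoc, hcomm]
    simp only [mul_assoc]
  -- Integration by parts: the integral of `∂ᵢ(e^K φ)` vanishes, which moves `∂ᵢ` from `e^K` to `φ`.
  have h2 : ∀ i, fibreIntegral N N' W (extExp K *
      (basicIncl _ W (c i) * contractGenerator (Sum.inl i) K) * pullLeft N N' W φ) =
      -tau K (basicIncl _ W (c i) * contractGenerator i φ) := by
    intro i
    have h := fibreIntegral_contractGenerator_inl i (extExp K * pullLeft N N' W φ)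
    have h' := congrArg (basicIncl _ W (c i) * ·) h
    rw [← fibreIntegral_pullRight_mul, pullRight_basicIncl, mul_zero, hd, mul_add, map_add,
      contractGenerator_inl_pullLeft] at h'
    rw [eq_neg_iff_add_eq_zero, ← h', tau_apply, map_mul (pullLeft N N' W), pullLeft_basicIncl,
      hcomm]
    simp only [mul_assoc, hcomm]
  have h3 : H' * tau K φ =
      fibreIntegral N N' W (extExp K * pullRight N N' W H' * pullLeft N N' W φ) := by
    rw [tau_apply, ← fibreIntegral_pullRight_mul, hcomm, mul_assoc]
  have h4 : tau K (H * φ) =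
      fibreIntegral N N' W (extExp K * pullLeft N N' W H * pullLeft N N' W φ) := by
    rw [tau_apply, map_mul (pullLeft N N' W), mul_assoc]
  have h5 : dK = pullLeft N N' W H - pullRight N N' W H' -
      (∑ i, basicIncl _ W (c i) * contractGenerator (Sum.inl i) K +
      ∑ j, basicIncl _ W (c' j) * contractGenerator (Sum.inr j) K) := eq_sub_of_add_eq hdK
  -- After substitution of `dK` the terms with `cⱼ'` and `H'` cancel those of the dual differential,
  -- leaving those with `cᵢ` and `H`.
  rw [h5, h3]
  simp only [mul_sub, mul_add, sub_mul, add_mul, map_sub, map_add, Finset.mul_sum, Finset.sum_mul,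
    map_sum, h1, h2, h4, Finset.sum_neg_distrib]
  abel

end TauAlgebra

/-! ### `τ_K` as an isomorphism of twisted complexes -/

section TauForms

variable {n : ℕ} {M : Type*} [TopologicalSpace M] [ChartedSpace (EuclideanSpace ℝ (Fin n)) M]
  {N N' : ℕ}

theorem baseForm_apply {κ : Type} (θ : Form n M) (x : M) :
    baseForm κ θ x = basicIncl κ _ (basicProj Empty _ (θ x)) := by
  have h : LinearMap.prodMap (0 : (Empty → ℝ) →ₗ[ℝ] κ → ℝ)
      (LinearMap.id : Module.Dual ℝ (TangentSpace (𝓡 n) x) →ₗ[ℝ] _) =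
      LinearMap.inr ℝ (κ → ℝ) (Module.Dual ℝ (TangentSpace (𝓡 n) x)) ∘ₗ
        LinearMap.snd ℝ (Empty → ℝ) _ := LinearMap.ext fun _ => rfl
  rw [baseForm, h, basicIncl, basicProj, ← AlgHom.comp_apply, ExteriorAlgebra.map_comp_map]

theorem inChart_tau (x₀ : M) (K : ExtForm n M (Fin N ⊕ Fin N')) (φ : ExtForm n M (Fin N))
    (y : EuclideanSpace ℝ (Fin n)) :
    inChart x₀ (fun x => tau (K x) (φ x)) y = tau (inChart x₀ K y) (inChart x₀ φ y) :=
  formMap_tau _ _ _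

theorem SmoothForm.tau {K : ExtForm n M (Fin N ⊕ Fin N')} (hK : SmoothForm K)
    {φ : ExtForm n M (Fin N)} (hφ : SmoothForm φ) : SmoothForm (fun x => tau (K x) (φ x)) :=
  fun x₀ => ((hK x₀).tau.apply (hφ x₀)).congr fun y _ => inChart_tau x₀ K φ y

variable {K : ExtForm n M (Fin N ⊕ Fin N')}

theorem gradeInv_inChart (he : ∀ x, gradeInv (K x) = K x) (x₀ : M) (y : EuclideanSpace ℝ (Fin n)) :
    gradeInv (inChart x₀ K y) = inChart x₀ K y := by
  rw [inChart_apply, toChart, ← formMap_gradeInv, he]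

theorem bijective_tau_inChart (he : ∀ x, gradeInv (K x) = K x)
    (h0 : ∀ x, Function.Bijective (CliffordCourant.tau (basicDegreeZero (K x)))) (x₀ : M)
    (y : EuclideanSpace ℝ (Fin n)) :
    Function.Bijective (CliffordCourant.tau (inChart x₀ K y)) := by
  refine bijective_tau (gradeInv_inChart he x₀ y) ?_
  rw [inChart_apply, toChart, basicDegreeZero_formMap]
  exact h0 _

/-- In each chart `τ_K` is a smooth family of isomorphisms, so its inverse is smooth as well. -/
theorem smoothForm_of_tau (hK : SmoothForm K) (he : ∀ x, gradeInv (K x) = K x)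
    (h0 : ∀ x, Function.Bijective (CliffordCourant.tau (basicDegreeZero (K x))))
    {φ : ExtForm n M (Fin N)}
    (hφ : SmoothForm (fun x => CliffordCourant.tau (K x) (φ x))) : SmoothForm φ := by
  intro x₀
  let e := fun y => LinearEquiv.ofBijective _ (bijective_tau_inChart he h0 x₀ y)
  have h1 : SmoothComponentsOn (fun y => (e y).symm.toLinearMap) (extChartAt (𝓡 n) x₀).target :=
    .inverse (isOpen_chart_target x₀) (hK x₀).tau
      (fun y _ => LinearMap.ext fun a => (e y).symm_apply_apply a)
      (fun y _ => LinearMap.ext fun a => (e y).apply_symm_apply a)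
  refine (h1.apply (hφ x₀)).congr fun y _ => ?_
  rw [inChart_tau]
  exact ((e y).symm_apply_apply _).symm

variable [IsManifold (𝓡 n) ∞ M]

theorem extDeriv_tau (hK : SmoothForm K) (he : ∀ x, gradeInv (K x) = K x)
    {φ : ExtForm n M (Fin N)} (hφ : SmoothForm φ) (x : M) :
    extDeriv (fun x => CliffordCourant.tau (K x) (φ x)) x =
      fibreIntegral N N' _ (extExp (K x) * extDeriv K x * pullLeft N N' _ (φ x)) +
        CliffordCourant.tau (K x) (extDeriv φ x) := by
  have hx := mem_extChartAt_source (I := 𝓡 n) x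
  have hy := (extChartAt (𝓡 n) x).map_source hx
  have hs := isOpen_chart_target (n := n) x
  have h1 : inChart x (fun x => CliffordCourant.tau (K x) (φ x)) =
      fun z => CliffordCourant.tau (inChart x K z) (inChart x φ z) :=
    funext fun z => inChart_tau x K φ z
  have h2 : ofChart (Fin N ⊕ Fin N') x x (extExp (inChart x K (extChartAt (𝓡 n) x x))) =
      extExp (K x) := by
    rw [← ofChart_inChart hx K]
    exact map_extExp _ _
  have h3 := ofChart_inChart hx K
  have h4 := ofChart_inChart hx φ
  rw [extDeriv_apply, h1, modelExtDeriv_tau ((hK x).hasDerivComponents hs hy)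
    (.of_forall (gradeInv_inChart he x)) ((hφ x).hasDerivComponents hs hy), map_add, extDeriv_apply,
    extDeriv_apply]
  congr 1
  · refine (formMap_fibreIntegral _ _).trans ?_
    rw [map_mul (formMap _ _), map_mul (formMap _ _), formMap_pullLeft]
    rw [ofChart] at h2 h4
    rw [h2, h4]
    rfl
  · refine (formMap_tau _ _ _).trans ?_
    rw [ofChart] at h3
    rw [h3]
    rfl

/-- The analytic part is the Leibniz rule for `τ_K`; the rest is the pointwise identity
`tau_intertwines`, fed with the equation for `dK`. -/
theorem twistedDeriv_tau (hK : SmoothForm K) (he : ∀ x, gradeInv (K x) = K x)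
    {c : Fin N → Form n M} {c' : Fin N' → Form n M} {H : ExtForm n M (Fin N)}
    {H' : ExtForm n M (Fin N')}
    (hd : ∀ x, totalDeriv (Sum.elim c c') K x = pullLeft N N' _ (H x) - pullRight N N' _ (H' x))
    {φ : ExtForm n M (Fin N)} (hφ : SmoothForm φ) :
    twistedDeriv c' H' (fun x => CliffordCourant.tau (K x) (φ x)) =
      fun x => CliffordCourant.tau (K x) (twistedDeriv c H φ x) := by
  funext x
  have h1 := hd x
  simp only [totalDeriv, Fintype.sum_sum_type, Sum.elim_inl, Sum.elim_inr, baseForm_apply] at h1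
  have h2 := tau_intertwines (he x) _ _ _ _ h1 (φ x) (extDeriv φ x)
  simp only [twistedDeriv, totalDeriv, baseForm_apply, extDeriv_tau hK he hφ]
  exact h2

end TauForms

/-! ### Transport of the algebroid along an isomorphism of complexes -/

section Transport

variable {n : ℕ} {M : Type*} [TopologicalSpace M] [ChartedSpace (EuclideanSpace ℝ (Fin n)) M]
  {N N' : ℕ}

theorem act_add_apply {x : M} (v w : CCFibre n (Fin N) x) (a : FormAt n (Fin N) x) :
    act (v + w) a = act v a + act w a :=
  LinearMap.congr_fun (map_add (actLinear n (Fin N) x) v w) a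

theorem act_smul_apply {x : M} (s : ℝ) (v : CCFibre n (Fin N) x) (a : FormAt n (Fin N) x) :
    act (s • v) a = s • act v a :=
  LinearMap.congr_fun (map_smul (actLinear n (Fin N) x) s v) a

set_option maxHeartbeats 1000000 in
/-- The isomorphism of Clifford–Courant bundles given by conjugation with an isomorphism of the
modules on which they act. -/
theorem exists_equiv_of_intertwiner {x : M} (e : FormAt n (Fin N) x ≃ₗ[ℝ] FormAt n (Fin N') x)
    {r : ℝ} (hr : r * r = 1) (he : ∀ a, e (gradeInv a) = r • gradeInv (e a))
    (hα : ∀ α a, e (basicι (Fin N) α * a) = basicι (Fin N') α * e a) :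
    ∃ T : CCFibre n (Fin N) x ≃ₗ[ℝ] CCFibre n (Fin N') x,
      (∀ v, (T v).1 = v.1) ∧ ∀ v a, act (T v) (e a) = e (act v a) := by
  have h1 : ∀ v : CCFibre n (Fin N) x, ∃ v' : CCFibre n (Fin N') x,
      act v' = e.toLinearMap ∘ₗ act v ∘ₗ e.symm.toLinearMap ∧
        tangentEval n x v'.1 = tangentEval n x v.1 := fun v =>
    exists_act_eq ((isCliffordOp_act v).conj_equiv e hr he hα)
  have he' : ∀ b, e.symm (gradeInv b) = r • gradeInv (e.symm b) := by
    intro b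
    rw [LinearEquiv.symm_apply_eq, map_smul, he, e.apply_symm_apply, smul_smul, hr, one_smul]
  have hα' : ∀ α b, e.symm (basicι (Fin N') α * b) = basicι (Fin N) α * e.symm b := by
    intro α b
    rw [LinearEquiv.symm_apply_eq, hα, e.apply_symm_apply]
  have h2 : ∀ v' : CCFibre n (Fin N') x, ∃ v : CCFibre n (Fin N) x,
      act v = e.symm.toLinearMap ∘ₗ act v' ∘ₗ e.symm.symm.toLinearMap ∧
        tangentEval n x v.1 = tangentEval n x v'.1 := fun v' =>
    exists_act_eq ((isCliffordOp_act v').conj_equiv e.symm hr he' hα')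
  choose T hT hT1 using h1
  have hTe : ∀ v a, act (T v) (e a) = e (act v a) := fun v a => by
    rw [hT]
    simp only [LinearMap.comp_apply, LinearEquiv.coe_coe, LinearEquiv.symm_apply_apply]
  -- Linearity is checked on operators, where conjugation is visibly linear, and descends because
  -- the action is faithful.
  let L : CCFibre n (Fin N) x →ₗ[ℝ] CCFibre n (Fin N') x :=
    { toFun := T
      map_add' := fun v w => act_injective (LinearMap.ext fun b => by
        obtain ⟨a, rfl⟩ := e.surjective b
        rw [act_add_apply, hTe, hTe, hTe, act_add_apply, map_add])
      map_smul' := fun s v => act_injective (LinearMap.ext fun b => by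
        obtain ⟨a, rfl⟩ := e.surjective b
        rw [RingHom.id_apply, act_smul_apply, hTe, hTe, act_smul_apply, map_smul]) }
  have hL : Function.Bijective L := by
    refine ⟨fun v w h => act_injective (LinearMap.ext fun a => e.injective ?_), fun v' => ?_⟩
    · rw [← hTe, ← hTe]
      exact congrArg (fun u => act u (e a)) h
    · obtain ⟨v, hv, -⟩ := h2 v'
      refine ⟨v, act_injective (LinearMap.ext fun b => ?_)⟩
      obtain ⟨a, rfl⟩ := e.surjective b
      refine (hTe v a).trans ?_
      rw [hv]
      simp only [LinearMap.comp_apply, LinearEquiv.coe_coe, LinearEquiv.apply_symm_apply,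
        LinearEquiv.symm_symm]
  exact ⟨LinearEquiv.ofBijective L hL, fun v => (tangentEval_bijective x).1 (hT1 v), hTe⟩

variable [IsManifold (𝓡 n) ∞ M] [T2Space M]

/-- Isomorphisms of Clifford–Courant bundles induced by an isomorphism of complexes are smooth and
compatible with brackets. -/
theorem smoothSection_iff_of_intertwiner {e : ∀ x : M, FormAt n (Fin N) x ≃ₗ[ℝ] FormAt n (Fin N') x}
    (hs : ∀ φ : ExtForm n M (Fin N), SmoothForm φ ↔ SmoothForm fun x => e x (φ x))
    {v : ∀ x : M, CCFibre n (Fin N) x} {v' : ∀ x : M, CCFibre n (Fin N') x}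
    (hv : ∀ x a, act (v' x) (e x a) = e x (act (v x) a)) :
    SmoothSection v ↔ SmoothSection v' := by
  refine ⟨fun h => smoothSection_of_actSection fun φ' hφ' => ?_,
    fun h => smoothSection_of_actSection fun φ hφ => ?_⟩
  · obtain ⟨φ, rfl⟩ : ∃ φ : ExtForm n M (Fin N), (fun x => e x (φ x)) = φ' :=
      ⟨fun x => (e x).symm (φ' x), funext fun x => (e x).apply_symm_apply _⟩
    have h1 := (hs _).mp (SmoothForm.actSection h ((hs φ).mpr hφ'))
    have h2 : actSection v' (fun x => e x (φ x)) = fun x => e x (actSection v φ x) :=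
      funext fun x => hv x (φ x)
    rwa [h2]
  · have h2 : actSection v' (fun x => e x (φ x)) = fun x => e x (actSection v φ x) :=
      funext fun x => hv x (φ x)
    rw [hs, ← h2]
    exact SmoothForm.actSection h ((hs φ).mp hφ)

/-- The derived bracket is a polynomial in the two actions and the twisted differential, all
intertwined by `e`; as `e` is also a bijection between smooth forms, the two conditions test the
same identity. -/
theorem isBracket_iff_of_intertwiner {e : ∀ x : M, FormAt n (Fin N) x ≃ₗ[ℝ] FormAt n (Fin N') x}
    (hs : ∀ φ : ExtForm n M (Fin N), SmoothForm φ ↔ SmoothForm fun x => e x (φ x))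
    {c : Fin N → Form n M} {c' : Fin N' → Form n M} {H : ExtForm n M (Fin N)}
    {H' : ExtForm n M (Fin N')}
    (hD : ∀ φ : ExtForm n M (Fin N), SmoothForm φ →
      twistedDeriv c' H' (fun x => e x (φ x)) = fun x => e x (twistedDeriv c H φ x))
    {v w u : ∀ x : M, CCFibre n (Fin N) x} {v' w' u' : ∀ x : M, CCFibre n (Fin N') x}
    (hv : ∀ x a, act (v' x) (e x a) = e x (act (v x) a))
    (hw : ∀ x a, act (w' x) (e x a) = e x (act (w x) a))
    (hu : ∀ x a, act (u' x) (e x a) = e x (act (u x) a))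
    (hvs : SmoothSection v) (hws : SmoothSection w) :
    IsBracket c H v w u ↔ IsBracket c' H' v' w' u' := by
  have h1 : ∀ {v : ∀ x : M, CCFibre n (Fin N) x} {v' : ∀ x : M, CCFibre n (Fin N') x},
      (∀ x a, act (v' x) (e x a) = e x (act (v x) a)) → ∀ φ : ExtForm n M (Fin N),
      actSection v' (fun x => e x (φ x)) = fun x => e x (actSection v φ x) :=
    fun hv φ => funext fun x => hv x (φ x)
  have h2 : ∀ φ : ExtForm n M (Fin N), SmoothForm φ →
      derivedBracket (actSection v') (twistedDeriv c' H') (actSection w') (fun x => e x (φ x)) =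
        fun x => e x (derivedBracket (actSection v) (twistedDeriv c H) (actSection w) φ x) := by
    intro φ hφ
    have hwφ := SmoothForm.actSection hws hφ
    have hvφ := SmoothForm.actSection hvs hφ
    have hadd : ∀ θ η : ExtForm n M (Fin N),
        ((fun x => e x (θ x)) + fun x => e x (η x)) = fun x => e x ((θ + η) x) :=
      fun θ η => funext fun x => (map_add (e x) _ _).symm
    have hsub : ∀ θ η : ExtForm n M (Fin N),
        ((fun x => e x (θ x)) - fun x => e x (η x)) = fun x => e x ((θ - η) x) :=
      fun θ η => funext fun x => (map_sub (e x) _ _).symm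
    rw [derivedBracket, h1 hw, hD _ hwφ, h1 hv, h1 hv, hD _ (.actSection hvs hwφ), hadd, hD _ hφ,
      h1 hv, h1 hv, hD _ hvφ, hadd, h1 hw, hsub]
    rfl
  refine and_congr (smoothSection_iff_of_intertwiner hs hu) ⟨fun h φ' hφ' => ?_, fun h φ hφ => ?_⟩
  · obtain ⟨φ, rfl⟩ : ∃ φ : ExtForm n M (Fin N), (fun x => e x (φ x)) = φ' :=
      ⟨fun x => (e x).symm (φ' x), funext fun x => (e x).apply_symm_apply _⟩
    have hφ := (hs φ).mpr hφ'
    rw [h2 φ hφ, h1 hu, h φ hφ]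
  · have h3 := h _ ((hs φ).mp hφ)
    rw [h2 φ hφ, h1 hu] at h3
    exact funext fun x => (e x).injective (congrFun h3 x)

end Transport

/-! ### Parity of the structure forms -/

section Twists

variable {n l r N : ℕ}
  {M : Type*} [TopologicalSpace M] [ChartedSpace (EuclideanSpace ℝ (Fin n)) M]
  {F : Type*} [TopologicalSpace F] [ChartedSpace (EuclideanSpace ℝ (Fin l)) F]
  {E : Type*} [TopologicalSpace E] [ChartedSpace (EuclideanSpace ℝ (Fin r)) E]
  {π : E → M}

theorem TransgressiveGeneratingSet.gradeInv_c (Ψ : TransgressiveGeneratingSet n l r F π N)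
    (k : Fin N) (x : M) : gradeInv (Ψ.c k x) = Ψ.c k x :=
  mem_evenPart_iff.mp (exteriorPower_le_evenPart (Ψ.odd_degree k).add_one (Ψ.c_mem k x))

theorem Twist.gradeInv_comp {Ψ : TransgressiveGeneratingSet n l r F π N} (H : Twist Ψ) (x : M) :
    gradeInv (H.comp x) = -H.comp x := mem_oddPart_iff.mp (H.odd x)

end Twists

end CliffordCourant

end

/-! ### The T-duality isomorphism -/

open CliffordCourant in
theorem theorem3p2 {n l r l' r' N N' : ℕ}
    {M : Type*} [TopologicalSpace M] [T2Space M] [SecondCountableTopology M]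
    [ChartedSpace (EuclideanSpace ℝ (Fin n)) M] [IsManifold (𝓡 n) ∞ M]
    {F : Type*} [TopologicalSpace F] [T2Space F] [SecondCountableTopology F]
    [ChartedSpace (EuclideanSpace ℝ (Fin l)) F] [IsManifold (𝓡 l) ∞ F]
    {E : Type*} [TopologicalSpace E] [T2Space E] [SecondCountableTopology E]
    [ChartedSpace (EuclideanSpace ℝ (Fin r)) E] [IsManifold (𝓡 r) ∞ E]
    {F' : Type*} [TopologicalSpace F'] [T2Space F'] [SecondCountableTopology F']
    [ChartedSpace (EuclideanSpace ℝ (Fin l')) F'] [IsManifold (𝓡 l') ∞ F']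
    {E' : Type*} [TopologicalSpace E'] [T2Space E'] [SecondCountableTopology E']
    [ChartedSpace (EuclideanSpace ℝ (Fin r')) E'] [IsManifold (𝓡 r') ∞ E']
    {π : E → M} (_hπ : IsSmoothFibreBundle n l r F π)
    {π' : E' → M} (_hπ' : IsSmoothFibreBundle n l' r' F' π')
    (Ψ : TransgressiveGeneratingSet n l r F π N)
    (Ψ' : TransgressiveGeneratingSet n l' r' F' π' N')
    (H : Twist Ψ) (H' : Twist Ψ')
    (K : ExtForm n M (Fin N ⊕ Fin N')) (_hK : IsTDualityKernel H H' K) :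
    (∀ v w : ∀ x : M, CCFibre n (Fin N) x, SmoothSection v → SmoothSection w →
      ∃! u, IsBracket Ψ.c H.comp v w u) ∧
    (∀ v w : ∀ x : M, CCFibre n (Fin N') x, SmoothSection v → SmoothSection w →
      ∃! u, IsBracket Ψ'.c H'.comp v w u) ∧
    ∃ T : ∀ x : M, CCFibre n (Fin N) x ≃ₗ[ℝ] CCFibre n (Fin N') x,
      (∀ v : ∀ x : M, CCFibre n (Fin N) x,
        SmoothSection v ↔ SmoothSection fun x => T x (v x)) ∧
      (∀ x v, (T x v).1 = v.1) ∧
      (∀ x (v : CCFibre n (Fin N) x) (v' : CCFibre n (Fin N') x),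
        v' = T x v ↔ ∀ φ : FormAt n (Fin N) x, tau (K x) (act v φ) = act v' (tau (K x) φ)) ∧
      (∀ v w u : ∀ x : M, CCFibre n (Fin N) x,
        SmoothSection v → SmoothSection w →
        (IsBracket Ψ.c H.comp v w u ↔
          IsBracket Ψ'.c H'.comp (fun x => T x (v x)) (fun x => T x (w x))
            (fun x => T x (u x)))) := by
  have he : ∀ x, gradeInv (K x) = K x := fun x => mem_evenPart_iff.mp (_hK.even x)
  have h0 := _hK.nondegenerate
  let e : ∀ x : M, FormAt n (Fin N) x ≃ₗ[ℝ] FormAt n (Fin N') x := fun x =>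
    LinearEquiv.ofBijective (tau (K x)) (bijective_tau (he x) (h0 x))
  have hs : ∀ φ : ExtForm n M (Fin N), SmoothForm φ ↔ SmoothForm fun x => e x (φ x) := fun φ =>
    ⟨fun h => SmoothForm.tau _hK.smooth h, fun h => smoothForm_of_tau _hK.smooth he h0 h⟩
  -- `(-1) ^ N` is the sign by which `τ_K` changes parity; only its square matters for conjugation.
  have hr : (-1 : ℝ) ^ N * (-1) ^ N = 1 := by rw [← mul_pow]; norm_num
  choose T hT1 hT using fun x => exists_equiv_of_intertwiner (e x) hr
    (fun a => tau_gradeInv (he x) a) (fun α a => tau_basicι_mul (he x) α a)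
  refine ⟨fun v w hv hw => existsUnique_isBracket Ψ.gradeInv_c H.gradeInv_comp Ψ.smooth_c H.smooth
      hv hw,
    fun v w hv hw => existsUnique_isBracket Ψ'.gradeInv_c H'.gradeInv_comp Ψ'.smooth_c H'.smooth
      hv hw, T, fun v => smoothSection_iff_of_intertwiner hs fun x => hT x (v x), hT1,
    fun x v v' => ⟨?_, fun h => ?_⟩, fun v w u hv hw => ?_⟩
  · rintro rfl φ
    exact (hT x v φ).symm
  -- `τ_K` is surjective, so the intertwining property determines the operator of `v'`, and the
  -- action is faithful.
  · refine act_injective (LinearMap.ext fun b => ?_)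
    obtain ⟨a, rfl⟩ := (e x).surjective b
    exact (h a).symm.trans (hT x v a).symm
  · exact isBracket_iff_of_intertwiner hs
      (fun φ hφ => twistedDeriv_tau _hK.smooth he _hK.gerbe_trivialization hφ)
      (fun x => hT x (v x)) (fun x => hT x (w x)) (fun x => hT x (u x)) hv hw
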